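/- **Setting.** Let $G$ be a (second countable, Hausdorff, finite-dimensional) real unimodular Lie group with Lie algebra $\mathfrak g$ and Haar measure $du$, let $n,g\ge 0$ be integers and $\hbar\in\mathbb R\setminus\{0\}$. Points of $G^{n+2g}$ are written $u=(u_{M_1},\dots,u_{M_n},u_{A_1},u_{B_1},\dots,u_{A_g},u_{B_g})$. Put $u_{K_k}=u_{B_k}u_{A_k}^{-1}u_{B_k}^{-1}u_{A_k}$ and $$\Phi_\infty(u)=u_{K_g}\cdots u_{K_1}\,u_{M_n}\cdots u_{M_1}.$$ Let $\mathrm{Ad}_hx=hxh^{-1}$ on $G$, and on $G^{n+2g}$ componentwise. $G\ltimes C^\infty(G)$ is the group of pairs $(h,f)$, $h\in G$, $f\in C^\infty(G,\mathbb R)$, with $(h_1,f_1)(h_2,f_2)=(h_1h_2,\,f_1+f_2\circ\mathrm{Ad}_{h_1^{-1}})$. **The quantum algebra.** For each loop $X\in\{M_i,A_k,B_k\}$ take a copy $\{t_X(\xi):\xi\in\mathfrak g\}$ of $\mathfrak g$ and let $h\in G$ act on $G^{n+2g}$ by changing only: for $X=M_i$: $u_{M_i}\mapsto h^{-1}u_{M_i}h$;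 for $X=A_k$: $u_{A_k}\mapsto u_{A_k}h$, $u_{B_k}\mapsto u_{A_k}hu_{A_k}^{-1}u_{B_k}$; for $X=B_k$: $u_{B_k}\mapsto u_{B_k}h$. Denote the result by $u\cdot_Xh$ and put $\{t_X(\xi),F\}(u)=-\frac{d}{dt}\big|_{0}F(u\cdot_Xe^{t\xi})$. (In terms of the decoupled generators $j_{X'}$: $t_{M_i}=j_{M_i'}$, $t_{A_k}=j_{A_k'}-j_{B_k'}$, $t_{B_k}=j_{B_k'}$.) $\hat{\mathcal F}=U(\bigoplus_X\mathfrak g)\ltimes C^\infty(G^{n+2g},\mathbb C)$ is the unital complex algebra generated by the (real-linear) symbols $t_X(\xi)$ and by the algebra $C^\infty(G^{n+2g},\mathbb C)$, with relations $$[t_X(\xi),t_X(\eta)]=-i\hbar\,t_X([\xi,\eta]),\quad [t_X(\xi),t_Y(\eta)]=0\ (X\ne Y),\quad [t_X(\xi),F]=i\hbar\,\{t_X(\xi),F\}.$$ For a smooth $s=\sum_bs_be_b:G^{n+2g}\to\mathfrak g$ ($(e_b)$ a basis of $\mathfrak g$) put $t_X(s)=\sum_bs_b\,t_X(e_b)$,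 $j_{A_k'}(s)=t_{A_k}(s)+t_{B_k}(s)$, $j_{B_k'}(s)=t_{B_k}(s)$ and $$H_k(s)=j_{A_k'}\big((1-\mathrm{Ad}(u_{A_k}^{-1}))s\big)+j_{B_k'}\big((\mathrm{Ad}(u_{A_k}^{-1})-\mathrm{Ad}(u_{B_k}^{-1}u_{A_k}))s\big).$$ The (undecoupled) generators of the quantum flower algebra are $$\begin{aligned} j_{M_i}(\xi)&=t_{M_i}(\xi)+\sum_{k>i}t_{M_k}\big((1-\mathrm{Ad}(u_{M_i}))\xi\big)+\sum_{k=1}^gH_k\big((1-\mathrm{Ad}(u_{M_i}))\xi\big),\\ j_{A_i}(\xi)&=j_{A_i'}(\xi)-j_{A_i'}(\mathrm{Ad}(u_{A_i}^{-1})\xi)+j_{B_i'}(\mathrm{Ad}(u_{A_i}^{-1})\xi)+\sum_{k>i}H_k\big((1-\mathrm{Ad}(u_{A_i}))\xi\big),\\ j_{B_i}(\xi)&=j_{B_i'}(\xi)-j_{A_i'}(\mathrm{Ad}(u_{A_i}^{-1})\xi)+j_{B_i'}(\mathrm{Ad}(u_{A_i}^{-1})\xi)+\sum_{k>i}H_k\big((1-\mathrm{Ad}(u_{B_i}))\xi\big).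 \end{aligned}$$ For smooth $s:G^{n+2g}\to\mathfrak g$ let $R_Y(s),L_Y(s),C_Y(s)$ be the vector fields generated by $u_Y\mapsto u_Ye^{ts}$, $u_Y\mapsto e^{-ts}u_Y$, $u_Y\mapsto e^{-ts}u_Ye^{ts}$ (the other components fixed). The classical flower-algebra brackets with functions are $$\begin{aligned} \{j_{M_i}(\xi),F\}&=-C_{M_i}(\xi)F-\sum_{Y>M_i}C_Y\big((1-\mathrm{Ad}(u_{M_i}))\xi\big)F,\\ \{j_{A_i}(\xi),F\}&=-C_{A_i}(\xi)F-C_{B_i}(\xi)F-R_{B_i}\big(\mathrm{Ad}(u_{B_i}^{-1}u_{A_i})\xi\big)F-\sum_{Y>B_i}C_Y\big((1-\mathrm{Ad}(u_{A_i}))\xi\big)F,\\ \{j_{B_i}(\xi),F\}&=-L_{A_i}(\xi)F-C_{B_i}(\xi)F-\sum_{Y>B_i}C_Y\big((1-\mathrm{Ad}(u_{B_i}))\xi\big)F, \end{aligned}$$ for the order $M_1<\dots<M_n<A_1<B_1<\dots<A_g<B_g$. The quantum action of $G\ltimes C^\infty(G)$ on $\hat{\mathcal F}$ is the action by algebra automorphisms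 $\widehat{(h,f)}$ with $$\widehat{(h,f)}F=F\circ\mathrm{Ad}_{h^{-1}},\qquad \widehat{(h,f)}\,j_X(\xi)=j_X(\mathrm{Ad}(h)\xi)+\{j_X(\mathrm{Ad}(h)\xi),\,f\circ\Phi_\infty\}.$$ **The representation spaces.** Let $g_{\mu_1},\dots,g_{\mu_n}\in G$ have centralisers $N_1,\dots,N_n$, let $\Pi_{s_i}$ be a strongly continuous unitary representation of $N_i$ on a Hilbert space $V_{s_i}$, and let $m_i\neq0$ be a $G$-invariant Borel measure on $G/N_i$, finite on compact sets. Let $Q=G/N_1\times\dots\times G/N_n\times G^{2g}$. $V_{\mu_1s_1\dots\mu_ns_n}$ is the space of (strongly) measurable $\psi:G^{n+2g}\to V_{s_1}\otimes\dots\otimes V_{s_n}$ (Hilbert tensor product) with $$\psi(v_{M_1}k_1,\dots,v_{M_n}k_n,u_{A_1},\dots,u_{B_g})=\big(\Pi_{s_1}(k_1^{-1})\otimes\dots\otimes\Pi_{s_n}(k_n^{-1})\big)\psi(v_{M_1},\dots,u_{B_g})\quad(k_i\in N_i)$$ and $\|\psi\|<\infty$, modulo zero-norm states, where $\langle\psi,\phi\rangle=\int_Q(\psi,\phi)\,dm_1\cdots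 dm_n\,du_{A_1}\cdots du_{B_g}$. $V^\infty_{\mu_1s_1\dots\mu_ns_n}$ is the space of smooth such $\psi$ whose support has compact image in $Q$. Let $\beta$ replace $v_{M_i}$ by $v_{M_i}g_{\mu_i}v_{M_i}^{-1}$ and leave $u_{A_k},u_{B_k}$ unchanged. The representation $\Pi$ of $\hat{\mathcal F}$ on $V^\infty_{\mu_1s_1\dots\mu_ns_n}$ is given by $$\Pi(F)\psi=(F\circ\beta)\,\psi,\qquad \Pi(t_X(\xi))\psi(v)=-i\hbar\tfrac{d}{dt}\big|_{0}\psi(v\ast_Xe^{t\xi}),$$ where $v\ast_{M_i}h$ replaces $v_{M_i}$ by $h^{-1}v_{M_i}$, and $v\ast_{A_k}h=v\cdot_{A_k}h$, $v\ast_{B_k}h=v\cdot_{B_k}h$. **Theorem (Representations of $G\ltimes C^\infty(G)$).** The representation $\Pi$ of $\hat{\mathcal F}$ on $V^\infty_{\mu_1s_1\dots\mu_ns_n}$ and the quantum action $(h,f)\mapsto\widehat{(h,f)}$ of $G\ltimes C^\infty(G)$ on $\hat{\mathcal F}$ exist and are uniquely determined by the formulas above, and the natural map $V^\infty_{\mu_1s_1\dots\mu_ns_n}\to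 V_{\mu_1s_1\dots\mu_ns_n}$ is well defined and injective. The formula $$\Gamma(h,f)\psi(v_{M_1},\dots,v_{M_n},u_{A_1},\dots,u_{B_g})=e^{\frac i\hbar f(u_{tot})}\,\psi(h^{-1}v_{M_1},\dots,h^{-1}v_{M_n},h^{-1}u_{A_1}h,\dots,h^{-1}u_{B_g}h),\qquad u_{tot}=\Phi_\infty(\beta(v)),$$ defines a unitary representation $\Gamma$ of $G\ltimes C^\infty(G)$ on $V_{\mu_1s_1\dots\mu_ns_n}$. It leaves the subspace $V^\infty_{\mu_1s_1\dots\mu_ns_n}$ invariant, and on this subspace $$\Pi\big(\widehat{(h,f)}\,Z\big)=\Gamma(h,f)\circ\Pi(Z)\circ\Gamma(h,f)^{-1}\qquad\text{for all }Z\in\hat{\mathcal F},\ (h,f)\in G\ltimes C^\infty(G).$$ -/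

import Mathlib

open scoped TensorProduct Manifold ContDiff
open MeasureTheory

noncomputable section
namespace FlowerAlgebra

section HilbertTensor

variable {ι : Type*} [Fintype ι] (V : ι → Type*) [∀ i, NormedAddCommGroup (V i)]
  [∀ i, InnerProductSpace ℂ (V i)]

/-- The algebraic tensor product of a finite family of Hilbert spaces (a type synonym, to be
equipped with the Hilbert tensor inner product). -/
def AlgTensor : Type _ := ⨂[ℂ] i, V i

instance : AddCommGroup (AlgTensor V) := inferInstanceAs (AddCommGroup (⨂[ℂ] i, V i))
instance : Module ℂ (AlgTensor V) := inferInstanceAs (Module ℂ (⨂[ℂ] i, V i))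

variable {V}

/-- The pure tensor `x₁ ⊗ ⋯ ⊗ xₙ`. -/
def pureT (x : ∀ i, V i) : AlgTensor V := PiTensorProduct.tprod ℂ x

/-- `y ↦ ∏ ⟪x i, y i⟫`. -/
def prodInner (x : ∀ i, V i) : MultilinearMap ℂ V ℂ where
  toFun y := ∏ i, inner ℂ (x i) (y i)
  map_update_add' y i a b := by
    classical
    rw [← Finset.prod_erase_mul _ _ (Finset.mem_univ i), ← Finset.prod_erase_mul _ _ (Finset.mem_univ i), ← Finset.prod_erase_mul _ _ (Finset.mem_univ i)]
    simp only [Function.update_self, inner_add_right, mul_add]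
    congr 1 <;> congr 1 <;>
    · refine Finset.prod_congr rfl fun j hj => ?_
      simp [Function.update_of_ne (Finset.ne_of_mem_erase hj)]
  map_update_smul' y i c a := by
    classical
    rw [← Finset.prod_erase_mul _ _ (Finset.mem_univ i), ← Finset.prod_erase_mul _ _ (Finset.mem_univ i)]
    simp only [Function.update_self, inner_smul_right, smul_eq_mul]
    rw [mul_left_comm]
    congr 2
    refine Finset.prod_congr rfl fun j hj => ?_
    simp [Function.update_of_ne (Finset.ne_of_mem_erase hj)]

/-- `t ↦ ⟪x₁ ⊗ ⋯ ⊗ xₙ, t⟫`, as a linear functional. -/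
def pureForm (x : ∀ i, V i) : AlgTensor V →ₗ[ℂ] ℂ := PiTensorProduct.lift (prodInner x)

theorem pureForm_pureT (x y : ∀ i, V i) : pureForm x (pureT y) = ∏ i, inner ℂ (x i) (y i) :=
  PiTensorProduct.lift.tprod y

theorem algTensor_induction {p : AlgTensor V → Prop} (h : ∀ (c : ℂ) x, p (c • pureT x))
    (ha : ∀ s t, p s → p t → p (s + t)) (t : AlgTensor V) : p t :=
  PiTensorProduct.induction_on t h ha

/-- `t ↦ ⟪t, x₁ ⊗ ⋯ ⊗ xₙ⟫`, as a conjugate-linear functional. -/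
def conjPureForm (x : ∀ i, V i) : AlgTensor V →ₗ⋆[ℂ] ℂ :=
  (starLinearEquiv ℂ (A := ℂ)).toLinearMap.comp (pureForm x)

theorem conjPureForm_smul_pureT (x y : ∀ i, V i) (c : ℂ) :
    conjPureForm x (c • pureT y) = starRingEnd ℂ c * ∏ i, inner ℂ (y i) (x i) := by
  change star (pureForm x (c • pureT y)) = _
  rw [map_smul, pureForm_pureT]
  simp

/-- `x ↦ (t ↦ ⟪t, x₁ ⊗ ⋯ ⊗ xₙ⟫)`. -/
def conjForm : MultilinearMap ℂ V (AlgTensor V →ₗ⋆[ℂ] ℂ) where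
  toFun := conjPureForm
  map_update_add' x i a b := by
    ext t
    induction t using algTensor_induction with
    | h c y =>
      have := (prodInner y).map_update_add x i a b
      simp only [prodInner, MultilinearMap.coe_mk] at this
      rw [LinearMap.add_apply, conjPureForm_smul_pureT, conjPureForm_smul_pureT,
        conjPureForm_smul_pureT, this, mul_add]
    | ha s t hs ht => rw [map_add, map_add, hs, ht]
  map_update_smul' x i r a := by
    ext t
    induction t using algTensor_induction with
    | h c y =>
      have := (prodInner y).map_update_smul x i r a
      simp only [prodInner, MultilinearMap.coe_mk] at this
      rw [LinearMap.smul_apply, conjPureForm_smul_pureT, conjPureForm_smul_pureT, this,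
        smul_eq_mul, smul_eq_mul, mul_left_comm]
    | ha s t hs ht => rw [map_add, map_add, hs, ht]

/-- `t ↦ (s ↦ ⟪s, t⟫)`. -/
def tensorForm : AlgTensor V →ₗ[ℂ] AlgTensor V →ₗ⋆[ℂ] ℂ := PiTensorProduct.lift conjForm

theorem tensorForm_pureT (x y : ∀ i, V i) :
    tensorForm (pureT y) (pureT x) = ∏ i, inner ℂ (x i) (y i) := by
  have : tensorForm (pureT y) = conjForm y := PiTensorProduct.lift.tprod y
  rw [this]
  change conjPureForm y (pureT x) = _
  simpa using conjPureForm_smul_pureT y x 1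

theorem tensorForm_sum {κ : Type*} [Fintype κ] (c : κ → ℂ) (x : κ → ∀ i, V i) :
    tensorForm (∑ k, c k • pureT (x k)) (∑ k, c k • pureT (x k)) =
      ∑ k, ∑ l, star (c k) * c l * ∏ i, inner ℂ (x k i) (x l i) := by
  simp only [map_sum, LinearMap.sum_apply, map_smul, LinearMap.smul_apply, LinearMap.map_smulₛₗ,
    tensorForm_pureT, smul_eq_mul]
  simp only [Finset.mul_sum]
  refine Finset.sum_congr rfl fun k _ => Finset.sum_congr rfl fun l _ => ?_
  simp [mul_assoc]

theorem exists_sum_pureT (t : AlgTensor V) :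
    ∃ (m : ℕ) (c : Fin m → ℂ) (x : Fin m → ∀ i, V i), t = ∑ k, c k • pureT (x k) := by
  induction t using algTensor_induction with
  | h c x => exact ⟨1, fun _ => c, fun _ => x, by simp⟩
  | ha s t hs ht =>
    obtain ⟨m, c, x, rfl⟩ := hs
    obtain ⟨m', c', x', rfl⟩ := ht
    refine ⟨m + m', Fin.append c c', Fin.append x x', ?_⟩
    simp [Fin.sum_univ_add]

open scoped ComplexOrder in
theorem posSemidef_prod_gram {m : ℕ} (x : Fin m → ∀ i, V i) (s : Finset ι) :
    (Matrix.of fun k l => ∏ i ∈ s, inner ℂ (x k i) (x l i) : Matrix (Fin m) (Fin m) ℂ).PosSemidef := by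
  classical
  induction s using Finset.induction_on with
  | empty =>
    have := Matrix.posSemidef_gram ℂ (fun _ : Fin m => (1 : ℂ))
    refine (congrArg Matrix.PosSemidef ?_).mpr this
    ext k l
    simp
  | insert a s ha ih =>
    have := (Matrix.posSemidef_gram ℂ (fun k => x k a)).hadamard ih
    refine (congrArg Matrix.PosSemidef ?_).mpr this
    ext k l
    simp [Finset.prod_insert ha]

instance tensorCore : PreInnerProductSpace.Core ℂ (AlgTensor V) where
  inner s t := tensorForm t s
  conj_inner_symm s t := by
    induction s using algTensor_induction with
    | ha s s' hs hs' => simp only [map_add, LinearMap.add_apply, hs, hs']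
    | h c x =>
      induction t using algTensor_induction with
      | ha t t' ht ht' => simp only [map_add, LinearMap.add_apply, ht, ht']
      | h d y =>
        simp only [map_smul, LinearMap.smul_apply, LinearMap.map_smulₛₗ, tensorForm_pureT]
        simp [mul_left_comm]
  re_inner_nonneg t := by
    obtain ⟨m, c, x, rfl⟩ := exists_sum_pureT t
    rw [tensorForm_sum]
    have h := (posSemidef_prod_gram x Finset.univ).re_dotProduct_nonneg c
    convert h using 2
    simp only [dotProduct, Matrix.mulVec, Finset.mul_sum, Matrix.of_apply, Pi.star_apply]
    exact Finset.sum_congr rfl fun k _ => Finset.sum_congr rfl fun l _ => by ring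
  add_left s s' t := map_add _ _ _
  smul_left s t c := by simp 

instance : SeminormedAddCommGroup (AlgTensor V) :=
  InnerProductSpace.Core.toSeminormedAddCommGroup (𝕜 := ℂ)

instance : InnerProductSpace ℂ (AlgTensor V) := InnerProductSpace.ofCore _

theorem inner_pureT (x y : ∀ i, V i) :
    inner ℂ (pureT x) (pureT y) = ∏ i, inner ℂ (x i) (y i) := tensorForm_pureT x y

variable (V) in
/-- The Hilbert tensor product `V₁ ⊗ ⋯ ⊗ Vₙ`: the completion of the algebraic tensor product for
the inner product `⟪x₁ ⊗ ⋯ ⊗ xₙ, y₁ ⊗ ⋯ ⊗ yₙ⟫ = ∏ ⟪x i, y i⟫`. -/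
abbrev HilbertTensor : Type _ := UniformSpace.Completion (AlgTensor V)

/-- `U₁ ⊗ ⋯ ⊗ Uₙ` as a linear map on the algebraic tensor product. -/
def algTensorLin (U : ∀ i, V i ≃ₗᵢ[ℂ] V i) : AlgTensor V →ₗ[ℂ] AlgTensor V :=
  PiTensorProduct.map fun i => (U i).toLinearEquiv.toLinearMap

theorem algTensorLin_pureT (U : ∀ i, V i ≃ₗᵢ[ℂ] V i) (x : ∀ i, V i) :
    algTensorLin U (pureT x) = pureT fun i => U i (x i) :=
  PiTensorProduct.map_tprod _ x

/-- `U₁ ⊗ ⋯ ⊗ Uₙ` as an isometry of the algebraic tensor product. -/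
def algTensorMap (U : ∀ i, V i ≃ₗᵢ[ℂ] V i) : AlgTensor V →ₗᵢ[ℂ] AlgTensor V :=
  LinearMap.isometryOfInner (algTensorLin U) fun s t => by
    induction s using algTensor_induction with
    | ha s s' hs hs' => rw [map_add, inner_add_left, inner_add_left, hs, hs']
    | h c x =>
      induction t using algTensor_induction with
      | ha t t' ht ht' => rw [map_add, inner_add_right, inner_add_right, ht, ht']
      | h d y =>
        rw [map_smul, map_smul, algTensorLin_pureT, algTensorLin_pureT, inner_smul_left,
          inner_smul_left, inner_smul_right, inner_smul_right, inner_pureT, inner_pureT]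
        simp

/-- `U₁ ⊗ ⋯ ⊗ Uₙ` on the Hilbert tensor product, for unitary operators `U i`. -/
def hilbertTensorMap (U : ∀ i, V i ≃ₗᵢ[ℂ] V i) : HilbertTensor V →ₗᵢ[ℂ] HilbertTensor V where
  toLinearMap := (algTensorMap U).toContinuousLinearMap.completion.toLinearMap
  norm_map' t := by
    change ‖(algTensorMap U).toContinuousLinearMap.completion t‖ = ‖t‖
    induction t using UniformSpace.Completion.induction_on with
    | hp =>
      exact isClosed_eq (continuous_norm.comp (ContinuousLinearMap.continuous _)) continuous_norm
    | ih t => simp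

end HilbertTensor
section Smooth
variable {E : Type*} [NormedAddCommGroup E] [NormedSpace ℝ E] {G : Type*} [TopologicalSpace G]
  [ChartedSpace E G] {κ : Type*} [Fintype κ]
variable (E κ) in
/-- The model of the product manifold `κ → G`. -/
abbrev powModel : ModelWithCorners ℝ (κ → E) (ModelPi fun _ : κ => E) :=
  ModelWithCorners.pi fun _ : κ => 𝓘(ℝ, E)

variable {E' : Type*} [NormedAddCommGroup E'] [NormedSpace ℝ E'] {H' : Type*} [TopologicalSpace H']
  {I' : ModelWithCorners ℝ E' H'} {M : Type*} [TopologicalSpace M] [ChartedSpace H' M]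

theorem contMDiff_pow {f : M → κ → G} (hf : ∀ k, ContMDiff I' 𝓘(ℝ, E) ∞ fun m => f m k) :
    ContMDiff I' (powModel E κ) ∞ f := by
  intro m
  rw [contMDiffAt_iff]
  refine ⟨(continuous_pi fun k => (hf k).continuous).continuousAt, ?_⟩
  rw [contDiffWithinAt_pi]
  intro k
  exact (contMDiffAt_iff.1 (hf k m)).2

theorem contMDiff_coord (k : κ) :
    ContMDiff (powModel E κ) 𝓘(ℝ, E) ∞ fun u : κ → G => u k := by
  intro u
  rw [contMDiffAt_iff]
  refine ⟨(continuous_apply k).continuousAt, ?_⟩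
  have h0 : ContDiffWithinAt ℝ ∞ (fun y : κ → E => y k) (Set.range (powModel E κ))
      (extChartAt (powModel E κ) u u) :=
    (contDiff_apply ℝ E k).contDiffWithinAt
  have key : ∀ y ∈ (extChartAt (powModel E κ) u).target,
      (extChartAt 𝓘(ℝ, E) (u k) ∘ (fun u : κ → G => u k) ∘ (extChartAt (powModel E κ) u).symm) y
        = y k := by
    intro y hy
    have hk : y k ∈ (extChartAt 𝓘(ℝ, E) (u k)).target := by
      simp only [extChartAt, OpenPartialHomeomorph.extend, PartialEquiv.trans_target] at hy ⊢
      exact ⟨Set.mem_univ _, hy.2 k (Set.mem_univ k)⟩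
    exact (extChartAt 𝓘(ℝ, E) (u k)).right_inv hk
  exact h0.congr_of_eventuallyEq
    (Filter.eventually_of_mem (extChartAt_target_mem_nhdsWithin (I := powModel E κ) u) key)
    (key _ (mem_extChartAt_target u))

instance [IsManifold 𝓘(ℝ, E) ∞ G] : IsManifold (powModel E κ) ∞ (κ → G) := by
  refine isManifold_of_contDiffOn _ _ _ ?_
  rintro _ _ ⟨e, he, rfl⟩ ⟨e', he', rfl⟩
  rw [contDiffOn_pi]
  intro k
  have h := (contDiffGroupoid ∞ 𝓘(ℝ, E)).compatible (he k (Set.mem_univ k)) (he' k (Set.mem_univ k))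
  rw [contDiffGroupoid, mem_groupoid_of_pregroupoid] at h
  have h1 : ContDiffOn ℝ ∞ ((e k).symm.trans (e' k)) ((e k).symm.trans (e' k)).source := by
    simpa [contDiffPregroupoid] using h.1
  refine h1.comp (contDiff_apply ℝ E k).contDiffOn fun y hy => ?_
  exact ⟨hy.1.1 k (Set.mem_univ k), hy.1.2 k (Set.mem_univ k)⟩

theorem inTangentCoordinates_const {E₂ H₂ N Z : Type*} [NormedAddCommGroup E₂] [NormedSpace ℝ E₂]
    [TopologicalSpace H₂] [TopologicalSpace N] [ChartedSpace H₂ N] {J : ModelWithCorners ℝ E₂ H₂}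
    [IsManifold 𝓘(ℝ, E) 1 G] [IsManifold J 1 N] (p : G) {f : Z → N} {x₀ x : Z}
    (hf : ∀ v, (tangentBundleCore J N).coordChange (achart H₂ (f x)) (achart H₂ (f x₀)) (f x) v = v)
    (hx : f x ∈ (chartAt H₂ (f x₀)).source) (ϕ : Z → E →L[ℝ] E₂) :
    inTangentCoordinates 𝓘(ℝ, E) J (fun _ : Z => p) f ϕ x₀ x = ϕ x := by
  have h := inTangentCoordinates_eq (I := 𝓘(ℝ, E)) (I' := J) (fun _ : Z => p) f ϕ (x₀ := x₀)
    (x := x) (mem_chart_source _ _) hx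
  refine h.trans ?_
  ext v
  simp only [ContinuousLinearMap.comp_apply]
  rw [hf]
  congr 1
  exact (tangentBundleCore 𝓘(ℝ, E) G).coordChange_self _ _ (mem_chart_source _ _) _

theorem polishSpace_of_lieGroup (E : Type*) [NormedAddCommGroup E] [NormedSpace ℝ E] [FiniteDimensional ℝ E]
   [ChartedSpace E G] [Group G] [LieGroup 𝓘(ℝ, E) ∞ G] [T2Space G] [SecondCountableTopology G] :
   PolishSpace G := by
  have := topologicalGroup_of_lieGroup 𝓘(ℝ, E) ∞ (G := G)
  have := Manifold.locallyCompact_of_finiteDimensional (M := G) 𝓘(ℝ, E)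
  let _ := IsTopologicalGroup.rightUniformSpace G
  have : IsRightUniformGroup G := ⟨rfl⟩
  have := IsRightUniformGroup.completeSpace_of_weaklyLocallyCompactSpace (G := G)
  have : (uniformity G).IsCountablyGenerated := by
    rw [uniformity_eq_comap_nhds_one']
    infer_instance
  infer_instance
section LieGroup
variable [Group G]

/-- The derivative at the identity of `φ : G → W` in the direction `ξ`,
i.e. `d/dt|_{t=0} φ(exp(tξ))`. -/
def derivOne {W : Type*} [NormedAddCommGroup W] [NormedSpace ℝ W] (φ : G → W)
    (ξ : GroupLieAlgebra 𝓘(ℝ, E) G) : W :=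
  mfderiv 𝓘(ℝ, E) 𝓘(ℝ, W) φ 1 ξ

/-- The adjoint action of `G` on its Lie algebra, the derivative at the identity of
`x ↦ h x h⁻¹`. -/
def Ad (h : G) : GroupLieAlgebra 𝓘(ℝ, E) G →L[ℝ] GroupLieAlgebra 𝓘(ℝ, E) G :=
  (mfderiv 𝓘(ℝ, E) 𝓘(ℝ, E) (fun x : G => h * x * h⁻¹) 1 : E →L[ℝ] E)

theorem contMDiff_derivOne [IsManifold 𝓘(ℝ, E) ∞ G] [IsManifold I' ∞ M] {W : Type*}
    [NormedAddCommGroup W] [NormedSpace ℝ W] {φ : M → G → W}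
    (hφ : ContMDiff (I'.prod 𝓘(ℝ, E)) 𝓘(ℝ, W) ∞ (Function.uncurry φ))
    {s : M → GroupLieAlgebra 𝓘(ℝ, E) G} (hs : ContMDiff (M' := E) I' 𝓘(ℝ, E) ∞ s) :
    ContMDiff I' 𝓘(ℝ, W) ∞ fun m => derivOne (φ m) (s m) := by
  have : IsManifold 𝓘(ℝ, E) 1 G := IsManifold.of_le (n := ∞) (by norm_cast)
  have : IsManifold I' 1 M := IsManifold.of_le (n := ∞) (by norm_cast)
  intro m
  have h := ContMDiffAt.mfderiv_apply (m := ∞) (n := ∞) (x₀ := m) φ (fun _ => (1 : G)) id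
    (show M → E from s) (I := 𝓘(ℝ, E)) (I' := 𝓘(ℝ, W)) (hφ _) contMDiffAt_const contMDiffAt_id (hs m) (by norm_num)
  refine h.congr_of_eventuallyEq (Filter.Eventually.of_forall fun x => ?_)
  have := inTangentCoordinates_const (E := E) (E₂ := W) (Z := M) (J := 𝓘(ℝ, W)) (N := W)
    (1 : G) (f := fun x => φ x 1) (x₀ := m) (x := x)
    (fun v => by rw [tangentBundleCore_coordChange_model_space]; rfl)
    (by rw [chartAt_self_eq]; exact Set.mem_univ _)
    (fun x => (mfderiv 𝓘(ℝ, E) 𝓘(ℝ, W) (φ x) 1 : E →L[ℝ] W))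
  exact (DFunLike.congr_fun this (s x)).symm

theorem contMDiff_Ad [LieGroup 𝓘(ℝ, E) ∞ G] [IsManifold I' ∞ M] {w : M → G}
    (hw : ContMDiff I' 𝓘(ℝ, E) ∞ w) {s : M → GroupLieAlgebra 𝓘(ℝ, E) G}
    (hs : ContMDiff (M' := E) I' 𝓘(ℝ, E) ∞ s) :
    ContMDiff (M' := E) I' 𝓘(ℝ, E) ∞ fun m => Ad (w m) (s m) := by
  have : IsManifold 𝓘(ℝ, E) ∞ G := LieGroup.toContMDiffMul.toIsManifold
  have : IsManifold 𝓘(ℝ, E) 1 G := IsManifold.of_le (n := ∞) (by norm_cast)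
  have : IsManifold I' 1 M := IsManifold.of_le (n := ∞) (by norm_cast)
  intro m
  have hw' : ContMDiff (I'.prod 𝓘(ℝ, E)) 𝓘(ℝ, E) ∞ fun p : M × G => w p.1 := hw.comp contMDiff_fst
  have h := ContMDiffAt.mfderiv_apply (m := ∞) (n := ∞) (x₀ := m) (fun m x => w m * x * (w m)⁻¹)
    (fun _ => (1 : G)) id (show M → E from s) (I := 𝓘(ℝ, E)) (I' := 𝓘(ℝ, E))
    (((hw'.mul contMDiff_snd).mul hw'.inv) _) contMDiffAt_const contMDiffAt_id (hs m) (by norm_num)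
  refine h.congr_of_eventuallyEq (Filter.Eventually.of_forall fun x => ?_)
  have := inTangentCoordinates_const (E := E) (E₂ := E) (Z := M) (J := 𝓘(ℝ, E)) (N := G) (1 : G)
    (f := fun x => w x * 1 * (w x)⁻¹) (x₀ := m) (x := x)
    (fun v => by
      simp only [mul_one, mul_inv_cancel]
      exact (tangentBundleCore 𝓘(ℝ, E) G).coordChange_self _ _ (mem_chart_source _ _) _)
    (by simp) (fun y => (mfderiv 𝓘(ℝ, E) 𝓘(ℝ, E) (fun x : G => w y * x * (w y)⁻¹) 1 : E →L[ℝ] E))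
  exact (DFunLike.congr_fun this (s x)).symm
end LieGroup
end Smooth

section Algebra

/-- The loops generating the fundamental group of a genus `g` surface with `n` punctures: `M i`
around the `i`-th puncture and `A k`, `B k` the `a`- and `b`-cycle of the `k`-th handle. -/
abbrev Loop (n g : ℕ) : Type := Fin n ⊕ (Fin g ⊕ Fin g)

section Loops
variable {n g : ℕ}
/-- The loop around the `i`-th puncture. -/
abbrev Loop.M (i : Fin n) : Loop n g := Sum.inl i
/-- The `a`-cycle of the `k`-th handle. -/
abbrev Loop.A (k : Fin g) : Loop n g := Sum.inr (Sum.inl k)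
/-- The `b`-cycle of the `k`-th handle. -/
abbrev Loop.B (k : Fin g) : Loop n g := Sum.inr (Sum.inr k)
end Loops

open Loop

/-- `G^{n+2g}`, a group element for every loop. -/
abbrev Config (G : Type*) (n g : ℕ) : Type _ := Loop n g → G

variable (E : Type*) [NormedAddCommGroup E] [NormedSpace ℝ E] (G : Type*)
  [TopologicalSpace G] [ChartedSpace E G] [Group G]

/-- The Lie algebra of `G`. -/
abbrev LieAlg : Type _ := GroupLieAlgebra 𝓘(ℝ, E) G

instance [FiniteDimensional ℝ E] : FiniteDimensional ℝ (LieAlg E G) :=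
  inferInstanceAs (FiniteDimensional ℝ E)

variable (n g : ℕ)

/-- The algebra `C^∞(G^{n+2g}, ℂ)`. -/
def smoothFun : Subalgebra ℂ (Config G n g → ℂ) where
  carrier := {F | ContMDiff (powModel E (Loop n g)) 𝓘(ℝ, ℂ) ∞ F}
  mul_mem' {F K} hF hK := by
    have : ContDiff ℝ ∞ fun p : ℂ × ℂ => p.1 * p.2 := contDiff_mul
    exact this.contMDiff.comp (hF.prodMk_space hK)
  add_mem' {F K} hF hK := ContMDiff.add hF hK
  algebraMap_mem' c := contMDiff_const

/-- Smooth maps `G^{n+2g} → G`, a group under pointwise multiplication. -/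
abbrev SmoothMap : Type _ := C^∞⟮powModel E (Loop n g), Config G n g; 𝓘(ℝ, E), G⟯

/-- Smooth maps `G^{n+2g} × G → G^{n+2g}`. -/
abbrev FlowMap : Type _ :=
  C^∞⟮(powModel E (Loop n g)).prod 𝓘(ℝ, E), Config G n g × G;
    powModel E (Loop n g), Config G n g⟯

/-- Smooth maps from `G^{n+2g}` to the Lie algebra of `G`. -/
def smoothSec : Submodule ℝ (Config G n g → LieAlg E G) where
  carrier := {s | ContMDiff (M' := E) (powModel E (Loop n g)) 𝓘(ℝ, E) ∞ s}
  add_mem' {s t} hs ht := by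
    have h : ContDiff ℝ ∞ fun p : E × E => p.1 + p.2 := contDiff_add
    have := h.contMDiff.comp (ContMDiff.prodMk_space hs ht)
    exact this
  zero_mem' := contMDiff_const
  smul_mem' c s hs := by
    have h : ContDiff ℝ ∞ fun x : E => c • x := contDiff_const_smul c
    have := h.contMDiff.comp (Set.mem_ofPred.1 hs)
    exact this

variable {E G n g}

/-- The constant map with value `ξ`. -/
def constSec (ξ : LieAlg E G) : smoothSec E G n g := ⟨fun _ => ξ, contMDiff_const⟩

/-- The holonomy of the loop `X`, as a function on `G^{n+2g}`. -/
def hol (X : Loop n g) : SmoothMap E G n g := ⟨fun u => u X, contMDiff_coord X⟩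

theorem contMDiff_update [LieGroup 𝓘(ℝ, E) ∞ G] {f : Config G n g × G → Config G n g}
    {w : Config G n g × G → G} (X : Loop n g)
    (hf : ContMDiff ((powModel E (Loop n g)).prod 𝓘(ℝ, E)) (powModel E (Loop n g)) ∞ f)
    (hw : ContMDiff ((powModel E (Loop n g)).prod 𝓘(ℝ, E)) 𝓘(ℝ, E) ∞ w) :
    ContMDiff ((powModel E (Loop n g)).prod 𝓘(ℝ, E)) (powModel E (Loop n g)) ∞
      fun p => Function.update (f p) X (w p) := by
  refine contMDiff_pow fun k => ?_
  rcases eq_or_ne k X with rfl | hk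
  · simpa using hw
  · simpa [Function.update_of_ne hk, Function.comp_def] using (contMDiff_coord k).comp hf

theorem contMDiff_fst_apply (X : Loop n g) :
    ContMDiff ((powModel E (Loop n g)).prod 𝓘(ℝ, E)) 𝓘(ℝ, E) ∞
      fun p : Config G n g × G => p.1 X :=
  (contMDiff_coord X).comp contMDiff_fst

variable [LieGroup 𝓘(ℝ, E) ∞ G]

/-- `u ↦ Ad (w u) (s u)`. -/
def adSec (w : SmoothMap E G n g) (s : smoothSec E G n g) : smoothSec E G n g :=
  have : IsManifold 𝓘(ℝ, E) ∞ G := LieGroup.toContMDiffMul.toIsManifold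
  ⟨fun u => Ad (w u) (s.1 u), contMDiff_Ad w.contMDiff s.2⟩

/-- `u_X ↦ u_X h`. -/
def rightFlow (X : Loop n g) : FlowMap E G n g :=
  ⟨fun p => Function.update p.1 X (p.1 X * p.2),
    contMDiff_update X contMDiff_fst ((contMDiff_fst_apply X).mul contMDiff_snd)⟩

/-- `u_X ↦ h⁻¹ u_X`. -/
def leftFlow (X : Loop n g) : FlowMap E G n g :=
  ⟨fun p => Function.update p.1 X (p.2⁻¹ * p.1 X),
    contMDiff_update X contMDiff_fst (contMDiff_snd.inv.mul (contMDiff_fst_apply X))⟩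

/-- `u_X ↦ h⁻¹ u_X h`. -/
def conjFlow (X : Loop n g) : FlowMap E G n g :=
  ⟨fun p => Function.update p.1 X (p.2⁻¹ * p.1 X * p.2),
    contMDiff_update X contMDiff_fst
      ((contMDiff_snd.inv.mul (contMDiff_fst_apply X)).mul contMDiff_snd)⟩

/-- `u_{A_k} ↦ u_{A_k} h` and `u_{B_k} ↦ u_{A_k} h u_{A_k}⁻¹ u_{B_k}`. -/
def handleFlow (k : Fin g) : FlowMap E G n g :=
  ⟨fun p => Function.update (Function.update p.1 (A k) (p.1 (A k) * p.2)) (B k)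
      (p.1 (A k) * p.2 * (p.1 (A k))⁻¹ * p.1 (B k)),
    contMDiff_update _
      (contMDiff_update _ contMDiff_fst ((contMDiff_fst_apply _).mul contMDiff_snd))
      ((((contMDiff_fst_apply _).mul contMDiff_snd).mul (contMDiff_fst_apply _).inv).mul
        (contMDiff_fst_apply _))⟩

/-- The action on the holonomies of the copy of `G` labelled by a loop. -/
def flow : Loop n g → FlowMap E G n g
  | Sum.inl i => conjFlow (M i)
  | Sum.inr (Sum.inl k) => handleFlow k
  | Sum.inr (Sum.inr k) => rightFlow (B k)

/-- The function `u ↦ d/dt|_{t=0} F (φ (u, exp (t s(u))))`. -/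
def along (φ : FlowMap E G n g) (s : smoothSec E G n g) (F : smoothFun E G n g) :
    smoothFun E G n g :=
  have : IsManifold 𝓘(ℝ, E) ∞ G := LieGroup.toContMDiffMul.toIsManifold
  ⟨fun u => derivOne (fun h => F.1 (φ (u, h))) (s.1 u),
    contMDiff_derivOne (φ := fun u h => F.1 (φ (u, h)))
      (ContMDiff.comp (I' := powModel E (Loop n g)) F.2 φ.contMDiff) s.2⟩

/-- The Poisson bracket `{ξ, F}` of an element `ξ` of the copy of the Lie algebra labelled by the
loop `X` with a function of the holonomies. -/
def pb (X : Loop n g) (ξ : LieAlg E G) (F : smoothFun E G n g) : smoothFun E G n g :=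
  -along (flow X) (constSec ξ) F

variable (E G) in
/-- `C^∞(G)`. -/
abbrev SmoothG : Type _ := C^∞⟮𝓘(ℝ, E), G; 𝓘(ℝ, ℝ), ℝ⟯

/-- The function `x ↦ f (h⁻¹ x h)`. -/
def conjG (h : G) (f : SmoothG E G) : SmoothG E G :=
  ⟨fun x => f (h⁻¹ * x * h),
    f.contMDiff.comp ((contMDiff_const.mul contMDiff_id).mul contMDiff_const)⟩

theorem conjG_conjG (h k : G) (f : SmoothG E G) : conjG h (conjG k f) = conjG (h * k) f := by
  ext x
  simp [conjG, mul_assoc]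

theorem conjG_one (f : SmoothG E G) : conjG 1 f = f := by
  ext x
  simp [conjG]

/-- The action of `G` on `C^∞(G)` by `f ↦ f ∘ Ad_{h⁻¹}`. -/
def conjAut : G →* MulAut (Multiplicative (SmoothG E G)) where
  toFun h :=
    { toFun := fun f => Multiplicative.ofAdd (conjG h f.toAdd)
      invFun := fun f => Multiplicative.ofAdd (conjG h⁻¹ f.toAdd)
      left_inv := fun f => by simp [conjG_conjG, conjG_one]
      right_inv := fun f => by simp [conjG_conjG, conjG_one]
      map_mul' := fun f f' => rfl }
  map_one' := by
    ext f
    simp [conjG_one]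
  map_mul' h k := by
    ext1 f
    exact congrArg Multiplicative.ofAdd (conjG_conjG h k f.toAdd).symm

variable (E G) in
/-- The group `G ⋉ C^∞(G)` with `(h₁, f₁) (h₂, f₂) = (h₁ h₂, f₁ + f₂ ∘ Ad_{h₁⁻¹})`. -/
abbrev SymGroup : Type _ := Multiplicative (SmoothG E G) ⋊[conjAut (E := E) (G := G)] G

variable (E G n g) in
/-- The free algebra on the Lie algebra elements of all copies and the functions. -/
abbrev FreeFlower : Type _ := FreeAlgebra ℂ ((Loop n g × LieAlg E G) ⊕ smoothFun E G n g)

/-- A Lie algebra element of the copy labelled by `X`, in the free algebra. -/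
def freeGen (X : Loop n g) (ξ : LieAlg E G) : FreeFlower E G n g :=
  FreeAlgebra.ι ℂ (Sum.inl (X, ξ))

/-- A function, in the free algebra. -/
def freeFn (F : smoothFun E G n g) : FreeFlower E G n g := FreeAlgebra.ι ℂ (Sum.inr F)

/-- The defining relations of `U(⨁ 𝔤) ⋉ C^∞(G^{n+2g}, ℂ)`. The commutators are `iħ` times the
Poisson brackets, with `{ξ, η} = -[ξ, η]` on every copy of the Lie algebra. -/
inductive FlowerRel (ħ : ℝ) : FreeFlower E G n g → FreeFlower E G n g → Prop
  | fn_algebraMap (c : ℂ) :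
      FlowerRel ħ (freeFn (algebraMap ℂ _ c)) (algebraMap ℂ _ c)
  | fn_add (F K : smoothFun E G n g) : FlowerRel ħ (freeFn (F + K)) (freeFn F + freeFn K)
  | fn_mul (F K : smoothFun E G n g) : FlowerRel ħ (freeFn (F * K)) (freeFn F * freeFn K)
  | gen_add (X : Loop n g) (ξ η : LieAlg E G) :
      FlowerRel ħ (freeGen X (ξ + η)) (freeGen X ξ + freeGen X η)
  | gen_smul (X : Loop n g) (r : ℝ) (ξ : LieAlg E G) :
      FlowerRel ħ (freeGen X (r • ξ)) ((r : ℂ) • freeGen X ξ)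
  | gen_lie (X : Loop n g) (ξ η : LieAlg E G) :
      FlowerRel ħ (freeGen X ξ * freeGen X η - freeGen X η * freeGen X ξ)
        ((-(Complex.I * ħ)) • freeGen X ⁅ξ, η⁆)
  | gen_comm (X Y : Loop n g) (h : X ≠ Y) (ξ η : LieAlg E G) :
      FlowerRel ħ (freeGen X ξ * freeGen Y η) (freeGen Y η * freeGen X ξ)
  | gen_fn (X : Loop n g) (ξ : LieAlg E G) (F : smoothFun E G n g) :
      FlowerRel ħ (freeGen X ξ * freeFn F - freeFn F * freeGen X ξ)
        ((Complex.I * ħ) • freeFn (pb X ξ F))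

variable (E G n g) in
/-- The quantised decoupled flower algebra `U(⨁ 𝔤) ⋉ C^∞(G^{n+2g}, ℂ)`, where `ξ ⊗ F` is the
product `fn F * ξ`. -/
def FlowerAlg (ħ : ℝ) : Type _ := RingQuot (FlowerRel (E := E) (G := G) (n := n) (g := g) ħ)

instance (ħ : ℝ) : Ring (FlowerAlg E G n g ħ) := inferInstanceAs (Ring (RingQuot _))
instance (ħ : ℝ) : Algebra ℂ (FlowerAlg E G n g ħ) := inferInstanceAs (Algebra ℂ (RingQuot _))

variable (ħ : ℝ)

/-- The generator `ξ ⊗ 1`, with `ξ` in the copy of the Lie algebra labelled by `X`. In terms of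
the decoupled generators `j'`, this is `j'_{M_i}(ξ)` for `X = M i`,
`j'_{A_k}(ξ) - j'_{B_k}(ξ)` for `X = A k`, and `j'_{B_k}(ξ)` for `X = B k`. -/
def gen (X : Loop n g) (ξ : LieAlg E G) : FlowerAlg E G n g ħ :=
  RingQuot.mkAlgHom ℂ (FlowerRel ħ) (freeGen X ξ)

/-- The generator `1 ⊗ F`. -/
def fn (F : smoothFun E G n g) : FlowerAlg E G n g ħ :=
  RingQuot.mkAlgHom ℂ (FlowerRel ħ) (freeFn F)

variable [FiniteDimensional ℝ E]

/-- The coordinate of a Lie algebra valued function in a fixed basis of the Lie algebra. -/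
def coordFun (b : Fin (Module.finrank ℝ (LieAlg E G))) (s : smoothSec E G n g) :
    smoothFun E G n g :=
  ⟨fun u => ((Module.finBasis ℝ (LieAlg E G)).coord b (s.1 u) : ℝ), by
    let l : E →ₗ[ℝ] ℝ := (Module.finBasis ℝ (LieAlg E G)).coord b
    have h : ContDiff ℝ ∞ fun x : E => (LinearMap.toContinuousLinearMap l x : ℂ) :=
      Complex.ofRealCLM.contDiff.comp (ContinuousLinearMap.contDiff _)
    exact ContMDiff.comp (I' := 𝓘(ℝ, E)) h.contMDiff s.2⟩

/-- For `s = ∑_b s_b e_b`, the element `∑_b s_b ξ_b` where `ξ_b` is the generator `e_b ⊗ 1` of the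
copy labelled by `X`. -/
def lin (X : Loop n g) (s : smoothSec E G n g) : FlowerAlg E G n g ħ :=
  ∑ b, fn ħ (coordFun b s) * gen ħ X (Module.finBasis ℝ (LieAlg E G) b)

/-- The decoupled generator `j'_{A_k}`, with function coefficients. -/
def linA (k : Fin g) (s : smoothSec E G n g) : FlowerAlg E G n g ħ :=
  lin ħ (A k) s + lin ħ (B k) s

/-- The contribution of the `k`-th handle to the generators of the loops preceding it. -/
def handleLin (k : Fin g) (s : smoothSec E G n g) : FlowerAlg E G n g ħ :=
  linA ħ k (s - adSec (hol (A k))⁻¹ s) +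
    lin ħ (B k) (adSec (hol (A k))⁻¹ s - adSec ((hol (B k))⁻¹ * hol (A k)) s)

/-- The section `ξ - Ad(u_X) ξ`. -/
def oneSubAd (X : Loop n g) (ξ : LieAlg E G) : smoothSec E G n g :=
  constSec ξ - adSec (hol X) (constSec ξ)

/-- The generator `j_X(ξ)` of the loop `X` of the (undecoupled) quantum flower algebra, the image
of the classical generator under the inverse decoupling transformation, with the functions
ordered to the left. -/
def loopGen : Loop n g → LieAlg E G → FlowerAlg E G n g ħ
  | Sum.inl i, ξ => gen ħ (M i) ξ + ∑ k ∈ Finset.Ioi i, lin ħ (M k) (oneSubAd (M i) ξ) +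
      ∑ k, handleLin ħ k (oneSubAd (M i) ξ)
  | Sum.inr (Sum.inl i), ξ => linA ħ i (constSec ξ) -
      linA ħ i (adSec (hol (A i))⁻¹ (constSec ξ)) + lin ħ (B i) (adSec (hol (A i))⁻¹ (constSec ξ)) +
      ∑ k ∈ Finset.Ioi i, handleLin ħ k (oneSubAd (A i) ξ)
  | Sum.inr (Sum.inr i), ξ => gen ħ (B i) ξ -
      linA ħ i (adSec (hol (A i))⁻¹ (constSec ξ)) + lin ħ (B i) (adSec (hol (A i))⁻¹ (constSec ξ)) +
      ∑ k ∈ Finset.Ioi i, handleLin ħ k (oneSubAd (B i) ξ)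

/-- The contribution of the `k`-th handle to the Poisson brackets of the preceding loops. -/
def handlePb (k : Fin g) (s : smoothSec E G n g) (F : smoothFun E G n g) : smoothFun E G n g :=
  along (conjFlow (A k)) s F + along (conjFlow (B k)) s F

/-- The Poisson bracket `{j_X(ξ), F}` of the classical flower algebra, for a function `F` of the
holonomies. -/
def loopPb : Loop n g → LieAlg E G → smoothFun E G n g → smoothFun E G n g
  | Sum.inl i, ξ, F => -along (conjFlow (M i)) (constSec ξ) F -
      ∑ k ∈ Finset.Ioi i, along (conjFlow (M k)) (oneSubAd (M i) ξ) F -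
      ∑ k, handlePb k (oneSubAd (M i) ξ) F
  | Sum.inr (Sum.inl i), ξ, F => -along (conjFlow (A i)) (constSec ξ) F -
      along (conjFlow (B i)) (constSec ξ) F -
      along (rightFlow (B i)) (adSec ((hol (B i))⁻¹ * hol (A i)) (constSec ξ)) F -
      ∑ k ∈ Finset.Ioi i, handlePb k (oneSubAd (A i) ξ) F
  | Sum.inr (Sum.inr i), ξ, F => -along (leftFlow (A i)) (constSec ξ) F -
      along (conjFlow (B i)) (constSec ξ) F -
      ∑ k ∈ Finset.Ioi i, handlePb k (oneSubAd (B i) ξ) F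

/-- The total holonomy `Φ_∞(u) = u_{K_g} ⋯ u_{K_1} u_{M_n} ⋯ u_{M_1}` with
`u_{K_k} = u_{B_k} u_{A_k}⁻¹ u_{B_k}⁻¹ u_{A_k}`. -/
def totalHol : SmoothMap E G n g :=
  (List.ofFn fun k : Fin g => hol (B k) * (hol (A k))⁻¹ * (hol (B k))⁻¹ * hol (A k)).reverse.prod *
    (List.ofFn fun i : Fin n => hol (M i)).reverse.prod

/-- The function `f ∘ Φ_∞`. -/
def charge (f : SmoothG E G) : smoothFun E G n g :=
  ⟨fun u => (f (totalHol (E := E) u) : ℝ),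
    ContMDiff.comp (I' := 𝓘(ℝ, ℝ)) Complex.ofRealCLM.contDiff.contMDiff
      (f.contMDiff.comp (totalHol (E := E) (G := G) (n := n) (g := g)).contMDiff)⟩

/-- The function `u ↦ F (h⁻¹ u h)`. -/
def conjFn (h : G) (F : smoothFun E G n g) : smoothFun E G n g :=
  ⟨fun u => F.1 fun X => h⁻¹ * u X * h,
    ContMDiff.comp (I' := powModel E (Loop n g)) F.2 (contMDiff_pow fun X =>
      (contMDiff_const.mul (contMDiff_coord X)).mul contMDiff_const)⟩

/-- The component `f` of `(h, f)`. -/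
def SymGroup.f (x : SymGroup E G) : SmoothG E G := x.left.toAdd

/-- The component `h` of `(h, f)`. -/
def SymGroup.h (x : SymGroup E G) : G := x.right

/-- `τ` is the quantum action of `G ⋉ C^∞(G)` on the flower algebra by algebra automorphisms: on the
functions and the loop generators it is the classical action
`F ↦ F ∘ Ad_{h⁻¹}`, `j_X(ξ) ↦ j_X(Ad(h) ξ) + {j_X(Ad(h) ξ), f ∘ Φ_∞}`. -/
structure IsQuantumAction
    (τ : SymGroup E G →* (FlowerAlg E G n g ħ ≃ₐ[ℂ] FlowerAlg E G n g ħ)) : Prop where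
  map_fn : ∀ x F, τ x (fn ħ F) = fn ħ (conjFn x.h F)
  map_loopGen : ∀ x X ξ, τ x (loopGen ħ X ξ) =
    loopGen ħ X (Ad x.h ξ) + fn ħ (loopPb X (Ad x.h ξ) (charge x.f))

end Algebra

section Representation

open Loop

variable {n g : ℕ} {G : Type*} [Group G]

/-- The stabiliser of `gμ i` under conjugation. -/
def stab (gμ : Fin n → G) (i : Fin n) : Subgroup G := Subgroup.centralizer {gμ i}

variable (gμ : Fin n → G)

variable (g) in
/-- `G/N₁ × ⋯ × G/Nₙ × G^{2g}`. -/
abbrev Base : Type _ := (∀ i, G ⧸ stab gμ i) × (Fin g ⊕ Fin g → G)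

/-- The projection `G^{n+2g} → G/N₁ × ⋯ × G/Nₙ × G^{2g}`. -/
def toBase (v : Config G n g) : Base g gμ := (fun i => (v (M i) : G ⧸ stab gμ i), fun X => v (Sum.inr X))

/-- A choice of representatives for the points of `G/N₁ × ⋯ × G/Nₙ × G^{2g}`. -/
def ofBase (q : Base g gμ) : Config G n g
  | Sum.inl i => (q.1 i).out
  | Sum.inr X => q.2 X

variable {gμ}

/-- `(v_{M_1} k₁, …, v_{M_n} kₙ, u_{A_1}, …, u_{B_g})`. -/
def rightMul (v : Config G n g) (k : ∀ i, stab gμ i) : Config G n g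
  | Sum.inl i => v (M i) * k i
  | Sum.inr X => v (Sum.inr X)

variable {W : Type*} [NormedAddCommGroup W]

/-- `ψ(v₁ k₁, …, vₙ kₙ, u) = σ(k⁻¹) ψ(v, u)`. -/
def Equivariant [InnerProductSpace ℂ W] (σ : (∀ i, stab gμ i) → W →ₗᵢ[ℂ] W) (ψ : Config G n g → W) :
    Prop :=
  ∀ v k, ψ (rightMul v k) = σ k⁻¹ (ψ v)

theorem Equivariant.enorm_rightMul [InnerProductSpace ℂ W] {σ : (∀ i, stab gμ i) → W →ₗᵢ[ℂ] W}
    {ψ : Config G n g → W} (h : Equivariant σ ψ) (v : Config G n g) (k : ∀ i, stab gμ i) :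
    ‖ψ (rightMul v k)‖ₑ = ‖ψ v‖ₑ := by
  rw [h, ← ofReal_norm, LinearIsometry.norm_map, ofReal_norm]

/-- The product measure on `G/N₁ × ⋯ × G/Nₙ × G^{2g}`. -/
def baseMeasure [MeasurableSpace G] (m : ∀ i, Measure (G ⧸ stab gμ i)) (μ : Measure G) :
    Measure (Base g gμ) :=
  (Measure.pi m).prod (Measure.pi fun _ => μ)

theorem toBase_ofBase (q : Base g gμ) : toBase gμ (ofBase gμ q) = q :=
  Prod.ext (funext fun _ => Quotient.out_eq _) rfl

theorem exists_rightMul (v : Config G n g) :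
    ∃ k : ∀ i, stab gμ i, ofBase gμ (toBase gμ v) = rightMul v k := by
  refine ⟨fun i => ⟨(v (M i))⁻¹ * (Quotient.out (v (M i) : G ⧸ stab gμ i)),
    QuotientGroup.eq.1 (Quotient.out_eq _).symm⟩, funext fun X => ?_⟩
  rcases X with i | X
  · simp [rightMul, ofBase, toBase]
  · rfl

section LieGroup
variable [TopologicalSpace G] [T2Space G] [SecondCountableTopology G] [MeasurableSpace G]
  [BorelSpace G]

theorem measurable_comp_ofBase (E : Type*) [NormedAddCommGroup E] [NormedSpace ℝ E]
    [FiniteDimensional ℝ E] [ChartedSpace E G] [LieGroup 𝓘(ℝ, E) ∞ G] {β : Type*} [MeasurableSpace β] {F : Config G n g → β}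
    (hF : Measurable F) (hinv : ∀ v (k : ∀ i, stab gμ i), F (rightMul v k) = F v) :
    Measurable fun q => F (ofBase gμ q) := by
  have := polishSpace_of_lieGroup (G := G) E
  have := topologicalGroup_of_lieGroup 𝓘(ℝ, E) ∞ (G := G)
  have hc : ∀ i, IsClosed (stab gμ i : Set G) := fun i => by
    have : (stab gμ i : Set G) = {x | gμ i * x = x * gμ i} := by
      ext x
      simp [stab, Subgroup.mem_centralizer_iff]
    rw [this]
    exact isClosed_eq (by fun_prop) (by fun_prop)
  have hm : Measurable (toBase (g := g) gμ) := by
    refine Measurable.prodMk (measurable_pi_lambda _ fun i => ?_) (by fun_prop)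
    exact QuotientGroup.measurable_coe.comp (measurable_pi_apply _)
  rw [← hm.measurable_comp_iff_of_surjective fun q => ⟨_, toBase_ofBase q⟩]
  refine (congrArg Measurable (funext fun v => ?_)).mpr hF
  obtain ⟨k, hk⟩ := exists_rightMul (gμ := gμ) v
  simp only [Function.comp_apply, hk, hinv]

variable (E : Type*) [NormedAddCommGroup E] [NormedSpace ℝ E] [FiniteDimensional ℝ E]
  [ChartedSpace E G] [LieGroup 𝓘(ℝ, E) ∞ G] [InnerProductSpace ℂ W] (σ : (∀ i, stab gμ i) → W →ₗᵢ[ℂ] W)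

/-- The space `L²_{μ₁s₁…μₙsₙ}`. -/
def l2Space (m : ∀ i, Measure (G ⧸ stab gμ i)) (μ : Measure G) :
    Submodule ℂ (Config G n g → W) where
  carrier := {ψ | StronglyMeasurable ψ ∧ Equivariant σ ψ ∧
    ∫⁻ q, ‖ψ (ofBase gμ q)‖ₑ ^ 2 ∂baseMeasure m μ < ⊤}
  add_mem' {ψ φ} hψ hφ := by
    refine ⟨hψ.1.add hφ.1, fun v k => by simp [hψ.2.1 v k, hφ.2.1 v k], ?_⟩
    have hmeas : Measurable fun q => ‖ψ (ofBase gμ q)‖ₑ ^ 2 :=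
      measurable_comp_ofBase E (hψ.1.enorm.pow_const 2) fun v k => by
        simp only [hψ.2.1.enorm_rightMul]
    have hle : ∀ q, ‖(ψ + φ) (ofBase gμ q)‖ₑ ^ 2 ≤
        2 * ‖ψ (ofBase gμ q)‖ₑ ^ 2 + 2 * ‖φ (ofBase gμ q)‖ₑ ^ 2 := fun q => by
      change ‖ψ (ofBase gμ q) + φ (ofBase gμ q)‖ₑ ^ 2 ≤ _
      simp only [enorm_eq_nnnorm]
      norm_cast
      rw [← NNReal.coe_le_coe]
      push_cast
      have h1 := norm_add_le (ψ (ofBase gμ q)) (φ (ofBase gμ q))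
      have h2 := norm_nonneg (ψ (ofBase gμ q) + φ (ofBase gμ q))
      nlinarith [sq_nonneg (‖ψ (ofBase gμ q)‖ - ‖φ (ofBase gμ q)‖)]
    refine (lintegral_mono hle).trans_lt ?_
    rw [lintegral_add_left (hmeas.const_mul 2), lintegral_const_mul' _ _ (by simp),
      lintegral_const_mul' _ _ (by simp)]
    exact ENNReal.add_lt_top.2 ⟨ENNReal.mul_lt_top (by simp) hψ.2.2,
      ENNReal.mul_lt_top (by simp) hφ.2.2⟩
  zero_mem' := ⟨stronglyMeasurable_zero, fun v k => by simp, by simp⟩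
  smul_mem' c ψ hψ := by
    refine ⟨hψ.1.const_smul c, fun v k => by simp [hψ.2.1 v k], ?_⟩
    have : ∀ q, ‖(c • ψ) (ofBase gμ q)‖ₑ ^ 2 = ‖c‖ₑ ^ 2 * ‖ψ (ofBase gμ q)‖ₑ ^ 2 := fun q => by
      rw [Pi.smul_apply, enorm_smul, mul_pow]
    simp only [this]
    rw [lintegral_const_mul' _ _ (by simp)]
    exact ENNReal.mul_lt_top (by simp) hψ.2.2

variable (m : ∀ i, Measure (G ⧸ stab gμ i)) (μ : Measure G)

variable (g) in
/-- The space `L²_{μ₁s₁…μₙsₙ}` as a type, to be equipped with its inner product. -/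
def L2 : Type _ := l2Space (g := g) E σ m μ

instance : AddCommGroup (L2 g E σ m μ) := inferInstanceAs (AddCommGroup (l2Space (g := g) E σ m μ))
instance : Module ℂ (L2 g E σ m μ) := inferInstanceAs (Module ℂ (l2Space (g := g) E σ m μ))

variable {E σ m μ}

/-- The function underlying an element of `L²_{μ₁s₁…μₙsₙ}`. -/
def L2.toFun (ψ : L2 g E σ m μ) : Config G n g → W := ψ.1

theorem L2.integrable_inner (ψ φ : L2 g E σ m μ) :
    Integrable (fun q => inner ℂ (ψ.toFun (ofBase gμ q)) (φ.toFun (ofBase gμ q)))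
      (baseMeasure m μ) := by
  have hψ := ψ.2
  have hφ := φ.2
  have hm : Measurable fun q => inner ℂ (ψ.toFun (ofBase gμ q)) (φ.toFun (ofBase gμ q)) :=
    measurable_comp_ofBase E (F := fun v => inner ℂ (ψ.toFun v) (φ.toFun v))
      (hψ.1.inner hφ.1).measurable fun v k => by
        change inner ℂ (ψ.1 _) (φ.1 _) = inner ℂ (ψ.1 _) (φ.1 _)
        rw [hψ.2.1, hφ.2.1, LinearIsometry.inner_map_map]
  refine ⟨hm.aestronglyMeasurable, ?_⟩
  have hmeas : Measurable fun q => ‖ψ.toFun (ofBase gμ q)‖ₑ ^ 2 :=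
      measurable_comp_ofBase E (hψ.1.enorm.pow_const 2) fun v k => by
        simp only [hψ.2.1.enorm_rightMul]
  refine (lintegral_mono (g := fun q => ‖ψ.toFun (ofBase gμ q)‖ₑ ^ 2 +
    ‖φ.toFun (ofBase gμ q)‖ₑ ^ 2) fun q => ?_).trans_lt ?_
  · simp only [enorm_eq_nnnorm]
    norm_cast
    rw [← NNReal.coe_le_coe]
    push_cast
    have h1 := norm_inner_le_norm (𝕜 := ℂ) (ψ.toFun (ofBase gμ q)) (φ.toFun (ofBase gμ q))
    nlinarith [sq_nonneg (‖ψ.toFun (ofBase gμ q)‖ - ‖φ.toFun (ofBase gμ q)‖),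
      sq_nonneg ‖ψ.toFun (ofBase gμ q)‖, sq_nonneg ‖φ.toFun (ofBase gμ q)‖]
  · rw [lintegral_add_left hmeas]
    exact ENNReal.add_lt_top.2 ⟨hψ.2.2, hφ.2.2⟩

instance L2.core : PreInnerProductSpace.Core ℂ (L2 g E σ m μ) where
  inner ψ φ := ∫ q, inner ℂ (ψ.toFun (ofBase gμ q)) (φ.toFun (ofBase gμ q)) ∂baseMeasure m μ
  conj_inner_symm ψ φ := by
    rw [← integral_conj]
    simp
  re_inner_nonneg ψ := by
    have h : ∀ q, inner ℂ (ψ.toFun (ofBase gμ q)) (ψ.toFun (ofBase gμ q)) =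
        ((‖ψ.toFun (ofBase gμ q)‖ ^ 2 : ℝ) : ℂ) := fun q => by
      rw [inner_self_eq_norm_sq_to_K]
      simp
    simp only [h]
    rw [integral_complex_ofReal]
    exact integral_nonneg fun q => by positivity
  add_left ψ χ φ := by
    rw [← integral_add (L2.integrable_inner _ _) (L2.integrable_inner _ _)]
    refine integral_congr_ae (Filter.Eventually.of_forall fun q => ?_)
    exact inner_add_left _ _ _
  smul_left ψ φ c := by
    rw [← integral_const_mul]
    refine integral_congr_ae (Filter.Eventually.of_forall fun q => ?_)
    exact inner_smul_left _ _ _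

instance : SeminormedAddCommGroup (L2 g E σ m μ) :=
  InnerProductSpace.Core.toSeminormedAddCommGroup (𝕜 := ℂ)

instance : InnerProductSpace ℂ (L2 g E σ m μ) := InnerProductSpace.ofCore _

variable (g E σ m μ) in
/-- The representation space `V_{μ₁s₁…μₙsₙ}`, the quotient of `L²_{μ₁s₁…μₙsₙ}` by the
zero-norm states. -/
abbrev RepSpace : Type _ := SeparationQuotient (L2 g E σ m μ)

variable (g E σ) in
/-- The space `V^∞_{μ₁s₁…μₙsₙ}` of smooth equivariant functions whose support is compact in
`G/N₁ × ⋯ × G/Nₙ × G^{2g}`. -/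
def smoothSpace : Submodule ℂ (Config G n g → W) where
  carrier := {ψ | ContMDiff (powModel E (Loop n g)) 𝓘(ℝ, W) ∞ ψ ∧ Equivariant σ ψ ∧
    ∃ C : Set (Base g gμ), IsCompact C ∧ ∀ v, toBase gμ v ∉ C → ψ v = 0}
  add_mem' {ψ φ} hψ hφ := by
    obtain ⟨C, hC, hC0⟩ := hψ.2.2
    obtain ⟨D, hD, hD0⟩ := hφ.2.2
    refine ⟨?_, fun v k => by simp [hψ.2.1 v k, hφ.2.1 v k], C ∪ D, hC.union hD, fun v hv => ?_⟩
    · have h : ContDiff ℝ ∞ fun p : W × W => p.1 + p.2 := contDiff_add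
      have := h.contMDiff.comp (ContMDiff.prodMk_space hψ.1 hφ.1)
      exact this
    · rw [Set.mem_union, not_or] at hv
      simp [hC0 v hv.1, hD0 v hv.2]
  zero_mem' := ⟨contMDiff_const, fun v k => by simp, ∅, isCompact_empty, fun v _ => rfl⟩
  smul_mem' c ψ hψ := by
    obtain ⟨C, hC, hC0⟩ := hψ.2.2
    refine ⟨?_, fun v k => by simp [hψ.2.1 v k], C, hC, fun v hv => by simp [hC0 v hv]⟩
    have h : ContDiff ℝ ∞ fun x : W => c • x := contDiff_const_smul c
    have := h.contMDiff.comp hψ.1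
    exact this

variable (g E σ m μ) in
/-- `ι` is the map `V^∞_{μ₁s₁…μₙsₙ} → V_{μ₁s₁…μₙsₙ}` sending a function to its class. -/
def IsClassMap (ι : smoothSpace g E σ →ₗ[ℂ] RepSpace g E σ m μ) : Prop :=
  ∀ ψ, ∃ φ : L2 g E σ m μ, φ.toFun = ψ.1 ∧ ι ψ = SeparationQuotient.mk φ

/-- The map `β`, sending `v_{M_i}` to `v_{M_i} g_{μ_i} v_{M_i}⁻¹` and leaving the elements of the
handles unchanged. -/
def beta (gμ : Fin n → G) (v : Config G n g) : Config G n g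
  | Sum.inl i => v (M i) * gμ i * (v (M i))⁻¹
  | Sum.inr X => v (Sum.inr X)

/-- The action on the arguments of the functions in the representation spaces of the copy of `G`
labelled by a loop. -/
def repFlow : Loop n g → FlowMap E G n g
  | Sum.inl i => leftFlow (M i)
  | Sum.inr (Sum.inl k) => handleFlow k
  | Sum.inr (Sum.inr k) => rightFlow (B k)

/-- `P` is the representation of the quantised flower algebra on `V^∞_{μ₁s₁…μₙsₙ}`. -/
structure IsFlowerRep (ħ : ℝ)
    (P : FlowerAlg E G n g ħ →ₐ[ℂ] Module.End ℂ (smoothSpace g E σ)) : Prop where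
  fn_apply : ∀ F ψ v, (P (fn ħ F) ψ).1 v = F.1 (beta gμ v) • ψ.1 v
  gen_apply : ∀ X (ξ : LieAlg E G) ψ v, (P (gen ħ X ξ) ψ).1 v =
    (-(Complex.I * ħ)) • derivOne (fun h => ψ.1 (repFlow (E := E) X (v, h))) ξ

/-- The twisted conjugation `(v, u) ↦ (h v, h u h⁻¹)`. -/
def adTwisted (h : G) (v : Config G n g) : Config G n g
  | Sum.inl i => h * v (M i)
  | Sum.inr X => h * v (Sum.inr X) * h⁻¹

/-- The function `Γ(h, f) ψ`. -/
def gammaFun (ħ : ℝ) (gμ : Fin n → G) (x : SymGroup E G) (ψ : Config G n g → W) :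
    Config G n g → W := fun v =>
  Complex.exp (Complex.I / ħ * (x.f (totalHol (E := E) (beta gμ v)) : ℝ)) • ψ (adTwisted x.h⁻¹ v)

/-- `Gam` is the (unitary) representation `Γ` of `G ⋉ C^∞(G)` on `V_{μ₁s₁…μₙsₙ}`, given on
functions by `gammaFun`. -/
def IsGamma (ħ : ℝ) (Gam : SymGroup E G →* (RepSpace g E σ m μ ≃ₗᵢ[ℂ] RepSpace g E σ m μ)) : Prop :=
  ∀ x (ψ : L2 g E σ m μ), ∃ φ : L2 g E σ m μ, φ.toFun = gammaFun ħ gμ x ψ.toFun ∧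
    Gam x (SeparationQuotient.mk ψ) = SeparationQuotient.mk φ

end LieGroup

/-- The representation `Π_{s₁} ⊗ ⋯ ⊗ Π_{sₙ}` of the product of the stabilisers. -/
def tensorRep {V : Fin n → Type*} [∀ i, NormedAddCommGroup (V i)] [∀ i, InnerProductSpace ℂ (V i)]
    (S : ∀ i, stab gμ i →* (V i ≃ₗᵢ[ℂ] V i)) (k : ∀ i, stab gμ i) :
    HilbertTensor V →ₗᵢ[ℂ] HilbertTensor V :=
  hilbertTensorMap fun i => S i (k i)

end Representation

end FlowerAlgebra
end

open FlowerAlgebra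

/-! The proof replaces the loop generators `j_X` by the decoupled generators `t_X` (`gen`), which
present the algebra together with the functions. On `G^{n+2g}` each copy of `G` acts from the right
by `flow`, and the copies of different loops commute. Derivatives along these flows therefore
satisfy the relations of `⨁ 𝔤`, by two facts of calculus: left invariant fields commute up to the
Lie bracket (`derivOne_lie`), and mixed derivatives commute (`derivOne_comm`). Since `β` turns the
translation `v ↦ h⁻¹v` into conjugation, the flows lift through `β` (`beta_repFlow`) to flows that
commute with the stabilisers acting from the right, and the Leibniz rule makes `Π` a representation.

For `F = f ∘ Φ_∞`, formal conjugation by `exp(iF/ħ)` sends `t` to `t + {t, F}`. Combined with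
`Ad(h)` this gives the quantum action on the `t_X`; it respects the semidirect product because `Φ_∞`
is equivariant under simultaneous conjugation (`totalHol_conj`). It has the prescribed values on the
`j_X` (`actionHom_loopGen`) because the classical bracket of `j_X` arises from the formula for `j_X`
by letting each `t_Y(s)` act as minus the derivative along its flow. The passage from `t_X` to `j_X`
is triangular, so the `j_X` and the functions generate (`gen_mem_of_loopGen_mem`), whence
uniqueness.

`Γ` multiplies by the actual phase `exp(iF/ħ) ∘ β` after a twisted conjugation. It is unitary
because the phase has modulus one and the measure on `Q` is invariant; unimodularity enters here. In
the intertwining identity both sides are algebra homomorphisms in `Z`, so functions and the `t_X`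
suffice: differentiating the phase produces exactly `{t_X, F}` (`flowerRep_actionHom_gen`). The
class map is injective because the measure on `Q` charges every nonempty open set. -/

noncomputable section
set_option linter.unusedSectionVars false
set_option linter.overlappingInstances false
namespace FlowerAlgebra

/-! ### First derivatives at the identity, and the adjoint action. -/

section Calculus

variable {E : Type*} [NormedAddCommGroup E] [NormedSpace ℝ E] {G : Type*} [TopologicalSpace G]
  [ChartedSpace E G] [Group G] {W : Type*} [NormedAddCommGroup W] [NormedSpace ℝ W]

theorem derivOne_add_dir (φ : G → W) (ξ η : LieAlg E G) :
    derivOne φ (ξ + η) = derivOne φ ξ + derivOne φ η :=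
  map_add (mfderiv 𝓘(ℝ, E) 𝓘(ℝ, W) φ 1) ξ η

theorem derivOne_smul_dir (φ : G → W) (r : ℝ) (ξ : LieAlg E G) :
    derivOne φ (r • ξ) = r • derivOne φ ξ :=
  map_smul (mfderiv 𝓘(ℝ, E) 𝓘(ℝ, W) φ 1) r ξ

theorem derivOne_sub_dir (φ : G → W) (ξ η : LieAlg E G) :
    derivOne φ (ξ - η) = derivOne φ ξ - derivOne φ η :=
  map_sub (mfderiv 𝓘(ℝ, E) 𝓘(ℝ, W) φ 1) ξ η

theorem derivOne_const (w : W) (ξ : LieAlg E G) : derivOne (fun _ : G => w) ξ = 0 := by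
  unfold derivOne
  rw [mfderiv_const]
  rfl

theorem derivOne_congr {φ φ' : G → W} (h : φ =ᶠ[nhds 1] φ') (ξ : LieAlg E G) :
    derivOne φ ξ = derivOne φ' ξ :=
  DFunLike.congr_fun (h.mfderiv_eq (I := 𝓘(ℝ, E)) (I' := 𝓘(ℝ, W))) ξ

/-- The model of `G` has no boundary and the chart of `W` is the identity, so everything reduces to
Fréchet calculus in the chart at `1`. The bilinear product rule and all second order statements go
through this reduction. -/
theorem derivOne_eq_fderiv {φ : G → W} (hφ : MDifferentiableAt 𝓘(ℝ, E) 𝓘(ℝ, W) φ 1)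
    (ξ : LieAlg E G) :
    derivOne φ ξ = fderiv ℝ (φ ∘ (extChartAt 𝓘(ℝ, E) (1 : G)).symm)
      (extChartAt 𝓘(ℝ, E) (1 : G) 1) (ξ : E) := by
  have h : mfderiv 𝓘(ℝ, E) 𝓘(ℝ, W) φ 1 = fderivWithin ℝ (writtenInExtChartAt 𝓘(ℝ, E) 𝓘(ℝ, W) 1 φ)
      (Set.range 𝓘(ℝ, E)) (extChartAt 𝓘(ℝ, E) (1 : G) 1) := if_pos hφ
  refine (DFunLike.congr_fun h ξ).trans ?_
  rw [ModelWithCorners.range_eq_univ, fderivWithin_univ]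
  rfl

theorem differentiableAt_comp_chart_symm {φ : G → W}
    (hφ : MDifferentiableAt 𝓘(ℝ, E) 𝓘(ℝ, W) φ 1) :
    DifferentiableAt ℝ (φ ∘ (extChartAt 𝓘(ℝ, E) (1 : G)).symm)
      (extChartAt 𝓘(ℝ, E) (1 : G) 1) := by
  have h := (mdifferentiableAt_iff φ 1).1 hφ
  rw [ModelWithCorners.range_eq_univ, differentiableWithinAt_univ] at h
  exact h.2

variable {φ ψ : G → W}

theorem derivOne_add (hφ : MDifferentiableAt 𝓘(ℝ, E) 𝓘(ℝ, W) φ 1)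
    (hψ : MDifferentiableAt 𝓘(ℝ, E) 𝓘(ℝ, W) ψ 1) (ξ : LieAlg E G) :
    derivOne (fun x => φ x + ψ x) ξ = derivOne φ ξ + derivOne ψ ξ := by
  have := (hφ.hasMFDerivAt.add hψ.hasMFDerivAt).mfderiv
  exact DFunLike.congr_fun this ξ

theorem derivOne_clm {W' : Type*} [NormedAddCommGroup W'] [NormedSpace ℝ W'] (l : W →L[ℝ] W')
    (hφ : MDifferentiableAt 𝓘(ℝ, E) 𝓘(ℝ, W) φ 1) (ξ : LieAlg E G) :
    derivOne (fun x => l (φ x)) ξ = l (derivOne φ ξ) := by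
  have := (l.hasMFDerivAt.comp (1 : G) hφ.hasMFDerivAt).mfderiv
  exact DFunLike.congr_fun this ξ

theorem mdifferentiableAt_bilin {U W' : Type*} [NormedAddCommGroup W'] [NormedSpace ℝ W']
    [NormedAddCommGroup U] [NormedSpace ℝ U] (l : U →L[ℝ] W →L[ℝ] W') {χ : G → U}
    (hχ : MDifferentiableAt 𝓘(ℝ, E) 𝓘(ℝ, U) χ 1) (hφ : MDifferentiableAt 𝓘(ℝ, E) 𝓘(ℝ, W) φ 1) :
    MDifferentiableAt 𝓘(ℝ, E) 𝓘(ℝ, W') (fun x => l (χ x) (φ x)) 1 := by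
  have h : DifferentiableAt ℝ (fun p : U × W => l p.1 p.2) (χ 1, φ 1) :=
    (l.isBoundedBilinearMap).differentiableAt _
  exact h.mdifferentiableAt.comp (1 : G) (hχ.prodMk_space hφ)

theorem derivOne_bilin {U W' : Type*} [NormedAddCommGroup W'] [NormedSpace ℝ W']
    [NormedAddCommGroup U] [NormedSpace ℝ U] (l : U →L[ℝ] W →L[ℝ] W') {χ : G → U}
    (hχ : MDifferentiableAt 𝓘(ℝ, E) 𝓘(ℝ, U) χ 1) (hφ : MDifferentiableAt 𝓘(ℝ, E) 𝓘(ℝ, W) φ 1)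
    (ξ : LieAlg E G) :
    derivOne (fun x => l (χ x) (φ x)) ξ = l (χ 1) (derivOne φ ξ) + l (derivOne χ ξ) (φ 1) := by
  rw [derivOne_eq_fderiv hφ, derivOne_eq_fderiv hχ,
    derivOne_eq_fderiv (mdifferentiableAt_bilin l hχ hφ)]
  have h := l.fderiv_of_bilinear (differentiableAt_comp_chart_symm hχ)
    (differentiableAt_comp_chart_symm hφ)
  have he := extChartAt_to_inv (I := 𝓘(ℝ, E)) (1 : G)
  refine (DFunLike.congr_fun h (ξ : E)).trans ?_
  simp only [Function.comp_apply, he]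
  rfl

theorem derivOne_comp {w : G → G} (hw : MDifferentiableAt 𝓘(ℝ, E) 𝓘(ℝ, E) w 1) (h1 : w 1 = 1)
    (hφ : MDifferentiableAt 𝓘(ℝ, E) 𝓘(ℝ, W) φ 1) (ξ : LieAlg E G) :
    derivOne (fun x => φ (w x)) ξ =
      derivOne φ (show LieAlg E G from (mfderiv 𝓘(ℝ, E) 𝓘(ℝ, E) w 1 : E →L[ℝ] E) ξ) := by
  have hφ' : HasMFDerivAt 𝓘(ℝ, E) 𝓘(ℝ, W) φ (w 1) (mfderiv 𝓘(ℝ, E) 𝓘(ℝ, W) φ 1) := by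
    rw [h1]; exact hφ.hasMFDerivAt
  exact DFunLike.congr_fun ((hφ'.comp (1 : G) hw.hasMFDerivAt).mfderiv) ξ

variable [LieGroup 𝓘(ℝ, E) ∞ G]

instance isManifold_of_lieGroup : IsManifold 𝓘(ℝ, E) ∞ G := LieGroup.toContMDiffMul.toIsManifold

theorem contMDiff_conj (k : G) : ContMDiff 𝓘(ℝ, E) 𝓘(ℝ, E) ∞ fun x : G => k * x * k⁻¹ :=
  (contMDiff_const.mul contMDiff_id).mul contMDiff_const

theorem derivOne_conj (hφ : MDifferentiableAt 𝓘(ℝ, E) 𝓘(ℝ, W) φ 1) (k : G) (ξ : LieAlg E G) :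
    derivOne (fun x => φ (k * x * k⁻¹)) ξ = derivOne φ (Ad k ξ) :=
  derivOne_comp ((contMDiff_conj k).mdifferentiableAt (by simp)) (by simp) hφ ξ

omit [LieGroup 𝓘(ℝ, E) ∞ G] in
theorem Ad_one (ξ : LieAlg E G) : Ad (1 : G) ξ = ξ := by
  have h : (fun x : G => 1 * x * 1⁻¹) = id := by ext; simp
  unfold Ad
  rw [h, mfderiv_id]
  rfl

theorem Ad_mul (h k : G) (ξ : LieAlg E G) : Ad (h * k) ξ = Ad h (Ad k ξ) := by
  have hc : (fun x : G => h * k * x * (h * k)⁻¹) = (fun x => h * x * h⁻¹) ∘ fun x => k * x * k⁻¹ := by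
    ext; simp [mul_assoc]
  have h1 : HasMFDerivAt 𝓘(ℝ, E) 𝓘(ℝ, E) (fun x => h * x * h⁻¹) (k * 1 * k⁻¹)
      (mfderiv 𝓘(ℝ, E) 𝓘(ℝ, E) (fun x => h * x * h⁻¹) 1 : E →L[ℝ] E) := by
    have : k * 1 * k⁻¹ = 1 := by simp
    rw [this]
    exact ((contMDiff_conj h).mdifferentiableAt (by simp)).hasMFDerivAt
  have h2 := (h1.comp (1 : G)
    ((contMDiff_conj k).mdifferentiableAt (x := 1) (by simp)).hasMFDerivAt).mfderiv
  unfold Ad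
  rw [hc]
  exact DFunLike.congr_fun h2 ξ

omit [Group G] [LieGroup 𝓘(ℝ, E) ∞ G] in
theorem contMDiff_slice_left {Ψ : G → G → W}
    (hΨ : ContMDiff (𝓘(ℝ, E).prod 𝓘(ℝ, E)) 𝓘(ℝ, W) ∞ (Function.uncurry Ψ)) (b : G) :
    ContMDiff 𝓘(ℝ, E) 𝓘(ℝ, W) ∞ fun a => Ψ a b :=
  hΨ.comp (contMDiff_id.prodMk contMDiff_const)

omit [Group G] [LieGroup 𝓘(ℝ, E) ∞ G] in
theorem contMDiff_slice_right {Ψ : G → G → W}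
    (hΨ : ContMDiff (𝓘(ℝ, E).prod 𝓘(ℝ, E)) 𝓘(ℝ, W) ∞ (Function.uncurry Ψ)) (a : G) :
    ContMDiff 𝓘(ℝ, E) 𝓘(ℝ, W) ∞ fun b => Ψ a b :=
  hΨ.comp (contMDiff_const.prodMk contMDiff_id)

omit [LieGroup 𝓘(ℝ, E) ∞ G] in
-- The chain rule along `x ↦ (x, x)`. It splits a flow that uses its group element in two places
-- into one-sided pieces.
theorem derivOne_diag {Ψ : G → G → W}
    (hΨ : ContMDiff (𝓘(ℝ, E).prod 𝓘(ℝ, E)) 𝓘(ℝ, W) ∞ (Function.uncurry Ψ)) (ξ : LieAlg E G) :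
    derivOne (fun x => Ψ x x) ξ = derivOne (fun a => Ψ a 1) ξ + derivOne (fun b => Ψ 1 b) ξ := by
  have hd : MDifferentiableAt (𝓘(ℝ, E).prod 𝓘(ℝ, E)) 𝓘(ℝ, W) (Function.uncurry Ψ) ((1 : G), (1 : G)) :=
    hΨ.mdifferentiableAt (by simp)
  have h := (HasMFDerivAt.comp (g := Function.uncurry Ψ) (f := fun x : G => (x, x)) (1 : G)
    hd.hasMFDerivAt ((hasMFDerivAt_id (1 : G)).prodMk (hasMFDerivAt_id (1 : G)))).mfderiv
  have h' := mfderiv_prod_eq_add_apply (v := ((ξ, ξ) : TangentSpace (𝓘(ℝ, E).prod 𝓘(ℝ, E)) ((1 : G), (1 : G)))) hd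
  exact (DFunLike.congr_fun h ξ).trans h'

theorem derivOne_inv (hφ : ContMDiff 𝓘(ℝ, E) 𝓘(ℝ, W) ∞ φ) (ξ : LieAlg E G) :
    derivOne (fun x => φ x⁻¹) ξ = -derivOne φ ξ := by
  -- On the diagonal `φ (a⁻¹ * b)` is constant, so the two partial derivatives cancel.
  have h := derivOne_diag (Ψ := fun a b : G => φ (a⁻¹ * b))
    (hφ.comp (contMDiff_fst.inv.mul contMDiff_snd)) ξ
  simp only [inv_mul_cancel, derivOne_const, mul_one, inv_one, one_mul] at h
  exact eq_neg_of_add_eq_zero_left h.symm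

end Calculus

/-! ### Second derivatives on the group and the Lie bracket. -/

section SecondOrder

variable {E : Type*} [NormedAddCommGroup E] [NormedSpace ℝ E] {G : Type*} [TopologicalSpace G]
  [ChartedSpace E G] [Group G] {W : Type*} [NormedAddCommGroup W] [NormedSpace ℝ W]
  [LieGroup 𝓘(ℝ, E) ∞ G]

theorem contMDiff_derivOne_const {φ : G → G → W}
    (hφ : ContMDiff (𝓘(ℝ, E).prod 𝓘(ℝ, E)) 𝓘(ℝ, W) ∞ (Function.uncurry φ)) (ξ : LieAlg E G) :
    ContMDiff 𝓘(ℝ, E) 𝓘(ℝ, W) ∞ fun a => derivOne (φ a) ξ :=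
  contMDiff_derivOne hφ contMDiff_const

/-- The derivative of the inverse of the chart at `1`. -/
def chartSymmDeriv (x : E) : E →L[ℝ] E :=
  mfderivWithin 𝓘(ℝ, E) 𝓘(ℝ, E) (extChartAt 𝓘(ℝ, E) (1 : G)).symm (Set.range 𝓘(ℝ, E)) x

/-- The derivative at `1` of the left multiplication by `a`. -/
def leftMulDeriv (a : G) (ξ : LieAlg E G) : E :=
  mfderiv 𝓘(ℝ, E) 𝓘(ℝ, E) (fun b : G => a * b) 1 ξ

/-- The coordinate expression of the left invariant vector field of `ξ` in the chart at `1`. -/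
def chartField (ξ : LieAlg E G) (x : E) : E :=
  (chartSymmDeriv (E := E) (G := G) x).inverse (leftMulDeriv ((extChartAt 𝓘(ℝ, E) (1 : G)).symm x) ξ)

theorem leftMulDeriv_one (ξ : LieAlg E G) : leftMulDeriv (1 : G) ξ = ξ := by
  have h : (fun x : G => 1 * x) = id := by ext; simp
  unfold leftMulDeriv
  rw [h, mfderiv_id]
  rfl

theorem chartField_one (ξ : LieAlg E G) :
    chartField ξ (extChartAt 𝓘(ℝ, E) (1 : G) 1) = ξ := by
  have := IsManifold.of_le (I := 𝓘(ℝ, E)) (M := G) (m := 1) (n := ∞) (by norm_cast)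
  have h : chartSymmDeriv (E := E) (G := G) (extChartAt 𝓘(ℝ, E) (1 : G) 1) = ContinuousLinearMap.id ℝ E :=
    mfderivWithin_range_extChartAt_symm
  rw [chartField, h, ContinuousLinearMap.inverse_id, extChartAt_to_inv, leftMulDeriv_one]
  rfl

/-- The bracket of the Lie algebra is the bracket of left invariant fields at `1`, itself defined by
pulling the fields back to the chart. At the base point of the chart the derivative of the chart is
the identity, so no correction factor survives. -/
theorem lie_eq_lieBracket (ξ η : LieAlg E G) :
    (⁅ξ, η⁆ : LieAlg E G) = (VectorField.lieBracket ℝ (chartField ξ) (chartField η)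
      (extChartAt 𝓘(ℝ, E) (1 : G) 1) : E) := by
  have := IsManifold.of_le (I := 𝓘(ℝ, E)) (M := G) (m := 1) (n := ∞) (by norm_cast)
  let D : E →L[ℝ] E := mfderiv 𝓘(ℝ, E) 𝓘(ℝ, E) (extChartAt 𝓘(ℝ, E) (1 : G)) 1
  have hD : D = ContinuousLinearMap.id ℝ E := mfderiv_extChartAt_self
  change D.inverse (VectorField.lieBracketWithin ℝ (chartField ξ) (chartField η)
    ((extChartAt 𝓘(ℝ, E) (1 : G)).symm ⁻¹' Set.univ ∩ Set.range 𝓘(ℝ, E)) _) = _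
  rw [hD, ContinuousLinearMap.inverse_id, Set.preimage_univ, Set.univ_inter,
    ModelWithCorners.range_eq_univ, VectorField.lieBracketWithin_univ]
  rfl

theorem differentiableAt_chartField [CompleteSpace E] (ξ : LieAlg E G) :
    DifferentiableAt ℝ (chartField ξ) (extChartAt 𝓘(ℝ, E) (1 : G) 1) := by
  have := IsManifold.of_le (I := 𝓘(ℝ, E)) (M := G) (m := 2) (n := ∞) (by norm_cast)
  have := LieGroup.of_le (I := 𝓘(ℝ, E)) (G := G) (m := minSmoothness ℝ 3) (n := ∞)
    (by simp; norm_cast)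
  have h : DifferentiableWithinAt ℝ (chartField ξ)
      ((extChartAt 𝓘(ℝ, E) (1 : G)).symm ⁻¹' Set.univ ∩ Set.range 𝓘(ℝ, E))
      (extChartAt 𝓘(ℝ, E) (1 : G) 1) :=
    MDifferentiableWithinAt.differentiableWithinAt_mpullbackWithin_vectorField
      (mdifferentiableAt_mulInvariantVectorField (I := 𝓘(ℝ, E)) ξ
        (g := (1 : G))).mdifferentiableWithinAt
  rwa [Set.preimage_univ, Set.univ_inter, ModelWithCorners.range_eq_univ,
    differentiableWithinAt_univ] at h

/-- This moves a derivative at `1` of a left translate to the translated point, as a derivative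
along the left invariant field. In this form it can be differentiated once more in the base point.
-/
theorem derivOne_mul_left_eq {φ : G → W} (hφ : ContMDiff 𝓘(ℝ, E) 𝓘(ℝ, W) ∞ φ) (ξ : LieAlg E G)
    {x : E} (hx : x ∈ (extChartAt 𝓘(ℝ, E) (1 : G)).target) :
    derivOne (fun b => φ ((extChartAt 𝓘(ℝ, E) (1 : G)).symm x * b)) ξ =
      fderiv ℝ (φ ∘ (extChartAt 𝓘(ℝ, E) (1 : G)).symm) x (chartField ξ x) := by
  have := IsManifold.of_le (I := 𝓘(ℝ, E)) (M := G) (m := 1) (n := ∞) (by norm_cast)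
  set p := (extChartAt 𝓘(ℝ, E) (1 : G)).symm x with hp
  let D : E →L[ℝ] W := mfderiv 𝓘(ℝ, E) 𝓘(ℝ, W) φ p
  have hD : HasMFDerivAt 𝓘(ℝ, E) 𝓘(ℝ, W) φ p D := (hφ.mdifferentiableAt (by simp)).hasMFDerivAt
  have hD1 : HasMFDerivAt 𝓘(ℝ, E) 𝓘(ℝ, W) φ (p * 1) D := by rwa [mul_one]
  have hl : MDifferentiableAt 𝓘(ℝ, E) 𝓘(ℝ, E) (fun b : G => p * b) 1 :=
    contMDiff_mul_left.mdifferentiableAt (n := ∞) (by simp)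
  have h1 : derivOne (fun b => φ (p * b)) ξ = D (leftMulDeriv p ξ) :=
    DFunLike.congr_fun ((hD1.comp (1 : G) hl.hasMFDerivAt).mfderiv) ξ
  have hsymm : HasMFDerivAt 𝓘(ℝ, E) 𝓘(ℝ, E) (extChartAt 𝓘(ℝ, E) (1 : G)).symm x
      (chartSymmDeriv (E := E) (G := G) x) := by
    have h := (mdifferentiableWithinAt_extChartAt_symm hx).hasMFDerivWithinAt
    rw [ModelWithCorners.range_eq_univ, hasMFDerivWithinAt_univ] at h
    unfold chartSymmDeriv
    rwa [ModelWithCorners.range_eq_univ]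
  have h2 : HasFDerivAt (φ ∘ (extChartAt 𝓘(ℝ, E) (1 : G)).symm)
      (D.comp (chartSymmDeriv (E := E) (G := G) x)) x :=
    hasMFDerivAt_iff_hasFDerivAt.1 (hD.comp x hsymm)
  -- `chartField` is defined with `inverse`, which is a true inverse only because the derivative of
  -- the inverse chart is invertible on the target.
  obtain ⟨e, he⟩ : (chartSymmDeriv (E := E) (G := G) x).IsInvertible :=
    isInvertible_mfderivWithin_extChartAt_symm hx
  rw [h1, h2.fderiv, ContinuousLinearMap.comp_apply, chartField, ← he,
    ContinuousLinearMap.inverse_equiv]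
  exact congrArg D (e.apply_symm_apply _).symm

theorem contDiffAt_comp_chart_symm {φ : G → W} (hφ : ContMDiff 𝓘(ℝ, E) 𝓘(ℝ, W) ∞ φ) :
    ContDiffAt ℝ ∞ (φ ∘ (extChartAt 𝓘(ℝ, E) (1 : G)).symm) (extChartAt 𝓘(ℝ, E) (1 : G) 1) := by
  have h := (contMDiffAt_iff.1 (hφ 1)).2
  rw [ModelWithCorners.range_eq_univ, contDiffWithinAt_univ] at h
  exact h

theorem derivOne_derivOne_mul {φ : G → W} (hφ : ContMDiff 𝓘(ℝ, E) 𝓘(ℝ, W) ∞ φ)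
    (ξ η : LieAlg E G) :
    derivOne (fun a => derivOne (fun b => φ (a * b)) η) ξ =
      fderiv ℝ (fun x => fderiv ℝ (φ ∘ (extChartAt 𝓘(ℝ, E) (1 : G)).symm) x (chartField η x))
        (extChartAt 𝓘(ℝ, E) (1 : G) 1) (chartField ξ (extChartAt 𝓘(ℝ, E) (1 : G) 1)) := by
  have hs : ContMDiff 𝓘(ℝ, E) 𝓘(ℝ, W) ∞ fun a : G => derivOne (fun b => φ (a * b)) η :=
    contMDiff_derivOne_const (φ := fun a b => φ (a * b))
      (hφ.comp (contMDiff_fst.mul contMDiff_snd)) η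
  rw [derivOne_eq_fderiv (hs.mdifferentiableAt (by simp)), chartField_one]
  congr 1
  refine Filter.EventuallyEq.fderiv_eq ?_
  filter_upwards [extChartAt_target_mem_nhds (I := 𝓘(ℝ, E)) (1 : G)] with x hx
  exact derivOne_mul_left_eq hφ η hx

/-- Second derivatives along left invariant vector fields commute up to the Lie bracket. -/
theorem derivOne_lie [CompleteSpace E] {φ : G → W} (hφ : ContMDiff 𝓘(ℝ, E) 𝓘(ℝ, W) ∞ φ)
    (ξ η : LieAlg E G) :
    derivOne (fun a => derivOne (fun b => φ (a * b)) η) ξ -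
      derivOne (fun a => derivOne (fun b => φ (a * b)) ξ) η = derivOne φ ⁅ξ, η⁆ := by
  rw [derivOne_derivOne_mul hφ, derivOne_derivOne_mul hφ,
    derivOne_eq_fderiv (hφ.mdifferentiableAt (by simp)), lie_eq_lieBracket]
  exact (VectorField.fderiv_apply_lieBracket (contDiffAt_comp_chart_symm hφ) (by simp; norm_cast)
    (differentiableAt_chartField η) (differentiableAt_chartField ξ)).symm

theorem contDiffAt_comp_chart_symm_prod {Ψ : G → G → W}
    (hΨ : ContMDiff (𝓘(ℝ, E).prod 𝓘(ℝ, E)) 𝓘(ℝ, W) ∞ (Function.uncurry Ψ)) {x y : E}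
    (hx : x ∈ (extChartAt 𝓘(ℝ, E) (1 : G)).target) (hy : y ∈ (extChartAt 𝓘(ℝ, E) (1 : G)).target) :
    ContDiffAt ℝ ∞ (fun p : E × E => Ψ ((extChartAt 𝓘(ℝ, E) (1 : G)).symm p.1)
      ((extChartAt 𝓘(ℝ, E) (1 : G)).symm p.2)) (x, y) := by
  have hs : ∀ z ∈ (extChartAt 𝓘(ℝ, E) (1 : G)).target,
      ContMDiffAt 𝓘(ℝ, E) 𝓘(ℝ, E) ∞ (extChartAt 𝓘(ℝ, E) (1 : G)).symm z := fun z hz =>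
    (contMDiffOn_extChartAt_symm (1 : G)).contMDiffAt ((isOpen_extChartAt_target (1 : G)).mem_nhds hz)
  have h1 : ContMDiffAt 𝓘(ℝ, E × E) 𝓘(ℝ, E) ∞ (fun p : E × E => (extChartAt 𝓘(ℝ, E) (1 : G)).symm p.1)
      (x, y) := (hs x hx).comp (x, y) contDiff_fst.contMDiff.contMDiffAt
  have h2 : ContMDiffAt 𝓘(ℝ, E × E) 𝓘(ℝ, E) ∞ (fun p : E × E => (extChartAt 𝓘(ℝ, E) (1 : G)).symm p.2)
      (x, y) := (hs y hy).comp (x, y) contDiff_snd.contMDiff.contMDiffAt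
  exact ((hΨ _).comp (x, y) (h1.prodMk h2)).contDiffAt

/-- With both arguments read in the chart, the inner derivative is a partial derivative near the
base point. Here and in `derivOne_derivOne_swap` the two orders of differentiation become one second
derivative with its arguments exchanged, so that symmetry of second derivatives applies. -/
theorem derivOne_derivOne {Ψ : G → G → W}
    (hΨ : ContMDiff (𝓘(ℝ, E).prod 𝓘(ℝ, E)) 𝓘(ℝ, W) ∞ (Function.uncurry Ψ)) (ξ η : LieAlg E G) :
    derivOne (fun a => derivOne (fun b => Ψ a b) η) ξ =
      fderiv ℝ (fderiv ℝ fun p : E × E => Ψ ((extChartAt 𝓘(ℝ, E) (1 : G)).symm p.1)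
        ((extChartAt 𝓘(ℝ, E) (1 : G)).symm p.2))
        (extChartAt 𝓘(ℝ, E) (1 : G) 1, extChartAt 𝓘(ℝ, E) (1 : G) 1)
        ((ξ : E), (0 : E)) ((0 : E), (η : E)) := by
  set e := extChartAt 𝓘(ℝ, E) (1 : G) with he
  set F : E × E → W := fun p : E × E => Ψ (e.symm p.1) (e.symm p.2) with hF
  have h1 : e 1 ∈ e.target := mem_extChartAt_target (1 : G)
  rw [derivOne_eq_fderiv ((contMDiff_derivOne_const hΨ η).mdifferentiableAt (by simp))]
  have hev : ((fun a => derivOne (fun b => Ψ a b) η) ∘ e.symm) =ᶠ[nhds (e 1)]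
      fun x => fderiv ℝ F (x, e 1) ((0 : E), (η : E)) := by
    filter_upwards [extChartAt_target_mem_nhds (I := 𝓘(ℝ, E)) (1 : G)] with x hx
    have hd : HasFDerivAt F (fderiv ℝ F (x, e 1)) (x, e 1) :=
      ((contDiffAt_comp_chart_symm_prod hΨ hx h1).differentiableAt (by simp)).hasFDerivAt
    have hc := (HasFDerivAt.comp (e 1) hd (hasFDerivAt_prodMk_right x (e 1))).fderiv
    simp only [Function.comp_apply]
    rw [derivOne_eq_fderiv ((contMDiff_slice_right hΨ _).mdifferentiableAt (by simp))]
    exact DFunLike.congr_fun hc (η : E)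
  rw [hev.fderiv_eq]
  have hd2 : HasFDerivAt (fderiv ℝ F) (fderiv ℝ (fderiv ℝ F) (e 1, e 1)) (e 1, e 1) :=
    (((contDiffAt_comp_chart_symm_prod hΨ h1 h1).fderiv_right (m := 1)
      (by norm_cast)).differentiableAt (by simp)).hasFDerivAt
  have hc := HasFDerivAt.clm_apply (HasFDerivAt.comp (g := fderiv ℝ F) (f := fun x => (x, e 1)) (e 1)
    hd2 (hasFDerivAt_prodMk_left (e 1) (e 1))) (hasFDerivAt_const ((0 : E), (η : E)) (e 1))
  refine (DFunLike.congr_fun hc.fderiv (ξ : E)).trans ?_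
  change fderiv ℝ F (e 1, e 1) (0 : E × E) + _ = _
  rw [map_zero, zero_add]
  rfl

theorem derivOne_derivOne_swap {Ψ : G → G → W}
    (hΨ : ContMDiff (𝓘(ℝ, E).prod 𝓘(ℝ, E)) 𝓘(ℝ, W) ∞ (Function.uncurry Ψ)) (ξ η : LieAlg E G) :
    derivOne (fun b => derivOne (fun a => Ψ a b) ξ) η =
      fderiv ℝ (fderiv ℝ fun p : E × E => Ψ ((extChartAt 𝓘(ℝ, E) (1 : G)).symm p.1)
        ((extChartAt 𝓘(ℝ, E) (1 : G)).symm p.2))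
        (extChartAt 𝓘(ℝ, E) (1 : G) 1, extChartAt 𝓘(ℝ, E) (1 : G) 1)
        ((0 : E), (η : E)) ((ξ : E), (0 : E)) := by
  have hΨ' : ContMDiff (𝓘(ℝ, E).prod 𝓘(ℝ, E)) 𝓘(ℝ, W) ∞ (Function.uncurry fun b a => Ψ a b) :=
    hΨ.comp (contMDiff_snd.prodMk contMDiff_fst)
  set e := extChartAt 𝓘(ℝ, E) (1 : G) with he
  set F : E × E → W := fun p : E × E => Ψ (e.symm p.1) (e.symm p.2) with hF
  have h1 : e 1 ∈ e.target := mem_extChartAt_target (1 : G)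
  rw [derivOne_eq_fderiv ((contMDiff_derivOne_const hΨ' ξ).mdifferentiableAt (by simp))]
  have hev : ((fun b => derivOne (fun a => Ψ a b) ξ) ∘ e.symm) =ᶠ[nhds (e 1)]
      fun x => fderiv ℝ F (e 1, x) ((ξ : E), (0 : E)) := by
    filter_upwards [extChartAt_target_mem_nhds (I := 𝓘(ℝ, E)) (1 : G)] with x hx
    have hd : HasFDerivAt F (fderiv ℝ F (e 1, x)) (e 1, x) :=
      ((contDiffAt_comp_chart_symm_prod hΨ h1 hx).differentiableAt (by simp)).hasFDerivAt
    have hc := (HasFDerivAt.comp (g := F) (f := fun y => (y, x)) (e 1) hd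
      (hasFDerivAt_prodMk_left (e 1) x)).fderiv
    simp only [Function.comp_apply]
    rw [derivOne_eq_fderiv ((contMDiff_slice_left hΨ _).mdifferentiableAt (by simp))]
    exact DFunLike.congr_fun hc (ξ : E)
  rw [hev.fderiv_eq]
  have hd2 : HasFDerivAt (fderiv ℝ F) (fderiv ℝ (fderiv ℝ F) (e 1, e 1)) (e 1, e 1) :=
    (((contDiffAt_comp_chart_symm_prod hΨ h1 h1).fderiv_right (m := 1)
      (by norm_cast)).differentiableAt (by simp)).hasFDerivAt
  have hc := HasFDerivAt.clm_apply (HasFDerivAt.comp (g := fderiv ℝ F) (f := fun x => (e 1, x)) (e 1)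
    hd2 (hasFDerivAt_prodMk_right (e 1) (e 1))) (hasFDerivAt_const ((ξ : E), (0 : E)) (e 1))
  refine (DFunLike.congr_fun hc.fderiv (η : E)).trans ?_
  change fderiv ℝ F (e 1, e 1) (0 : E × E) + _ = _
  rw [map_zero, zero_add]
  rfl

/-- Mixed second derivatives commute. -/
theorem derivOne_comm {Ψ : G → G → W}
    (hΨ : ContMDiff (𝓘(ℝ, E).prod 𝓘(ℝ, E)) 𝓘(ℝ, W) ∞ (Function.uncurry Ψ)) (ξ η : LieAlg E G) :
    derivOne (fun a => derivOne (fun b => Ψ a b) η) ξ =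
      derivOne (fun b => derivOne (fun a => Ψ a b) ξ) η := by
  have h1 := mem_extChartAt_target (I := 𝓘(ℝ, E)) (1 : G)
  have hd := contDiffAt_comp_chart_symm_prod hΨ h1 h1
  rw [derivOne_derivOne hΨ, (hd.isSymmSndFDerivAt (by simp; norm_cast)).eq]
  exact (derivOne_derivOne_swap hΨ ξ η).symm

/-- Smooth functions separate the elements of the Lie algebra. -/
theorem ext_derivOne [FiniteDimensional ℝ E] [T2Space G] {ξ η : LieAlg E G}
    (h : ∀ φ : G → E, ContMDiff 𝓘(ℝ, E) 𝓘(ℝ, E) ∞ φ → derivOne φ ξ = derivOne φ η) : ξ = η := by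
  have := IsManifold.of_le (I := 𝓘(ℝ, E)) (M := G) (m := 1) (n := ∞) (by norm_cast)
  obtain ⟨f⟩ : Nonempty (SmoothBumpFunction 𝓘(ℝ, E) (1 : G)) := inferInstance
  -- A bump function turns the chart at `1` into a global smooth function without changing it near
  -- `1`, where its derivative is the identity.
  have hs : ContMDiff 𝓘(ℝ, E) 𝓘(ℝ, E) ∞ fun x => f x • extChartAt 𝓘(ℝ, E) (1 : G) x :=
    f.contMDiff_smul (contMDiffOn_extChartAt)
  have key : ∀ ζ : LieAlg E G, derivOne (fun x => f x • extChartAt 𝓘(ℝ, E) (1 : G) x) ζ = (ζ : E) :=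
    fun ζ => by
      have he : (fun x => f x • extChartAt 𝓘(ℝ, E) (1 : G) x) =ᶠ[nhds 1]
          extChartAt 𝓘(ℝ, E) (1 : G) := by
        filter_upwards [f.eventuallyEq_one] with x hx
        rw [hx, Pi.one_apply, one_smul]
      rw [derivOne_congr he]
      exact DFunLike.congr_fun (mfderiv_extChartAt_self (I := 𝓘(ℝ, E)) (x := (1 : G))) ζ
  have := h _ hs
  rwa [key, key] at this

/-- By `derivOne_lie` the bracket is determined by its effect on smooth functions, which separate
Lie algebra elements. Conjugation by `h` is an automorphism of `G`, so it carries the second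
derivatives in directions `ξ, η` to those in directions `Ad h ξ, Ad h η`. -/
theorem Ad_lie [FiniteDimensional ℝ E] [T2Space G] (h : G) (ξ η : LieAlg E G) :
    Ad h ⁅ξ, η⁆ = ⁅Ad h ξ, Ad h η⁆ := by
  have := FiniteDimensional.complete ℝ E
  refine ext_derivOne fun φ hφ => ?_
  have hc : ContMDiff 𝓘(ℝ, E) 𝓘(ℝ, E) ∞ fun x => φ (h * x * h⁻¹) := hφ.comp (contMDiff_conj h)
  have hs : ∀ a ζ, derivOne (fun b => φ (h * (a * b) * h⁻¹)) ζ =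
      derivOne (fun b => φ (h * a * h⁻¹ * b)) (Ad h ζ) := fun a ζ => by
    rw [← derivOne_conj (φ := fun b => φ (h * a * h⁻¹ * b))
      ((hφ.comp (contMDiff_const.mul contMDiff_id)).mdifferentiableAt (by simp))]
    simp [mul_assoc]
  have hs' : ∀ ζ, ContMDiff 𝓘(ℝ, E) 𝓘(ℝ, E) ∞ fun a : G => derivOne (fun b => φ (a * b)) (Ad h ζ) :=
    fun ζ => contMDiff_derivOne_const (φ := fun a b => φ (a * b))
      (hφ.comp (contMDiff_fst.mul contMDiff_snd)) _
  rw [← derivOne_lie hφ, ← derivOne_conj (hφ.mdifferentiableAt (by simp)), ← derivOne_lie hc]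
  simp only [hs]
  rw [← derivOne_conj ((hs' _).mdifferentiableAt (by simp)),
    ← derivOne_conj ((hs' _).mdifferentiableAt (by simp))]

end SecondOrder

open Loop

/-! ### The flows on `G^{n+2g}` and the classical brackets. -/

section Flows

variable {E : Type*} [NormedAddCommGroup E] [NormedSpace ℝ E] {G : Type*} [TopologicalSpace G]
  [ChartedSpace E G] [Group G] [LieGroup 𝓘(ℝ, E) ∞ G] {n g : ℕ}
  {W : Type*} [NormedAddCommGroup W] [NormedSpace ℝ W]

theorem contMDiff_update_of {E' H' M : Type*} [NormedAddCommGroup E'] [NormedSpace ℝ E']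
    [TopologicalSpace H'] {I' : ModelWithCorners ℝ E' H'} [TopologicalSpace M] [ChartedSpace H' M]
    {f : M → Config G n g} {w : M → G} (X : Loop n g)
    (hf : ContMDiff I' (powModel E (Loop n g)) ∞ f) (hw : ContMDiff I' 𝓘(ℝ, E) ∞ w) :
    ContMDiff I' (powModel E (Loop n g)) ∞ fun p => Function.update (f p) X (w p) := by
  refine contMDiff_pow fun k => ?_
  rcases eq_or_ne k X with rfl | hk
  · simpa using hw
  · simpa [Function.update_of_ne hk, Function.comp_def] using (contMDiff_coord k).comp hf

/-- The derivative of `ψ` along the flow `φ` in the direction `ξ`. -/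
def flowDeriv (φ : FlowMap E G n g) (ξ : LieAlg E G) (ψ : Config G n g → W) : Config G n g → W :=
  fun u => derivOne (fun h => ψ (φ (u, h))) ξ

variable {ψ : Config G n g → W} (hψ : ContMDiff (powModel E (Loop n g)) 𝓘(ℝ, W) ∞ ψ)

include hψ

theorem contMDiff_comp_flow (φ : FlowMap E G n g) (u : Config G n g) :
    ContMDiff 𝓘(ℝ, E) 𝓘(ℝ, W) ∞ fun h => ψ (φ (u, h)) :=
  hψ.comp (φ.contMDiff.comp (contMDiff_const.prodMk contMDiff_id))

theorem mdifferentiableAt_comp_flow (φ : FlowMap E G n g) (u : Config G n g) :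
    MDifferentiableAt 𝓘(ℝ, E) 𝓘(ℝ, W) (fun h => ψ (φ (u, h))) 1 :=
  (contMDiff_comp_flow hψ φ u).mdifferentiableAt (by simp)

theorem contMDiff_comp_flow_flow (φ φ' : FlowMap E G n g) (u : Config G n g) :
    ContMDiff (𝓘(ℝ, E).prod 𝓘(ℝ, E)) 𝓘(ℝ, W) ∞
      (Function.uncurry fun a b => ψ (φ' (φ (u, a), b))) :=
  hψ.comp (φ'.contMDiff.comp
    ((φ.contMDiff.comp (contMDiff_const.prodMk contMDiff_fst)).prodMk contMDiff_snd))

theorem contMDiff_flowDeriv (φ : FlowMap E G n g) (ξ : LieAlg E G) :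
    ContMDiff (powModel E (Loop n g)) 𝓘(ℝ, W) ∞ (flowDeriv φ ξ ψ) :=
  contMDiff_derivOne (φ := fun u h => ψ (φ (u, h))) (hψ.comp φ.contMDiff) contMDiff_const

/-- The hypothesis makes `φ` a right action, so an iterated derivative along it is an iterated
derivative of a function of `a * b` and `derivOne_lie` applies. -/
theorem flowDeriv_lie [CompleteSpace E] {φ : FlowMap E G n g}
    (hφ : ∀ u a b, φ (φ (u, a), b) = φ (u, a * b)) (ξ η : LieAlg E G) :
    flowDeriv φ ξ (flowDeriv φ η ψ) - flowDeriv φ η (flowDeriv φ ξ ψ) = flowDeriv φ ⁅ξ, η⁆ ψ := by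
  ext u
  rw [Pi.sub_apply]
  simp only [flowDeriv, hφ]
  exact derivOne_lie (contMDiff_comp_flow hψ φ u) ξ η

theorem flowDeriv_comm {φ φ' : FlowMap E G n g}
    (hφ : ∀ u a b, φ' (φ (u, a), b) = φ (φ' (u, b), a)) (ξ η : LieAlg E G) :
    flowDeriv φ ξ (flowDeriv φ' η ψ) = flowDeriv φ' η (flowDeriv φ ξ ψ) := by
  ext u
  have h := derivOne_comm (contMDiff_comp_flow_flow hψ φ φ' u) ξ η
  simp only [flowDeriv]
  rw [h]
  simp only [hφ]

omit hψ

/-- The handle is the case to watch: its second step uses the new value `u_A a`, and `(u_A a) b (u_A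
a)⁻¹ · u_A a u_A⁻¹ = u_A (a b) u_A⁻¹`. -/
theorem flow_mul (X : Loop n g) (u : Config G n g) (a b : G) :
    flow (E := E) X (flow (E := E) X (u, a), b) = flow (E := E) X (u, a * b) := by
  rcases X with i | k | k <;>
  · ext Z
    simp only [flow, conjFlow, handleFlow, rightFlow, ContMDiffMap.coeFn_mk, Function.update_apply]
    split_ifs <;> simp_all [mul_assoc]

theorem repFlow_mul (X : Loop n g) (u : Config G n g) (a b : G) :
    repFlow (E := E) X (repFlow (E := E) X (u, a), b) = repFlow (E := E) X (u, a * b) := by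
  rcases X with i | X
  · ext Z
    simp only [repFlow, leftFlow, ContMDiffMap.coeFn_mk, Function.update_apply]
    split_ifs <;> simp_all [mul_assoc]
  · rcases X with k | k
    · exact flow_mul (E := E) (A k) u a b
    · exact flow_mul (E := E) (B k) u a b

/-- Only the flows of `A k` and `B k` touch a common component: on `u_{B_k}` one multiplies on the
left by a factor free of `u_{B_k}`, the other on the right. -/
theorem flow_comm {X Y : Loop n g} (h : X ≠ Y) (u : Config G n g) (a b : G) :
    flow (E := E) Y (flow (E := E) X (u, a), b) = flow (E := E) X (flow (E := E) Y (u, b), a) := by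
  rcases X with i | k | k <;> rcases Y with j | l | l <;>
  · ext Z
    simp only [flow, conjFlow, handleFlow, rightFlow, ContMDiffMap.coeFn_mk, Function.update_apply]
    grind

theorem repFlow_comm {X Y : Loop n g} (h : X ≠ Y) (u : Config G n g) (a b : G) :
    repFlow (E := E) Y (repFlow (E := E) X (u, a), b) =
      repFlow (E := E) X (repFlow (E := E) Y (u, b), a) := by
  rcases X with i | k | k <;> rcases Y with j | l | l <;>
  · ext Z
    simp only [repFlow, leftFlow, handleFlow, rightFlow, ContMDiffMap.coeFn_mk,
      Function.update_apply]
    grind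

/-- Simultaneous conjugation of all components. -/
def conjAll (h : G) (u : Config G n g) : Config G n g := fun X => h * u X * h⁻¹

theorem conjAll_flow (X : Loop n g) (h : G) (u : Config G n g) (a : G) :
    conjAll h (flow (E := E) X (u, a)) = flow (E := E) X (conjAll h u, h * a * h⁻¹) := by
  rcases X with i | k | k <;>
  · ext Z
    simp only [flow, conjFlow, handleFlow, rightFlow, ContMDiffMap.coeFn_mk, Function.update_apply,
      conjAll]
    split_ifs <;> simp_all [mul_assoc]

theorem along_sub (φ : FlowMap E G n g) (s t : smoothSec E G n g) (F : smoothFun E G n g) :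
    along φ (s - t) F = along φ s F - along φ t F :=
  Subtype.ext (funext fun _ => derivOne_sub_dir _ _ _)

/-- This rests on `h⁻¹ u_X = u_X (u_X⁻¹ h⁻¹ u_X)`. Right translations are the common normal form in
which the brackets are compared. -/
theorem along_leftFlow (X : Loop n g) (s : smoothSec E G n g) (F : smoothFun E G n g) :
    along (leftFlow X) s F = -along (rightFlow X) (adSec (hol X)⁻¹ s) F := by
  refine Subtype.ext (funext fun u => ?_)
  have hs : ContMDiff 𝓘(ℝ, E) 𝓘(ℝ, ℂ) ∞ fun h => F.1 (Function.update u X (u X * h)) :=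
    contMDiff_comp_flow F.2 (rightFlow X) u
  have h1 := derivOne_inv ((hs.comp (contMDiff_conj (u X)⁻¹))) (s.1 u)
  have h2 := derivOne_conj (hs.mdifferentiableAt (by simp)) (u X)⁻¹ (s.1 u)
  change derivOne (fun h => F.1 (Function.update u X (h⁻¹ * u X))) (s.1 u) =
    -derivOne (fun h => F.1 (Function.update u X (u X * h))) (Ad (u X)⁻¹ (s.1 u))
  rw [← h2]
  simpa [Function.comp_def, mul_assoc] using h1

theorem along_conjFlow (X : Loop n g) (s : smoothSec E G n g) (F : smoothFun E G n g) :
    along (conjFlow X) s F =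
      along (rightFlow X) s F - along (rightFlow X) (adSec (hol X)⁻¹ s) F := by
  rw [sub_eq_add_neg, ← along_leftFlow]
  refine Subtype.ext (funext fun u => ?_)
  have h := derivOne_diag (Ψ := fun a b => F.1 (Function.update u X (a⁻¹ * u X * b)))
    (ContMDiff.comp (I' := powModel E (Loop n g)) F.2 (contMDiff_update_of X contMDiff_const
      ((contMDiff_fst.inv.mul contMDiff_const).mul contMDiff_snd))) (s.1 u)
  simp only [mul_one, inv_one, one_mul] at h
  exact h.trans (add_comm _ _)

/-- The left factor on `u_B` is moved to the right: `u_A h u_A⁻¹ u_B = u_B · (u_B⁻¹ u_A) h (u_B⁻¹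
u_A)⁻¹`. -/
theorem along_handleFlow (k : Fin g) (s : smoothSec E G n g) (F : smoothFun E G n g) :
    along (handleFlow k) s F = along (rightFlow (A k)) s F +
      along (rightFlow (B k)) (adSec ((hol (B k))⁻¹ * hol (A k)) s) F := by
  refine Subtype.ext (funext fun u => ?_)
  have h := derivOne_diag (Ψ := fun a b => F.1 (Function.update
      (Function.update u (A k) (u (A k) * a)) (B k) (u (A k) * b * (u (A k))⁻¹ * u (B k))))
    (ContMDiff.comp (I' := powModel E (Loop n g)) F.2 (contMDiff_update_of _ (contMDiff_update_of _
      contMDiff_const (contMDiff_const.mul contMDiff_fst))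
      (((contMDiff_const.mul contMDiff_snd).mul contMDiff_const).mul contMDiff_const))) (s.1 u)
  refine h.trans (congrArg₂ (· + ·) ?_ ?_)
  · change _ = derivOne (fun h => F.1 (Function.update u (A k) (u (A k) * h))) (s.1 u)
    congr 1
    ext a
    refine congrArg F.1 ?_
    rw [mul_one, mul_inv_cancel, one_mul, Function.update_eq_self_iff]
    simp
  · have hs : ContMDiff 𝓘(ℝ, E) 𝓘(ℝ, ℂ) ∞ fun h => F.1 (Function.update u (B k) (u (B k) * h)) :=
      contMDiff_comp_flow F.2 (rightFlow (B k)) u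
    refine Eq.trans ?_ (derivOne_conj (hs.mdifferentiableAt (by simp)) ((u (B k))⁻¹ * u (A k))
      (s.1 u))
    congr 1
    ext b
    simp [mul_assoc]

theorem adSec_sub (w : SmoothMap E G n g) (s t : smoothSec E G n g) :
    adSec w (s - t) = adSec w s - adSec w t :=
  Subtype.ext (funext fun _ => map_sub _ _ _)

theorem adSec_adSec (w w' : SmoothMap E G n g) (s : smoothSec E G n g) :
    adSec w (adSec w' s) = adSec (w * w') s :=
  Subtype.ext (funext fun _ => (Ad_mul _ _ _).symm)

/-- The bracket of a handle with the functions, in terms of the decoupled generators. -/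
theorem handlePb_eq (k : Fin g) (s : smoothSec E G n g) (F : smoothFun E G n g) :
    handlePb k s F = along (flow (A k)) (s - adSec (hol (A k))⁻¹ s) F +
      along (flow (B k)) (s - adSec (hol (A k))⁻¹ s) F +
      along (flow (B k)) (adSec (hol (A k))⁻¹ s - adSec ((hol (B k))⁻¹ * hol (A k)) s) F := by
  change _ = along (handleFlow k) _ F + along (rightFlow (B k)) _ F + along (rightFlow (B k)) _ F
  rw [handlePb, along_handleFlow, along_conjFlow, along_conjFlow]
  -- The `u_A`-factors cancel in `Ad(u_B⁻¹ u_A) Ad(u_A⁻¹) = Ad(u_B⁻¹)`, and the two terms with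
  -- `Ad(u_B⁻¹ u_A) s` cancel each other.
  simp only [along_sub, adSec_sub, adSec_adSec, mul_assoc, mul_inv_cancel, mul_one]
  abel

end Flows

/-! ### The flower algebra by generators and relations. -/

section QuantumAlgebra

variable {E : Type*} [NormedAddCommGroup E] [NormedSpace ℝ E] {G : Type*} [TopologicalSpace G]
  [ChartedSpace E G] [Group G] [LieGroup 𝓘(ℝ, E) ∞ G] {n g : ℕ} (ħ : ℝ)

variable (E G n g) in
/-- The projection from the free algebra. -/
def flowerMk : FreeFlower E G n g →ₐ[ℂ] FlowerAlg E G n g ħ := RingQuot.mkAlgHom ℂ (FlowerRel ħ)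

theorem flowerMk_rel {x y : FreeFlower E G n g} (h : FlowerRel ħ x y) :
    flowerMk E G n g ħ x = flowerMk E G n g ħ y := RingQuot.mkAlgHom_rel ℂ h

theorem flowerMk_gen (X : Loop n g) (ξ : LieAlg E G) :
    flowerMk E G n g ħ (freeGen X ξ) = gen ħ X ξ := rfl

theorem flowerMk_fn (F : smoothFun E G n g) : flowerMk E G n g ħ (freeFn F) = fn ħ F := rfl

variable (E G n g) in
/-- The inclusion of the functions. -/
def fnHom : smoothFun E G n g →ₐ[ℂ] FlowerAlg E G n g ħ :=
  AlgHom.ofLinearMap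
    { toFun := fn ħ
      map_add' := fun F K => by
        simpa only [map_add, flowerMk_fn] using flowerMk_rel ħ (FlowerRel.fn_add F K)
      map_smul' := fun c F => by
        have h1 := flowerMk_rel ħ (FlowerRel.fn_mul (algebraMap ℂ (smoothFun E G n g) c) F)
        have h2 := flowerMk_rel ħ (FlowerRel.fn_algebraMap (E := E) (G := G) (n := n) (g := g) c)
        simp only [map_mul, flowerMk_fn, AlgHom.commutes] at h1 h2
        rw [Algebra.smul_def, h1, h2, RingHom.id_apply, Algebra.smul_def] }
    (by
      have h2 := flowerMk_rel ħ (FlowerRel.fn_algebraMap (E := E) (G := G) (n := n) (g := g) 1)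
      simp only [map_one, flowerMk_fn] at h2
      exact h2)
    (fun F K => by
      have h := flowerMk_rel ħ (FlowerRel.fn_mul F K)
      simp only [map_mul, flowerMk_fn] at h
      exact h)

theorem fnHom_apply (F : smoothFun E G n g) : fnHom E G n g ħ F = fn ħ F := rfl

theorem gen_add (X : Loop n g) (ξ η : LieAlg E G) :
    gen (n := n) (g := g) ħ X (ξ + η) = gen ħ X ξ + gen ħ X η := by
  simpa only [map_add, flowerMk_gen] using flowerMk_rel ħ (FlowerRel.gen_add X ξ η)

theorem gen_smul (X : Loop n g) (r : ℝ) (ξ : LieAlg E G) :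
    gen (n := n) (g := g) ħ X (r • ξ) = (r : ℂ) • gen ħ X ξ := by
  simpa only [map_smul, flowerMk_gen] using flowerMk_rel ħ (FlowerRel.gen_smul X r ξ)

theorem gen_lie (X : Loop n g) (ξ η : LieAlg E G) :
    gen (n := n) (g := g) ħ X ξ * gen ħ X η - gen ħ X η * gen ħ X ξ =
      (-(Complex.I * ħ)) • gen ħ X ⁅ξ, η⁆ := by
  simpa only [map_sub, map_mul, map_smul, flowerMk_gen] using
    flowerMk_rel ħ (FlowerRel.gen_lie X ξ η)

theorem gen_comm {X Y : Loop n g} (h : X ≠ Y) (ξ η : LieAlg E G) :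
    gen (n := n) (g := g) ħ X ξ * gen ħ Y η = gen ħ Y η * gen ħ X ξ := by
  simpa only [map_mul, flowerMk_gen] using flowerMk_rel ħ (FlowerRel.gen_comm X Y h ξ η)

theorem gen_fn (X : Loop n g) (ξ : LieAlg E G) (F : smoothFun E G n g) :
    gen (n := n) (g := g) ħ X ξ * fn ħ F - fn ħ F * gen ħ X ξ =
      (Complex.I * ħ) • fn ħ (pb X ξ F) := by
  simpa only [map_sub, map_mul, map_smul, flowerMk_gen, flowerMk_fn] using
    flowerMk_rel ħ (FlowerRel.gen_fn X ξ F)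

variable {ħ}

theorem flowerAlg_hom_ext {A : Type*} [Semiring A] [Algebra ℂ A] {P Q : FlowerAlg E G n g ħ →ₐ[ℂ] A}
    (hfn : ∀ F, P (fn ħ F) = Q (fn ħ F)) (hgen : ∀ X ξ, P (gen ħ X ξ) = Q (gen ħ X ξ)) : P = Q := by
  refine RingQuot.ringQuot_ext' ℂ _ _ (FreeAlgebra.hom_ext (funext fun x => ?_))
  rcases x with ⟨X, ξ⟩ | F
  · exact hgen X ξ
  · exact hfn F

variable (ħ)

/-- The algebra homomorphism out of the flower algebra determined by its values on generators. -/
def flowerLift {A : Type*} [Ring A] [Algebra ℂ A] (T : Loop n g → LieAlg E G →ₗ[ℝ] A)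
    (P : smoothFun E G n g →ₐ[ℂ] A)
    (lie : ∀ X ξ η, T X ξ * T X η - T X η * T X ξ = (-(Complex.I * ħ)) • T X ⁅ξ, η⁆)
    (comm : ∀ X Y, X ≠ Y → ∀ ξ η, T X ξ * T Y η = T Y η * T X ξ)
    (gf : ∀ X ξ F, T X ξ * P F - P F * T X ξ = (Complex.I * ħ) • P (pb X ξ F)) :
    FlowerAlg E G n g ħ →ₐ[ℂ] A :=
  RingQuot.liftAlgHom ℂ ⟨FreeAlgebra.lift ℂ (Sum.elim (fun p => T p.1 p.2) P), by
    intro x y h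
    cases h <;> simp only [freeGen, freeFn, map_add, map_mul, map_sub, map_smul,
      FreeAlgebra.lift_ι_apply, Sum.elim_inl, Sum.elim_inr, AlgHom.commutes, lie, gf]
    case gen_smul => exact (RCLike.real_smul_eq_coe_smul (K := ℂ) _ _)
    case gen_comm h ξ η => exact comm _ _ h _ _⟩

section lift
variable {A : Type*} [Ring A] [Algebra ℂ A] (T : Loop n g → LieAlg E G →ₗ[ℝ] A)
    (P : smoothFun E G n g →ₐ[ℂ] A)
    (lie : ∀ X ξ η, T X ξ * T X η - T X η * T X ξ = (-(Complex.I * ħ)) • T X ⁅ξ, η⁆)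
    (comm : ∀ X Y, X ≠ Y → ∀ ξ η, T X ξ * T Y η = T Y η * T X ξ)
    (gf : ∀ X ξ F, T X ξ * P F - P F * T X ξ = (Complex.I * ħ) • P (pb X ξ F))

theorem flowerLift_gen (X : Loop n g) (ξ : LieAlg E G) :
    flowerLift ħ T P lie comm gf (gen ħ X ξ) = T X ξ := by
  refine (RingQuot.liftAlgHom_mkAlgHom_apply ..).trans ?_
  simp [freeGen]

theorem flowerLift_fn (F : smoothFun E G n g) :
    flowerLift ħ T P lie comm gf (fn ħ F) = P F := by
  refine (RingQuot.liftAlgHom_mkAlgHom_apply ..).trans ?_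
  simp [freeFn]
end lift

/-! ### Generation by the functions and the loop generators. -/

section Generation

variable [FiniteDimensional ℝ E]

theorem gen_sum (X : Loop n g) {ι : Type*} (s : Finset ι) (r : ι → ℝ) (v : ι → LieAlg E G) :
    gen (n := n) (g := g) ħ X (∑ i ∈ s, r i • v i) = ∑ i ∈ s, (r i : ℂ) • gen ħ X (v i) := by
  classical
  induction s using Finset.induction_on with
  | empty => simpa using gen_smul (n := n) (g := g) ħ X 0 (0 : LieAlg E G)
  | insert a s ha ih => rw [Finset.sum_insert ha, Finset.sum_insert ha, gen_add, gen_smul, ih]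

theorem lin_constSec (X : Loop n g) (ξ : LieAlg E G) :
    lin (n := n) (g := g) ħ X (constSec ξ) = gen ħ X ξ := by
  have hc : ∀ b, coordFun b (constSec ξ : smoothSec E G n g) = algebraMap ℂ (smoothFun E G n g)
      ((Module.finBasis ℝ (LieAlg E G)).repr ξ b : ℂ) := fun b => rfl
  conv_rhs => rw [← (Module.finBasis ℝ (LieAlg E G)).sum_repr ξ, gen_sum]
  unfold lin
  refine Finset.sum_congr rfl fun b _ => ?_
  rw [hc, ← fnHom_apply, AlgHom.commutes, Algebra.smul_def]

theorem lin_mem {S : Subalgebra ℂ (FlowerAlg E G n g ħ)} (hfn : ∀ F, fn ħ F ∈ S) {X : Loop n g}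
    (hX : ∀ ξ, gen ħ X ξ ∈ S) (s : smoothSec E G n g) : lin ħ X s ∈ S :=
  sum_mem fun _ _ => mul_mem (hfn _) (hX _)

/-- The functions and the loop generators generate the flower algebra. -/
theorem gen_mem_of_loopGen_mem {S : Subalgebra ℂ (FlowerAlg E G n g ħ)} (hfn : ∀ F, fn ħ F ∈ S)
    (hloop : ∀ X ξ, loopGen ħ X ξ ∈ S) (X : Loop n g) (ξ : LieAlg E G) : gen ħ X ξ ∈ S := by
  have handle : ∀ k : Fin g, (∀ ξ, gen ħ (A k) ξ ∈ S) → (∀ ξ, gen ħ (B k) ξ ∈ S) →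
      ∀ s, handleLin ħ k s ∈ S := fun k hA hB s =>
    add_mem (add_mem (lin_mem ħ hfn hA _) (lin_mem ħ hfn hB _)) (lin_mem ħ hfn hB _)
  have hAB : ∀ k : Fin g, (∀ ξ, gen ħ (A k) ξ ∈ S) ∧ ∀ ξ, gen ħ (B k) ξ ∈ S := by
    intro k
    -- The induction runs downwards, since the generators of the `k`-th handle involve, besides that
    -- handle, only later ones.
    induction k using WellFoundedGT.induction with
    | ind k ih =>
    have hsum : ∀ s, ∑ l ∈ Finset.Ioi k, handleLin ħ l s ∈ S := fun s =>
      sum_mem fun l hl => handle l (ih l (Finset.mem_Ioi.1 hl)).1 (ih l (Finset.mem_Ioi.1 hl)).2 s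
    have hA : ∀ ξ, gen ħ (A k) ξ ∈ S := fun ξ => by
      -- The generators of `A k` and `B k` share their twisted terms, so up to later handles the
      -- difference is `j_{A'} - j_{B'} = t_A`, with no function coefficients left.
      have h := sub_mem (sub_mem (hloop (A k) ξ) (hsum (oneSubAd (A k) ξ)))
        (sub_mem (hloop (B k) ξ) (hsum (oneSubAd (B k) ξ)))
      convert h using 1
      simp only [loopGen, linA, lin_constSec]
      abel
    refine ⟨hA, fun ξ => ?_⟩
    -- The twisted terms of `j_B` add up to `-t_A(Ad(u_A⁻¹) ξ)`, which lies in `S` because `t_A`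
    -- does.
    have h := add_mem (sub_mem (hloop (B k) ξ) (hsum (oneSubAd (B k) ξ)))
      (lin_mem ħ hfn hA (adSec (hol (A k))⁻¹ (constSec ξ)))
    convert h using 1
    simp only [loopGen, linA]
    abel
  rcases X with i | k | k
  -- A puncture involves all handles, which are settled, and the later punctures.
  · induction i using WellFoundedGT.induction generalizing ξ with
    | ind i ih =>
    have h := sub_mem (sub_mem (hloop (M i) ξ)
      (sum_mem (t := Finset.univ) fun k _ => handle k (hAB k).1 (hAB k).2 (oneSubAd (M i) ξ)))
      (sum_mem (t := Finset.Ioi i) fun k hk =>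
        lin_mem ħ hfn (fun η => ih k (Finset.mem_Ioi.1 hk) η) (oneSubAd (M i) ξ))
    convert h using 1
    simp only [loopGen]
    abel
  · exact (hAB k).1 ξ
  · exact (hAB k).2 ξ

theorem flowerAlg_hom_ext_loopGen {A : Type*} [Semiring A] [Algebra ℂ A]
    {P Q : FlowerAlg E G n g ħ →ₐ[ℂ] A} (hfn : ∀ F, P (fn ħ F) = Q (fn ħ F))
    (hgen : ∀ X ξ, P (loopGen ħ X ξ) = Q (loopGen ħ X ξ)) : P = Q :=
  flowerAlg_hom_ext hfn
    (gen_mem_of_loopGen_mem ħ (S := AlgHom.equalizer P Q) hfn hgen)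

end Generation

end QuantumAlgebra

/-! ### The quantum action and its values on the loop generators. -/

section QuantumAction

variable {E : Type*} [NormedAddCommGroup E] [NormedSpace ℝ E] {G : Type*} [TopologicalSpace G]
  [ChartedSpace E G] [Group G] [LieGroup 𝓘(ℝ, E) ∞ G] {n g : ℕ}

/-- Conjugation of functions, as an algebra homomorphism. -/
def conjFnHom (h : G) : smoothFun E G n g →ₐ[ℂ] smoothFun E G n g where
  toFun := conjFn h
  map_one' := rfl
  map_mul' _ _ := rfl
  map_zero' := rfl
  map_add' _ _ := rfl
  commutes' _ := rfl

theorem conjFnHom_apply (h : G) (F : smoothFun E G n g) : conjFnHom h F = conjFn h F := rfl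

theorem pb_add (X : Loop n g) (ξ η : LieAlg E G) (F : smoothFun E G n g) :
    pb X (ξ + η) F = pb X ξ F + pb X η F := by
  refine Subtype.ext (funext fun u => ?_)
  exact (congrArg Neg.neg (derivOne_add_dir _ _ _)).trans (neg_add _ _)

theorem pb_smul (X : Loop n g) (r : ℝ) (ξ : LieAlg E G) (F : smoothFun E G n g) :
    pb X (r • ξ) F = (r : ℂ) • pb X ξ F := by
  refine Subtype.ext (funext fun u => ?_)
  refine (congrArg Neg.neg (derivOne_smul_dir _ _ _)).trans ?_
  exact (smul_neg r _).symm.trans (Complex.coe_smul r _).symm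

theorem pb_val (X : Loop n g) (ξ : LieAlg E G) (F : smoothFun E G n g) :
    (pb X ξ F).1 = -flowDeriv (flow X) ξ F.1 := rfl

theorem flowDeriv_neg {W : Type*} [NormedAddCommGroup W] [NormedSpace ℝ W] {ψ : Config G n g → W}
    (hψ : ContMDiff (powModel E (Loop n g)) 𝓘(ℝ, W) ∞ ψ) (φ : FlowMap E G n g) (ξ : LieAlg E G) :
    flowDeriv φ ξ (-ψ) = -flowDeriv φ ξ ψ :=
  funext fun u => derivOne_clm (-ContinuousLinearMap.id ℝ W) (mdifferentiableAt_comp_flow hψ φ u) ξ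

theorem pb_pb_val (X Y : Loop n g) (ξ η : LieAlg E G) (F : smoothFun E G n g) :
    (pb X ξ (pb Y η F)).1 = flowDeriv (flow X) ξ (flowDeriv (flow Y) η F.1) := by
  rw [pb_val, pb_val, flowDeriv_neg (contMDiff_flowDeriv F.2 _ _), neg_neg]

/-- `pb` is minus the flow derivative; in the iterated brackets the signs cancel, on the right one
sign remains. This matches the sign in `{ξ, η} = -[ξ, η]`. -/
theorem pb_lie [CompleteSpace E] (X : Loop n g) (ξ η : LieAlg E G) (F : smoothFun E G n g) :
    pb X ξ (pb X η F) - pb X η (pb X ξ F) = -pb X ⁅ξ, η⁆ F := by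
  refine Subtype.ext ?_
  change (pb X ξ (pb X η F)).1 - (pb X η (pb X ξ F)).1 = -(pb X ⁅ξ, η⁆ F).1
  rw [pb_pb_val, pb_pb_val, flowDeriv_lie F.2 (flow_mul X), pb_val, neg_neg]

theorem pb_comm {X Y : Loop n g} (h : X ≠ Y) (ξ η : LieAlg E G) (F : smoothFun E G n g) :
    pb X ξ (pb Y η F) = pb Y η (pb X ξ F) := by
  refine Subtype.ext ?_
  rw [pb_pb_val, pb_pb_val, flowDeriv_comm F.2 (flow_comm h)]

theorem conjFn_pb (h : G) (X : Loop n g) (ξ : LieAlg E G) (F : smoothFun E G n g) :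
    conjFn h (pb X ξ F) = pb X (Ad h ξ) (conjFn h F) := by
  refine Subtype.ext (funext fun u => ?_)
  refine congrArg Neg.neg ?_
  have h1 := derivOne_conj (mdifferentiableAt_comp_flow (conjFn h F).2 (flow X) u) h ξ
  refine Eq.trans ?_ h1
  have h0 : (fun X => h⁻¹ * u X * h) = conjAll h⁻¹ u := by ext; simp [conjAll]
  change derivOne (fun a => F.1 (flow (E := E) X (fun X => h⁻¹ * u X * h, a))) ξ = _
  rw [h0]
  congr 1
  funext a
  refine congrArg F.1 ?_
  have h2 := conjAll_flow (E := E) X h (conjAll h⁻¹ u) a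
  have h3 : conjAll h (conjAll h⁻¹ u) = u := by ext; simp [conjAll, mul_assoc]
  rw [h3] at h2
  rw [← h2]
  ext Y
  simp [conjAll, mul_assoc]

theorem conjFn_conjFn (h k : G) (F : smoothFun E G n g) :
    conjFn h (conjFn k F) = conjFn (h * k) F := by
  refine Subtype.ext (funext fun u => congrArg F.1 ?_)
  ext X
  simp [mul_assoc]

theorem conjFn_one (F : smoothFun E G n g) : conjFn 1 F = F := by
  refine Subtype.ext (funext fun u => congrArg F.1 ?_)
  ext X
  simp

theorem totalHol_apply (u : Config G n g) : totalHol (E := E) u =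
    (List.ofFn fun k : Fin g => u (B k) * (u (A k))⁻¹ * (u (B k))⁻¹ * u (A k)).reverse.prod *
      (List.ofFn fun i : Fin n => u (M i)).reverse.prod := by
  have hl : ∀ l : List (SmoothMap E G n g), l.prod u = (l.map fun w => w u).prod := fun l => by
    induction l with
    | nil => rfl
    | cons w l ih =>
      rw [List.prod_cons, List.map_cons, List.prod_cons, ← ih]
      rfl
  refine (congrArg₂ (· * ·) (hl _) (hl _)).trans ?_
  rw [List.map_reverse, List.map_reverse, List.map_ofFn, List.map_ofFn]
  rfl

/-- Each factor of the total holonomy is a word in the components, and conjugation by `h` is a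
homomorphism. This equivariance makes both the quantum action and `Γ` compatible with the twisted
product. -/
theorem totalHol_conj (h : G) (u : Config G n g) :
    totalHol (E := E) (conjAll h u) = h * totalHol (E := E) u * h⁻¹ := by
  have hp : ∀ l : List G, (l.map (MulAut.conj h)).prod = MulAut.conj h l.prod :=
    fun l => (map_list_prod _ l).symm
  have key : ∀ {m : ℕ} (w w' : Fin m → G), (∀ i, w' i = h * w i * h⁻¹) →
      (List.ofFn w').reverse.prod = MulAut.conj h (List.ofFn w).reverse.prod := fun w w' hw => by
    rw [← hp, List.map_reverse, List.map_ofFn]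
    congr 3
    funext i
    exact hw i
  rw [totalHol_apply, totalHol_apply, ← MulAut.conj_apply, map_mul]
  exact congrArg₂ (· * ·) (key _ _ fun k => by simp [conjAll, mul_assoc]) (key _ _ fun i => rfl)

theorem conjFn_charge (h : G) (f : SmoothG E G) :
    conjFn (n := n) (g := g) h (charge f) = charge (conjG h f) := by
  refine Subtype.ext (funext fun u => congrArg Complex.ofReal (congrArg f ?_))
  have h1 := totalHol_conj (E := E) h⁻¹ u
  rw [inv_inv] at h1
  refine Eq.trans ?_ h1
  congr 1
  ext X
  simp [conjAll]

theorem charge_add (f f' : SmoothG E G) :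
    charge (n := n) (g := g) (f + f') = charge f + charge f' :=
  Subtype.ext (funext fun _ => Complex.ofReal_add _ _)

theorem charge_zero : charge (n := n) (g := g) (0 : SmoothG E G) = 0 :=
  Subtype.ext (funext fun _ => Complex.ofReal_zero)

theorem pb_fun_add (X : Loop n g) (ξ : LieAlg E G) (F K : smoothFun E G n g) :
    pb X ξ (F + K) = pb X ξ F + pb X ξ K := by
  refine Subtype.ext (funext fun u => ?_)
  refine (congrArg Neg.neg (derivOne_add (mdifferentiableAt_comp_flow F.2 (flow X) u)
    (mdifferentiableAt_comp_flow K.2 (flow X) u) ξ)).trans (neg_add _ _)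

theorem pb_fun_zero (X : Loop n g) (ξ : LieAlg E G) :
    pb X ξ (0 : smoothFun E G n g) = 0 := by
  have h := pb_fun_add X ξ (0 : smoothFun E G n g) 0
  rwa [add_zero, left_eq_add] at h

variable (ħ : ℝ)

theorem gen_mul_fn (X : Loop n g) (ξ : LieAlg E G) (F : smoothFun E G n g) :
    gen ħ X ξ * fn ħ F = fn ħ F * gen ħ X ξ + (Complex.I * ħ) • fn ħ (pb X ξ F) := by
  rw [← gen_fn]; abel

theorem fn_comm (F K : smoothFun E G n g) : fn ħ F * fn ħ K = fn ħ K * fn ħ F := by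
  rw [← fnHom_apply, ← fnHom_apply, ← map_mul, ← map_mul, mul_comm]

variable [FiniteDimensional ℝ E] [T2Space G]

/-- The image of a generator under the quantum action. -/
def actionGen (x : SymGroup E G) (X : Loop n g) : LieAlg E G →ₗ[ℝ] FlowerAlg E G n g ħ where
  toFun ξ := gen ħ X (Ad x.h ξ) + fn ħ (pb X (Ad x.h ξ) (charge x.f))
  map_add' ξ η := by
    simp only [map_add, gen_add, pb_add, ← fnHom_apply]
    abel
  map_smul' r ξ := by
    simp only [map_smul, gen_smul, pb_smul, ← fnHom_apply]
    rw [RingHom.id_apply, smul_add, Complex.coe_smul, Complex.coe_smul]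

theorem actionGen_apply (x : SymGroup E G) (X : Loop n g) (ξ : LieAlg E G) :
    actionGen ħ x X ξ = gen ħ X (Ad x.h ξ) + fn ħ (pb X (Ad x.h ξ) (charge x.f)) := rfl

/-- The functions commute with each other, so only the commutators of a generator with a function
add anything. The extra term is the failure of `ξ ↦ pb X ξ F` to be a cocycle in the required sense,
and `pb_lie` and `pb_comm` control it. -/
theorem commutator_gen_add_fn (X Y : Loop n g) (ξ η : LieAlg E G) (F : smoothFun E G n g) :
    (gen ħ X ξ + fn ħ (pb X ξ F)) * (gen ħ Y η + fn ħ (pb Y η F)) -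
      (gen ħ Y η + fn ħ (pb Y η F)) * (gen ħ X ξ + fn ħ (pb X ξ F)) =
    gen ħ X ξ * gen ħ Y η - gen ħ Y η * gen ħ X ξ +
      (Complex.I * ħ) • fn ħ (pb X ξ (pb Y η F) - pb Y η (pb X ξ F)) := by
  simp only [mul_add, add_mul, gen_mul_fn, fn_comm ħ (pb X ξ F) (pb Y η F)]
  rw [← fnHom_apply ħ (_ - _), map_sub, smul_sub, fnHom_apply, fnHom_apply]
  abel

/-- The quantum action of an element of `G ⋉ C^∞(G)`, as an algebra homomorphism. -/
def actionHom (x : SymGroup E G) : FlowerAlg E G n g ħ →ₐ[ℂ] FlowerAlg E G n g ħ :=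
  flowerLift ħ (actionGen ħ x) ((fnHom E G n g ħ).comp (conjFnHom x.h))
    (fun X ξ η => by
      have := FiniteDimensional.complete ℝ E
      simp only [actionGen_apply]
      rw [commutator_gen_add_fn, pb_lie, gen_lie, ← fnHom_apply, ← fnHom_apply, map_neg, smul_neg,
        smul_add, Ad_lie, neg_smul, neg_smul])
    (fun X Y hXY ξ η => by
      rw [← sub_eq_zero]
      simp only [actionGen_apply]
      rw [commutator_gen_add_fn, gen_comm ħ hXY, pb_comm hXY, sub_self, sub_self, ← fnHom_apply,
        map_zero, smul_zero, add_zero])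
    (fun X ξ F => by
      simp only [actionGen_apply, AlgHom.comp_apply, fnHom_apply, conjFnHom_apply]
      -- The added function commutes with functions and drops out; what remains is covariance of the
      -- bracket under conjugation.
      rw [add_mul, mul_add, fn_comm ħ (pb X _ _), add_sub_add_right_eq_sub, gen_fn, conjFn_pb])

theorem actionHom_gen (x : SymGroup E G) (X : Loop n g) (ξ : LieAlg E G) :
    actionHom ħ x (gen ħ X ξ) = gen ħ X (Ad x.h ξ) + fn ħ (pb X (Ad x.h ξ) (charge x.f)) :=
  flowerLift_gen ..

theorem actionHom_fn (x : SymGroup E G) (F : smoothFun E G n g) :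
    actionHom ħ x (fn ħ F) = fn ħ (conjFn x.h F) :=
  flowerLift_fn ..

omit [FiniteDimensional ℝ E] [T2Space G] in
theorem symGroup_mul_f (x y : SymGroup E G) : (x * y).f = x.f + conjG x.h y.f := rfl

omit [FiniteDimensional ℝ E] [T2Space G] in
theorem symGroup_mul_h (x y : SymGroup E G) : (x * y).h = x.h * y.h := rfl

omit [FiniteDimensional ℝ E] [T2Space G] in
theorem symGroup_one_f : (1 : SymGroup E G).f = 0 := rfl

omit [FiniteDimensional ℝ E] [T2Space G] in
theorem symGroup_one_h : (1 : SymGroup E G).h = 1 := rfl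

variable (E G n g) in
/-- The quantum action as a homomorphism into the endomorphisms. -/
def actionEnd : SymGroup E G →* (FlowerAlg E G n g ħ →ₐ[ℂ] FlowerAlg E G n g ħ) where
  toFun := actionHom ħ
  map_one' := by
    refine flowerAlg_hom_ext (fun F => ?_) fun X ξ => ?_
    · rw [actionHom_fn, symGroup_one_h, conjFn_one]; rfl
    · rw [actionHom_gen, symGroup_one_h, symGroup_one_f, Ad_one, charge_zero, pb_fun_zero,
        ← fnHom_apply, map_zero, add_zero]
      rfl
  map_mul' x y := by
    refine flowerAlg_hom_ext (fun F => ?_) fun X ξ => ?_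
    · rw [AlgHom.mul_apply, actionHom_fn, actionHom_fn, actionHom_fn, conjFn_conjFn, symGroup_mul_h]
    -- Conjugation by the outer `h` turns the charge of the inner `f` into the charge of `f ∘
    -- Ad_{h⁻¹}`, which is the product rule of the semidirect product.
    · rw [AlgHom.mul_apply, actionHom_gen, actionHom_gen, map_add, actionHom_gen, actionHom_fn,
        symGroup_mul_h, symGroup_mul_f, Ad_mul, conjFn_pb, conjFn_charge, charge_add, pb_fun_add,
        ← fnHom_apply, map_add, fnHom_apply, fnHom_apply, add_assoc]

variable (E G n g) in
/-- The quantum action. -/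
def quantumAction : SymGroup E G →* (FlowerAlg E G n g ħ ≃ₐ[ℂ] FlowerAlg E G n g ħ) :=
  -- A homomorphism from a group to a monoid takes values in the units, so invertibility needs no
  -- separate proof.
  (AlgEquiv.algHomUnitsEquiv ℂ (FlowerAlg E G n g ħ)).toMonoidHom.comp (actionEnd E G n g ħ).toHomUnits

theorem quantumAction_apply (x : SymGroup E G) (Z : FlowerAlg E G n g ħ) :
    quantumAction E G n g ħ x Z = actionHom ħ x Z := rfl

/-- The section `u ↦ Ad(h) s(h⁻¹ u h)`. -/
def conjSec (h : G) (s : smoothSec E G n g) : smoothSec E G n g :=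
  ⟨fun u => Ad h (s.1 (conjAll h⁻¹ u)), contMDiff_Ad contMDiff_const
    (ContMDiff.comp (I' := powModel E (Loop n g)) s.2 (contMDiff_pow fun X =>
      (contMDiff_const.mul (contMDiff_coord X)).mul contMDiff_const))⟩

theorem conjSec_const (h : G) (ξ : LieAlg E G) :
    conjSec h (constSec ξ : smoothSec E G n g) = constSec (Ad h ξ) := rfl

theorem conjSec_sub (h : G) (s t : smoothSec E G n g) :
    conjSec h (s - t) = conjSec h s - conjSec h t :=
  Subtype.ext (funext fun _ => map_sub _ _ _)

/-- Equivariance of a smooth map to `G`. -/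
def EquivariantMap (w : SmoothMap E G n g) : Prop := ∀ h u, w (conjAll h u) = h * w u * h⁻¹

theorem equivariantMap_hol (X : Loop n g) : EquivariantMap (E := E) (G := G) (hol X) :=
  fun _ _ => rfl

theorem EquivariantMap.inv {w : SmoothMap E G n g} (hw : EquivariantMap w) :
    EquivariantMap w⁻¹ := fun h u => by
  change (w _)⁻¹ = h * (w u)⁻¹ * h⁻¹
  rw [hw]
  simp [mul_assoc]

theorem EquivariantMap.mul {w w' : SmoothMap E G n g} (hw : EquivariantMap w)
    (hw' : EquivariantMap w') : EquivariantMap (w * w') := fun h u => by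
  change w _ * w' _ = h * (w u * w' u) * h⁻¹
  rw [hw, hw']
  simp [mul_assoc]

/-- Equivariance of `w` is the identity `h · w(h⁻¹ u h) = w(u) · h`. -/
theorem conjSec_adSec (h : G) {w : SmoothMap E G n g} (hw : EquivariantMap w)
    (s : smoothSec E G n g) : conjSec h (adSec w s) = adSec w (conjSec h s) := by
  refine Subtype.ext (funext fun u => ?_)
  change Ad h (Ad (w (conjAll h⁻¹ u)) (s.1 (conjAll h⁻¹ u))) =
    Ad (w u) (Ad h (s.1 (conjAll h⁻¹ u)))
  rw [← Ad_mul, ← Ad_mul, hw]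
  simp [mul_assoc]

theorem conjSec_oneSubAd (h : G) (X : Loop n g) (ξ : LieAlg E G) :
    conjSec h (oneSubAd X ξ) = oneSubAd X (Ad h ξ) := by
  rw [oneSubAd, conjSec_sub, conjSec_adSec h (equivariantMap_hol X), conjSec_const, oneSubAd]

theorem sum_coord_smul (ξ : LieAlg E G) :
    ∑ b, (Module.finBasis ℝ (LieAlg E G)).coord b ξ • Module.finBasis ℝ (LieAlg E G) b = ξ :=
  (Module.finBasis ℝ (LieAlg E G)).sum_repr ξ

theorem coordFun_conjSec (h : G) (c : Fin (Module.finrank ℝ (LieAlg E G)))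
    (s : smoothSec E G n g) :
    coordFun c (conjSec h s) = ∑ b, ((Module.finBasis ℝ (LieAlg E G)).coord c
      (Ad h (Module.finBasis ℝ (LieAlg E G) b)) : ℂ) • conjFn h (coordFun b s) := by
  refine Subtype.ext (funext fun u => ?_)
  rw [AddSubmonoidClass.coe_finsetSum, Finset.sum_apply]
  change (((Module.finBasis ℝ (LieAlg E G)).coord c (Ad h (s.1 (conjAll h⁻¹ u))) : ℝ) : ℂ) =
    ∑ b, (((Module.finBasis ℝ (LieAlg E G)).coord c (Ad h (Module.finBasis ℝ (LieAlg E G) b)) : ℝ) : ℂ) *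
      (((Module.finBasis ℝ (LieAlg E G)).coord b (s.1 fun X => h⁻¹ * u X * h) : ℝ) : ℂ)
  have hu : (fun X => h⁻¹ * u X * h) = conjAll h⁻¹ u := by ext; simp [conjAll]
  rw [hu]
  conv_lhs => rw [← sum_coord_smul (s.1 (conjAll h⁻¹ u))]
  rw [map_sum, map_sum, Complex.ofReal_sum]
  refine Finset.sum_congr rfl fun b _ => ?_
  rw [map_smul, map_smul, smul_eq_mul, mul_comm, Complex.ofReal_mul]

/-- The matrix of `Ad h` passes from the basis vectors to the coordinates of the section, so the
image of `lin` does not depend on the basis used to define it. -/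
theorem sum_conj_coordFun_mul_gen (h : G) (X : Loop n g) (s : smoothSec E G n g) :
    ∑ b, fn ħ (conjFn h (coordFun b s)) * gen ħ X (Ad h (Module.finBasis ℝ (LieAlg E G) b)) =
      lin ħ X (conjSec h s) := by
  have h1 : ∀ b, gen (n := n) (g := g) ħ X (Ad h (Module.finBasis ℝ (LieAlg E G) b)) =
      ∑ c, (((Module.finBasis ℝ (LieAlg E G)).coord c
        (Ad h (Module.finBasis ℝ (LieAlg E G) b)) : ℝ) : ℂ) •
          gen ħ X (Module.finBasis ℝ (LieAlg E G) c) := fun b => by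
    rw [← gen_sum, sum_coord_smul]
  simp only [h1, Finset.mul_sum]
  rw [Finset.sum_comm]
  unfold lin
  refine Finset.sum_congr rfl fun c _ => ?_
  rw [coordFun_conjSec, ← fnHom_apply, map_sum, Finset.sum_mul]
  refine Finset.sum_congr rfl fun b _ => ?_
  rw [map_smul, smul_mul_assoc, mul_smul_comm, fnHom_apply]

theorem sum_conj_coordFun_mul_pb (h : G) (X : Loop n g) (s : smoothSec E G n g)
    (F : smoothFun E G n g) :
    ∑ b, conjFn h (coordFun b s) * pb X (Ad h (Module.finBasis ℝ (LieAlg E G) b)) F =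
      -along (flow X) (conjSec h s) F := by
  have h1 : ∀ (u : Config G n g) (ι : Type) (t : Finset ι) (r : ι → ℝ) (v : ι → LieAlg E G),
      flowDeriv (flow X) (∑ i ∈ t, r i • v i) F.1 u =
        ∑ i ∈ t, (r i : ℂ) * flowDeriv (flow X) (v i) F.1 u := fun u ι t r v => by
    let D : LieAlg E G →ₗ[ℝ] ℂ :=
      { toFun := fun ξ => flowDeriv (flow X) ξ F.1 u
        map_add' := derivOne_add_dir _
        map_smul' := derivOne_smul_dir _ }
    exact (map_sum D _ _).trans (Finset.sum_congr rfl fun i _ =>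
      (map_smul D _ _).trans (Complex.real_smul))
  refine Subtype.ext (funext fun u => ?_)
  rw [AddSubmonoidClass.coe_finsetSum, Finset.sum_apply]
  change ∑ b, (((Module.finBasis ℝ (LieAlg E G)).coord b (s.1 fun X => h⁻¹ * u X * h) : ℝ) : ℂ) *
    -flowDeriv (flow X) (Ad h (Module.finBasis ℝ (LieAlg E G) b)) F.1 u =
      -flowDeriv (flow X) (Ad h (s.1 (conjAll h⁻¹ u))) F.1 u
  have hu : (fun X => h⁻¹ * u X * h) = conjAll h⁻¹ u := by ext; simp [conjAll]
  rw [hu]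
  conv_rhs => rw [← sum_coord_smul (s.1 (conjAll h⁻¹ u)), map_sum]
  simp only [map_smul]
  rw [h1, ← Finset.sum_neg_distrib]
  exact Finset.sum_congr rfl fun b _ => mul_neg _ _

/-- The coefficients stand to the left of the generators, so applying the homomorphism creates no
ordering terms and the correction is linear over the functions. -/
theorem actionHom_lin (x : SymGroup E G) (X : Loop n g) (s : smoothSec E G n g) :
    actionHom ħ x (lin ħ X s) = lin ħ X (conjSec x.h s) -
      fn ħ (along (flow X) (conjSec x.h s) (charge x.f)) := by
  have h := congrArg (fnHom E G n g ħ) (sum_conj_coordFun_mul_pb x.h X s (charge x.f))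
  rw [map_neg] at h
  rw [sub_eq_add_neg, ← fnHom_apply, ← h, ← sum_conj_coordFun_mul_gen, map_sum, ← Finset.sum_add_distrib]
  unfold lin
  rw [map_sum]
  refine Finset.sum_congr rfl fun b _ => ?_
  rw [map_mul, map_mul, actionHom_fn, actionHom_gen, mul_add]
  rfl

theorem actionHom_handleLin (x : SymGroup E G) (k : Fin g) (s : smoothSec E G n g) :
    actionHom ħ x (handleLin ħ k s) = handleLin ħ k (conjSec x.h s) -
      fn ħ (handlePb k (conjSec x.h s) (charge x.f)) := by
  rw [handlePb_eq, ← fnHom_apply]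
  simp only [handleLin, linA, map_add, actionHom_lin, conjSec_sub,
    conjSec_adSec _ (equivariantMap_hol _).inv,
    conjSec_adSec _ ((equivariantMap_hol (B k)).inv.mul (equivariantMap_hol (A k))), fnHom_apply]
  abel

/-- Each `lin` contributes minus a derivative along its flow. It remains to see that these
derivatives add up to the classical bracket, an identity between fields generated by left, right and
conjugation flows. -/
theorem actionHom_loopGen (x : SymGroup E G) (X : Loop n g) (ξ : LieAlg E G) :
    actionHom ħ x (loopGen ħ X ξ) = loopGen ħ X (Ad x.h ξ) +
      fn ħ (loopPb X (Ad x.h ξ) (charge x.f)) := by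
  rcases X with i | i | i
  · simp only [loopGen, loopPb, map_add, map_sum, actionHom_lin, actionHom_handleLin,
      conjSec_oneSubAd, ← lin_constSec, conjSec_const, Finset.sum_sub_distrib]
    simp only [← fnHom_apply, map_sub, map_neg, map_sum]
    simp only [flow]
    abel
  · simp only [loopGen, loopPb, linA, map_add, map_sub, map_sum, actionHom_lin, actionHom_handleLin,
      conjSec_oneSubAd, conjSec_const, Finset.sum_sub_distrib,
      conjSec_adSec _ (equivariantMap_hol _).inv]
    -- All fields are written in terms of right translations of `u_A` and `u_B`, after which the
    -- terms match one by one.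
    simp only [← fnHom_apply, map_sub, map_neg, map_sum, flow, along_handleFlow, along_conjFlow,
      adSec_adSec, mul_assoc, mul_inv_cancel, mul_one, map_add]
    abel
  · simp only [loopGen, loopPb, linA, map_add, map_sub, map_sum, actionHom_lin, actionHom_handleLin,
      conjSec_oneSubAd, conjSec_const, Finset.sum_sub_distrib, ← lin_constSec,
      conjSec_adSec _ (equivariantMap_hol _).inv]
    simp only [← fnHom_apply, map_sub, map_neg, map_sum, flow, along_handleFlow, along_conjFlow,
      adSec_adSec, mul_assoc, mul_inv_cancel, mul_one, map_add, along_leftFlow]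
    abel

theorem isQuantumAction_quantumAction : IsQuantumAction ħ (quantumAction E G n g ħ) :=
  ⟨actionHom_fn ħ, actionHom_loopGen ħ⟩

theorem IsQuantumAction.eq {τ : SymGroup E G →* (FlowerAlg E G n g ħ ≃ₐ[ℂ] FlowerAlg E G n g ħ)}
    (hτ : IsQuantumAction ħ τ) : τ = quantumAction E G n g ħ := by
  refine MonoidHom.ext fun x => AlgEquiv.ext fun Z => ?_
  have h : (τ x : FlowerAlg E G n g ħ →ₐ[ℂ] FlowerAlg E G n g ħ) = actionHom ħ x :=
    flowerAlg_hom_ext_loopGen ħ (fun F => (hτ.map_fn x F).trans (actionHom_fn ħ x F).symm)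
      fun X ξ => (hτ.map_loopGen x X ξ).trans (actionHom_loopGen ħ x X ξ).symm
  exact DFunLike.congr_fun h Z

end QuantumAction

/-! ### The representation on smooth equivariant functions. -/

section FlowerRepresentation

section Topology

variable {n g : ℕ} {G : Type*} [Group G] [TopologicalSpace G] {gμ : Fin n → G}

theorem mem_stab_iff {i : Fin n} {x : G} : x ∈ stab gμ i ↔ gμ i * x = x * gμ i := by
  simp [stab, Subgroup.mem_centralizer_iff]

theorem continuous_toBase : Continuous (toBase (g := g) gμ) := by
  refine Continuous.prodMk (continuous_pi fun i => ?_) (by fun_prop)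
  exact QuotientGroup.continuous_mk.comp (continuous_apply _)

/-- Products of quotient maps need not be quotient maps, but products of open ones are; projections
to coset spaces are open. -/
theorem isOpenQuotientMap_toBase [IsTopologicalGroup G] :
    IsOpenQuotientMap (toBase (g := g) gμ) := by
  have h1 : IsOpenQuotientMap (Prod.map (Pi.map fun i (x : G) => (x : G ⧸ stab gμ i))
      (id : (Fin g ⊕ Fin g → G) → _)) :=
    (IsOpenQuotientMap.piMap fun _ => QuotientGroup.isOpenQuotientMap_mk).prodMap .id
  exact h1.comp (Homeomorph.sumArrowHomeomorphProdArrow (ι := Fin n) (ι' := Fin g ⊕ Fin g)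
    (X := G)).isOpenQuotientMap

/-- The choice `ofBase` need not be continuous. A right-invariant `F` descends along the quotient
map, and its value at the chosen representative is the descended function. -/
theorem continuous_comp_ofBase [IsTopologicalGroup G] {β : Type*} [TopologicalSpace β]
    {F : Config G n g → β} (hF : Continuous F)
    (hinv : ∀ v (k : ∀ i, stab gμ i), F (rightMul v k) = F v) :
    Continuous fun q => F (ofBase gμ q) := by
  rw [(isOpenQuotientMap_toBase (g := g) (gμ := gμ)).isQuotientMap.continuous_iff]
  refine hF.congr fun v => ?_
  obtain ⟨k, hk⟩ := exists_rightMul (gμ := gμ) v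
  rw [Function.comp_apply, hk, hinv]

/-- The orbit map `x ↦ x gμ x⁻¹` embeds the coset space injectively and continuously in `G`. The
Hausdorff property makes compact supports closed. -/
instance t2Space_quotient_stab [IsTopologicalGroup G] [T2Space G] (i : Fin n) :
    T2Space (G ⧸ stab gμ i) := by
  let F : G ⧸ stab gμ i → G := Quotient.lift (fun x => x * gμ i * x⁻¹) fun a b hab => by
    have h := mem_stab_iff.1 (QuotientGroup.leftRel_apply.1 hab)
    have : b = a * (a⁻¹ * b) := by simp
    rw [this]
    generalize a⁻¹ * b = k at h
    rw [mul_inv_rev, mul_assoc a k, ← h]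
    simp [mul_assoc]
  have hc : Continuous F := by
    refine Continuous.quotient_lift (by fun_prop) _
  refine T2Space.of_injective_continuous (f := F) ?_ hc
  rintro ⟨a⟩ ⟨b⟩ hab
  refine Quotient.sound (QuotientGroup.leftRel_apply.2 (mem_stab_iff.2 ?_))
  have hab' : a * gμ i * a⁻¹ = b * gμ i * b⁻¹ := hab
  have : gμ i = a⁻¹ * (b * gμ i * b⁻¹) * a := by rw [← hab']; simp [mul_assoc]
  conv_lhs => rw [this]
  simp [mul_assoc]

end Topology

variable {n g : ℕ} {E : Type*} [NormedAddCommGroup E] [NormedSpace ℝ E] {G : Type*}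
  [TopologicalSpace G] [ChartedSpace E G] [Group G] [LieGroup 𝓘(ℝ, E) ∞ G] {gμ : Fin n → G}
  {W : Type*} [NormedAddCommGroup W] [InnerProductSpace ℂ W]

theorem contMDiff_beta :
    ContMDiff (powModel E (Loop n g)) (powModel E (Loop n g)) ∞ (beta (g := g) gμ) := by
  refine contMDiff_pow fun X => ?_
  rcases X with i | X
  · exact ((contMDiff_coord _).mul contMDiff_const).mul (contMDiff_coord _).inv
  · exact contMDiff_coord _

/-- For a puncture, `(h⁻¹ v) gμ (h⁻¹ v)⁻¹ = h⁻¹ (v gμ v⁻¹) h`; on the handles `β` is the identity.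
The commutators with functions come out right because of this. -/
theorem beta_repFlow (X : Loop n g) (v : Config G n g) (a : G) :
    beta gμ (repFlow (E := E) X (v, a)) = flow (E := E) X (beta gμ v, a) := by
  rcases X with i | k | k <;>
  · ext (j | Y | Y) <;>
    simp only [flow, conjFlow, handleFlow, rightFlow, repFlow, leftFlow, ContMDiffMap.coeFn_mk,
      Function.update_apply, beta, Sum.inl.injEq, Sum.inr.injEq, reduceCtorEq, if_false] <;>
    split_ifs <;> simp_all [mul_assoc]

/-- Left translations commute with the right action of the stabilisers, so the flow derivatives
preserve equivariance. -/
theorem repFlow_rightMul (X : Loop n g) (v : Config G n g) (k : ∀ i, stab gμ i) (a : G) :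
    repFlow (E := E) X (rightMul v k, a) = rightMul (repFlow (E := E) X (v, a)) k := by
  rcases X with i | j | j <;>
  · ext (l | Y | Y) <;>
    simp only [handleFlow, rightFlow, repFlow, leftFlow, ContMDiffMap.coeFn_mk,
      Function.update_apply, rightMul, Sum.inl.injEq, Sum.inr.injEq, reduceCtorEq, if_false] <;>
    split_ifs <;> simp_all [mul_assoc] <;> (subst_vars; rfl)

theorem beta_rightMul (v : Config G n g) (k : ∀ i, stab gμ i) :
    beta gμ (rightMul v k) = beta gμ v := by
  ext (i | X)
  · have h := mem_stab_iff.1 (k i).2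
    simp only [beta, rightMul, mul_inv_rev]
    rw [mul_assoc (v (M i)), ← h]
    simp [mul_assoc]
  · rfl

theorem repFlow_one (X : Loop n g) (v : Config G n g) : repFlow (E := E) X (v, 1) = v := by
  rcases X with i | j | j <;>
  · ext (l | Y | Y) <;>
    simp only [handleFlow, rightFlow, repFlow, leftFlow, ContMDiffMap.coeFn_mk,
      Function.update_apply] <;>
    split_ifs <;> simp_all

theorem derivOne_complex_smul {φ : G → W} (hφ : MDifferentiableAt 𝓘(ℝ, E) 𝓘(ℝ, W) φ 1) (c : ℂ)
    (ξ : LieAlg E G) : derivOne (fun x => c • φ x) ξ = c • derivOne φ ξ :=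
  derivOne_clm (c • ContinuousLinearMap.id ℝ W) hφ ξ

theorem flowDeriv_complex_smul {ψ : Config G n g → W}
    (hψ : ContMDiff (powModel E (Loop n g)) 𝓘(ℝ, W) ∞ ψ) (φ : FlowMap E G n g) (ξ : LieAlg E G)
    (c : ℂ) : flowDeriv φ ξ (c • ψ) = c • flowDeriv φ ξ ψ :=
  funext fun u => derivOne_complex_smul (mdifferentiableAt_comp_flow hψ φ u) c ξ

theorem flowDeriv_add {ψ χ : Config G n g → W}
    (hψ : ContMDiff (powModel E (Loop n g)) 𝓘(ℝ, W) ∞ ψ)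
    (hχ : ContMDiff (powModel E (Loop n g)) 𝓘(ℝ, W) ∞ χ) (φ : FlowMap E G n g) (ξ : LieAlg E G) :
    flowDeriv φ ξ (ψ + χ) = flowDeriv φ ξ ψ + flowDeriv φ ξ χ :=
  funext fun u => derivOne_add (mdifferentiableAt_comp_flow hψ φ u)
    (mdifferentiableAt_comp_flow hχ φ u) ξ

theorem derivOne_fun_smul {χ : G → ℂ} {φ : G → W} (hχ : MDifferentiableAt 𝓘(ℝ, E) 𝓘(ℝ, ℂ) χ 1)
    (hφ : MDifferentiableAt 𝓘(ℝ, E) 𝓘(ℝ, W) φ 1) (ξ : LieAlg E G) :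
    derivOne (fun x => χ x • φ x) ξ = χ 1 • derivOne φ ξ + derivOne χ ξ • φ 1 :=
  derivOne_bilin (ContinuousLinearMap.lsmul ℝ ℂ) hχ hφ ξ

theorem contMDiff_fun_smul {χ : Config G n g → ℂ} {ψ : Config G n g → W}
    (hχ : ContMDiff (powModel E (Loop n g)) 𝓘(ℝ, ℂ) ∞ χ)
    (hψ : ContMDiff (powModel E (Loop n g)) 𝓘(ℝ, W) ∞ ψ) :
    ContMDiff (powModel E (Loop n g)) 𝓘(ℝ, W) ∞ fun v => χ v • ψ v := by
  have h : ContDiff ℝ ∞ fun p : ℂ × W => p.1 • p.2 := contDiff_smul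
  exact h.contMDiff.comp (hχ.prodMk_space hψ)

variable {σ : (∀ i, stab gμ i) → W →ₗᵢ[ℂ] W}

/-- Multiplication by a function of the holonomies on the smooth space. -/
def fnEnd : smoothFun E G n g →ₐ[ℂ] Module.End ℂ (smoothSpace g E σ) where
  toFun F :=
    { toFun := fun ψ => ⟨fun v => F.1 (beta gμ v) • ψ.1 v,
        contMDiff_fun_smul (ContMDiff.comp (I' := powModel E (Loop n g)) F.2 contMDiff_beta) ψ.2.1,
        fun v k => by simp only [beta_rightMul, ψ.2.2.1 v k, map_smul], by
          obtain ⟨C, hC, h0⟩ := ψ.2.2.2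
          exact ⟨C, hC, fun v hv => by simp only [h0 v hv, smul_zero]⟩⟩
      map_add' := fun ψ φ => Subtype.ext (funext fun v => smul_add _ _ _)
      map_smul' := fun c ψ => Subtype.ext (funext fun v => smul_comm _ _ _) }
  map_one' := LinearMap.ext fun ψ => Subtype.ext (funext fun v => one_smul ℂ _)
  map_mul' F K := LinearMap.ext fun ψ => Subtype.ext (funext fun v => mul_smul _ _ _)
  map_zero' := LinearMap.ext fun ψ => Subtype.ext (funext fun v => zero_smul ℂ _)
  map_add' F K := LinearMap.ext fun ψ => Subtype.ext (funext fun v => add_smul _ _ _)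
  commutes' c := LinearMap.ext fun ψ => rfl

theorem flowDeriv_mem [IsTopologicalGroup G] [T2Space G] (X : Loop n g) (ξ : LieAlg E G)
    {ψ : Config G n g → W} (hψ : ψ ∈ smoothSpace g E σ) :
    flowDeriv (repFlow X) ξ ψ ∈ smoothSpace g E σ := by
  refine ⟨contMDiff_flowDeriv hψ.1 _ _, fun v k => ?_, ?_⟩
  · simp only [flowDeriv, repFlow_rightMul, hψ.2.1 _ k]
    exact derivOne_clm ((σ k⁻¹).toContinuousLinearMap.restrictScalars ℝ)
      (mdifferentiableAt_comp_flow hψ.1 _ v) ξ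
  · obtain ⟨C, hC, h0⟩ := hψ.2.2
    refine ⟨C, hC, fun v hv => ?_⟩
    have hcont : Continuous fun a : G => toBase gμ (repFlow (E := E) X (v, a)) :=
      continuous_toBase.comp ((repFlow (E := E) X).contMDiff.continuous.comp
        (continuous_const.prodMk continuous_id))
    -- The compact set is closed, so a point outside it stays outside under small flow elements and
    -- the derivative vanishes there: the same compact set serves.
    have hev : (fun a : G => ψ (repFlow (E := E) X (v, a))) =ᶠ[nhds 1] fun _ => 0 := by
      filter_upwards [hcont.continuousAt.preimage_mem_nhds (hC.isClosed.isOpen_compl.mem_nhds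
        (by rwa [repFlow_one]))] with a ha
      exact h0 _ ha
    exact (derivOne_congr hev ξ).trans (derivOne_const 0 ξ)

variable [IsTopologicalGroup G] [T2Space G] (ħ : ℝ)

/-- The action of the generators on the smooth space. -/
def genEnd (X : Loop n g) : LieAlg E G →ₗ[ℝ] Module.End ℂ (smoothSpace g E σ) where
  toFun ξ :=
    { toFun := fun ψ => ⟨(-(Complex.I * ħ)) • flowDeriv (repFlow X) ξ ψ.1,
        Submodule.smul_mem _ _ (flowDeriv_mem X ξ ψ.2)⟩
      map_add' := fun ψ φ => Subtype.ext ((congrArg _ (flowDeriv_add ψ.2.1 φ.2.1 _ ξ)).trans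
        (smul_add _ _ _))
      map_smul' := fun c ψ => Subtype.ext
        ((congrArg _ (flowDeriv_complex_smul ψ.2.1 _ ξ c)).trans (smul_comm _ _ _)) }
  map_add' ξ η := LinearMap.ext fun _ => Subtype.ext (funext fun _ =>
    (congrArg _ (derivOne_add_dir _ ξ η)).trans (smul_add _ _ _))
  map_smul' r ξ := LinearMap.ext fun _ => Subtype.ext (funext fun _ =>
    (congrArg _ (derivOne_smul_dir _ r ξ)).trans (smul_comm _ _ _))

theorem genEnd_val (X : Loop n g) (ξ : LieAlg E G) (ψ : smoothSpace g E σ) :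
    (genEnd ħ X ξ ψ).1 = (-(Complex.I * ħ)) • flowDeriv (repFlow X) ξ ψ.1 := rfl

theorem genEnd_genEnd_val (X Y : Loop n g) (ξ η : LieAlg E G) (ψ : smoothSpace g E σ) :
    (genEnd ħ X ξ (genEnd ħ Y η ψ)).1 = (-(Complex.I * ħ)) • (-(Complex.I * ħ)) •
      flowDeriv (repFlow X) ξ (flowDeriv (repFlow Y) η ψ.1) := by
  rw [genEnd_val, genEnd_val, flowDeriv_complex_smul (contMDiff_flowDeriv ψ.2.1 _ _)]

variable (n g E σ) in
/-- The representation of the flower algebra on the smooth space. -/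
def flowerRep [CompleteSpace E] :
    FlowerAlg E G n g ħ →ₐ[ℂ] Module.End ℂ (smoothSpace g E σ) :=
  flowerLift (A := Module.End ℂ (smoothSpace g E σ)) ħ (genEnd ħ) fnEnd
    (fun X ξ η => by
      refine LinearMap.ext fun ψ => Subtype.ext ?_
      change (genEnd ħ X ξ (genEnd ħ X η ψ)).1 - (genEnd ħ X η (genEnd ħ X ξ ψ)).1 =
        (-(Complex.I * ħ)) • (genEnd ħ X ⁅ξ, η⁆ ψ).1
      rw [genEnd_genEnd_val, genEnd_genEnd_val, genEnd_val, ← smul_sub, ← smul_sub,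
        flowDeriv_lie ψ.2.1 (repFlow_mul X)])
    (fun X Y hXY ξ η => by
      refine LinearMap.ext fun ψ => Subtype.ext ?_
      change (genEnd ħ X ξ (genEnd ħ Y η ψ)).1 = (genEnd ħ Y η (genEnd ħ X ξ ψ)).1
      rw [genEnd_genEnd_val, genEnd_genEnd_val, flowDeriv_comm ψ.2.1 (repFlow_comm hXY)])
    (fun X ξ F => by
      refine LinearMap.ext fun ψ => Subtype.ext (funext fun v => ?_)
      -- By the Leibniz rule the part differentiating `ψ` cancels in the commutator, leaving the
      -- derivative of `F ∘ β`, which by `beta_repFlow` is the flow derivative of `F` at `β(v)`.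
      have h := derivOne_fun_smul (χ := fun a => F.1 (beta gμ (repFlow (E := E) X (v, a))))
        (mdifferentiableAt_comp_flow
          (ContMDiff.comp (I' := powModel E (Loop n g)) F.2 contMDiff_beta) (repFlow X) v)
        (mdifferentiableAt_comp_flow ψ.2.1 (repFlow X) v) ξ
      simp only [repFlow_one, beta_repFlow] at h
      change (-(Complex.I * ħ)) • derivOne (fun a => F.1 (beta gμ (repFlow (E := E) X (v, a))) •
        ψ.1 (repFlow (E := E) X (v, a))) ξ - F.1 (beta gμ v) • (-(Complex.I * ħ)) •
          derivOne (fun a => ψ.1 (repFlow (E := E) X (v, a))) ξ = (Complex.I * ħ) •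
            (-derivOne (fun a => F.1 (flow (E := E) X (beta gμ v, a))) ξ) • ψ.1 v
      simp only [beta_repFlow]
      rw [h]
      module)

theorem isFlowerRep_flowerRep [CompleteSpace E] : IsFlowerRep ħ (flowerRep n g E σ ħ) where
  fn_apply F ψ v := by
    rw [flowerRep, flowerLift_fn]
    rfl
  gen_apply X ξ ψ v := by
    rw [flowerRep, flowerLift_gen]
    rfl

theorem IsFlowerRep.unique {P Q : FlowerAlg E G n g ħ →ₐ[ℂ] Module.End ℂ (smoothSpace g E σ)}
    (hP : IsFlowerRep ħ P) (hQ : IsFlowerRep ħ Q) : P = Q :=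
  flowerAlg_hom_ext
    (fun F => LinearMap.ext fun ψ => Subtype.ext (funext fun v =>
      (hP.fn_apply F ψ v).trans (hQ.fn_apply F ψ v).symm))
    (fun X ξ => LinearMap.ext fun ψ => Subtype.ext (funext fun v =>
      (hP.gen_apply X ξ ψ v).trans (hQ.gen_apply X ξ ψ v).symm))

end FlowerRepresentation

/-! ### Positivity and invariance of the measure on `Q`. -/

section Measures

variable {n g : ℕ} {G : Type*} [Group G] [TopologicalSpace G] [IsTopologicalGroup G]
  [LocallyCompactSpace G] [PolishSpace G] [MeasurableSpace G] [BorelSpace G] {gμ : Fin n → G}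

/-- Some member of a compact covering has positive measure. By transitivity finitely many translates
of a nonempty open set cover it, so that open set cannot be null. -/
theorem isOpenPosMeasure_quotient {i : Fin n} {m : Measure (G ⧸ stab gμ i)}
    [SMulInvariantMeasure G (G ⧸ stab gμ i) m] (hm : m ≠ 0) : m.IsOpenPosMeasure := by
  obtain ⟨k, hk⟩ := exists_pos_measure_of_cover (iUnion_compactCovering (G ⧸ stab gμ i)) hm
  exact ⟨fun U hU hne => (measure_isOpen_pos_of_smulInvariant_of_compact_ne_zero G
    (isCompact_compactCovering _ k) hk.ne' hU hne).ne'⟩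

variable {m : ∀ i, Measure (G ⧸ stab gμ i)} {μ : Measure G}

instance isFiniteMeasureOnCompacts_baseMeasure [∀ i, IsFiniteMeasureOnCompacts (m i)]
    [IsFiniteMeasureOnCompacts μ] : IsFiniteMeasureOnCompacts (baseMeasure (g := g) m μ) := by
  unfold baseMeasure
  infer_instance

theorem isOpenPosMeasure_baseMeasure [∀ i, IsFiniteMeasureOnCompacts (m i)]
    [∀ i, SMulInvariantMeasure G (G ⧸ stab gμ i) (m i)] (hm : ∀ i, m i ≠ 0) [μ.IsHaarMeasure] :
    (baseMeasure (g := g) m μ).IsOpenPosMeasure := by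
  have := fun i => isOpenPosMeasure_quotient (hm i)
  unfold baseMeasure
  infer_instance

/-- The action of `G` on `G/N₁ × ⋯ × G/Nₙ × G^{2g}`. -/
def baseAct (h : G) (q : Base g gμ) : Base g gμ :=
  (fun i => h • q.1 i, fun X => h * q.2 X * h⁻¹)

omit [TopologicalSpace G] [IsTopologicalGroup G] [LocallyCompactSpace G] [PolishSpace G]
  [MeasurableSpace G] [BorelSpace G] in
theorem toBase_adTwisted (h : G) (v : Config G n g) :
    toBase gμ (adTwisted h v) = baseAct h (toBase gμ v) := rfl

omit [LocallyCompactSpace G] [PolishSpace G] [MeasurableSpace G] [BorelSpace G] in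
theorem continuous_baseAct (h : G) : Continuous (baseAct (g := g) (gμ := gμ) h) := by
  refine Continuous.prodMk (continuous_pi fun i => ?_) (continuous_pi fun X => ?_)
  · exact ((continuous_apply i).comp continuous_fst).const_smul h
  · exact (continuous_const.mul ((continuous_apply X).comp continuous_snd)).mul continuous_const

/-- Conjugation on the handle factors is a left followed by a right translation, so both invariances
of the Haar measure are needed. -/
theorem measurePreserving_baseAct [∀ i, IsFiniteMeasureOnCompacts (m i)]
    [∀ i, SMulInvariantMeasure G (G ⧸ stab gμ i) (m i)] [μ.IsHaarMeasure] [μ.IsMulRightInvariant]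
    (h : G) : MeasurePreserving (baseAct (g := g) h) (baseMeasure m μ) (baseMeasure m μ) := by
  have : ∀ i, MeasurableConstSMul G (G ⧸ stab gμ i) := fun i =>
    ⟨fun c => (continuous_const_smul c).measurable⟩
  unfold baseMeasure
  exact (measurePreserving_pi m m fun i => measurePreserving_smul h (m i)).prod
    (measurePreserving_pi _ _ fun _ =>
      (measurePreserving_mul_right μ h⁻¹).comp (measurePreserving_mul_left μ h))

end Measures

/-! ### The unitary representation `Γ` and the class map. -/

section Gamma

variable {n g : ℕ} {E : Type*} [NormedAddCommGroup E] [NormedSpace ℝ E]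
  {G : Type*} [TopologicalSpace G] [ChartedSpace E G] [Group G] [LieGroup 𝓘(ℝ, E) ∞ G]
  {gμ : Fin n → G} {W : Type*} [NormedAddCommGroup W] [InnerProductSpace ℂ W]
  {σ : (∀ i, stab gμ i) → W →ₗᵢ[ℂ] W}

theorem beta_adTwisted (h : G) (v : Config G n g) :
    beta gμ (adTwisted h v) = conjAll h (beta gμ v) := by
  ext (i | X) <;> simp [beta, adTwisted, conjAll, mul_assoc]

theorem adTwisted_rightMul (h : G) (v : Config G n g) (k : ∀ i, stab gμ i) :
    adTwisted h (rightMul v k) = rightMul (adTwisted h v) k := by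
  ext (i | X) <;> simp [rightMul, adTwisted, mul_assoc]

theorem adTwisted_adTwisted (h k : G) (v : Config G n g) :
    adTwisted h (adTwisted k v) = adTwisted (h * k) v := by
  ext (i | X) <;> simp [adTwisted, mul_assoc]

theorem adTwisted_one (v : Config G n g) : adTwisted 1 v = v := by
  ext (i | X) <;> simp [adTwisted]

theorem contMDiff_adTwisted (h : G) :
    ContMDiff (powModel E (Loop n g)) (powModel E (Loop n g)) ∞ (adTwisted (n := n) (g := g) h) := by
  refine contMDiff_pow fun X => ?_
  rcases X with i | X
  · exact contMDiff_const.mul (contMDiff_coord _)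
  · exact (contMDiff_const.mul (contMDiff_coord _)).mul contMDiff_const

/-- The phase `exp(i f(u_tot) / ħ)`. -/
def phase (ħ : ℝ) (gμ : Fin n → G) (f : SmoothG E G) (v : Config G n g) : ℂ :=
  Complex.exp (Complex.I / ħ * (f (totalHol (E := E) (beta gμ v)) : ℝ))

variable (ħ : ℝ)

theorem gammaFun_apply (x : SymGroup E G) (ψ : Config G n g → W) (v : Config G n g) :
    gammaFun ħ gμ x ψ v = phase ħ gμ x.f v • ψ (adTwisted x.h⁻¹ v) := rfl

theorem norm_phase (f : SmoothG E G) (v : Config G n g) : ‖phase ħ gμ f v‖ = 1 := by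
  have : Complex.I / ħ * (f (totalHol (E := E) (beta gμ v)) : ℝ) =
      ((f (totalHol (E := E) (beta gμ v)) / ħ : ℝ) : ℂ) * Complex.I := by
    push_cast
    ring
  rw [phase, this, Complex.norm_exp_ofReal_mul_I]

theorem contMDiff_phase (f : SmoothG E G) :
    ContMDiff (powModel E (Loop n g)) 𝓘(ℝ, ℂ) ∞ (phase (n := n) (g := g) ħ gμ f) := by
  have h1 : ContDiff ℝ ∞ fun r : ℝ => Complex.exp (Complex.I / ħ * (r : ℂ)) :=
    (contDiff_const.mul Complex.ofRealCLM.contDiff).cexp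
  exact h1.contMDiff.comp (f.contMDiff.comp
    ((totalHol (E := E) (G := G) (n := n) (g := g)).contMDiff.comp contMDiff_beta))

theorem phase_rightMul (f : SmoothG E G) (v : Config G n g) (k : ∀ i, stab gμ i) :
    phase ħ gμ f (rightMul v k) = phase ħ gμ f v := by
  rw [phase, beta_rightMul, phase]

/-- `β` intertwines the twisted action with simultaneous conjugation, and the total holonomy is
equivariant. With `phase_add` this makes `Γ` multiplicative. -/
theorem phase_adTwisted (f : SmoothG E G) (h : G) (v : Config G n g) :
    phase ħ gμ f (adTwisted h⁻¹ v) = phase ħ gμ (conjG h f) v := by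
  rw [phase, beta_adTwisted, totalHol_conj, inv_inv]
  rfl

theorem phase_add (f f' : SmoothG E G) (v : Config G n g) :
    phase ħ gμ (f + f') v = phase ħ gμ f v * phase ħ gμ f' v := by
  rw [phase, phase, phase, ← Complex.exp_add, ← mul_add, ← Complex.ofReal_add]
  rfl

theorem phase_zero (v : Config G n g) : phase ħ gμ (0 : SmoothG E G) v = 1 := by
  have : (0 : SmoothG E G) (totalHol (E := E) (beta gμ v)) = 0 := rfl
  rw [phase, this, Complex.ofReal_zero, mul_zero, Complex.exp_zero]

theorem gammaFun_mul (x y : SymGroup E G) (ψ : Config G n g → W) :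
    gammaFun ħ gμ (x * y) ψ = gammaFun ħ gμ x (gammaFun ħ gμ y ψ) := by
  funext v
  rw [gammaFun_apply, gammaFun_apply, gammaFun_apply, phase_adTwisted, smul_smul, ← phase_add,
    adTwisted_adTwisted, symGroup_mul_f, symGroup_mul_h, mul_inv_rev]

theorem gammaFun_one (ψ : Config G n g → W) : gammaFun ħ gμ (1 : SymGroup E G) ψ = ψ := by
  funext v
  rw [gammaFun_apply, symGroup_one_f, symGroup_one_h, phase_zero, one_smul, inv_one, adTwisted_one]

theorem equivariant_gammaFun (x : SymGroup E G) {ψ : Config G n g → W} (hψ : Equivariant σ ψ) :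
    Equivariant σ (gammaFun ħ gμ x ψ) := fun v k => by
  rw [gammaFun_apply, gammaFun_apply, phase_rightMul, adTwisted_rightMul, hψ, map_smul]

theorem inner_gammaFun (x : SymGroup E G) (ψ φ : Config G n g → W) (v : Config G n g) :
    inner ℂ (gammaFun ħ gμ x ψ v) (gammaFun ħ gμ x φ v) =
      inner ℂ (ψ (adTwisted x.h⁻¹ v)) (φ (adTwisted x.h⁻¹ v)) := by
  rw [gammaFun_apply, gammaFun_apply, inner_smul_left, inner_smul_right, ← mul_assoc,
    ← Complex.normSq_eq_conj_mul_self, Complex.normSq_eq_norm_sq, norm_phase]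
  simp

/-- The action need not carry chosen representatives to chosen representatives, but the discrepancy
lies in the stabilisers, where invariant functions do not see it. -/
theorem comp_adTwisted_ofBase {β : Type*} {F : Config G n g → β}
    (hF : ∀ v (k : ∀ i, stab gμ i), F (rightMul v k) = F v) (h : G) (q : Base g gμ) :
    F (adTwisted h (ofBase gμ q)) = F (ofBase gμ (baseAct h q)) := by
  obtain ⟨k, hk⟩ := exists_rightMul (gμ := gμ) (adTwisted h (ofBase gμ q))
  rw [toBase_adTwisted, toBase_ofBase] at hk
  rw [hk, hF]

theorem gammaFun_mem_smoothSpace [IsTopologicalGroup G] (x : SymGroup E G) {ψ : Config G n g → W}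
    (hψ : ψ ∈ smoothSpace g E σ) : gammaFun ħ gμ x ψ ∈ smoothSpace g E σ := by
  refine ⟨contMDiff_fun_smul (contMDiff_phase ħ x.f) (hψ.1.comp (contMDiff_adTwisted _)),
    equivariant_gammaFun ħ x hψ.2.1, ?_⟩
  obtain ⟨C, hC, h0⟩ := hψ.2.2
  -- The argument is moved by `h⁻¹`, so the support is moved by `h`.
  refine ⟨baseAct x.h '' C, hC.image (continuous_baseAct _), fun v hv => ?_⟩
  rw [gammaFun_apply, h0, smul_zero]
  intro hmem
  refine hv ⟨_, hmem, ?_⟩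
  rw [← toBase_adTwisted, adTwisted_adTwisted, mul_inv_cancel, adTwisted_one]

variable [T2Space G] [SecondCountableTopology G] [MeasurableSpace G] [BorelSpace G]
  [FiniteDimensional ℝ E] [IsTopologicalGroup G] [LocallyCompactSpace G] [PolishSpace G]
  {m : ∀ i, Measure (G ⧸ stab gμ i)} {μ : Measure G}
  [∀ i, SMulInvariantMeasure G (G ⧸ stab gμ i) (m i)] [∀ i, IsFiniteMeasureOnCompacts (m i)]
  [μ.IsHaarMeasure] [μ.IsMulRightInvariant]

theorem gammaFun_mem_l2Space (x : SymGroup E G) {ψ : Config G n g → W}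
    (hψ : ψ ∈ l2Space (g := g) E σ m μ) : gammaFun ħ gμ x ψ ∈ l2Space (g := g) E σ m μ := by
  refine ⟨?_, equivariant_gammaFun ħ x hψ.2.1, ?_⟩
  · exact (contMDiff_phase ħ x.f).continuous.stronglyMeasurable.smul
      (hψ.1.comp_measurable (contMDiff_adTwisted (E := E) _).continuous.measurable)
  · have hinv : ∀ v (k : ∀ i, stab gμ i), ‖ψ (rightMul v k)‖ₑ ^ 2 = ‖ψ v‖ₑ ^ 2 := fun v k => by
      rw [hψ.2.1.enorm_rightMul]
    have h1 : ∀ q, ‖gammaFun ħ gμ x ψ (ofBase gμ q)‖ₑ ^ 2 =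
        ‖ψ (ofBase gμ (baseAct x.h⁻¹ q))‖ₑ ^ 2 := fun q => by
      rw [gammaFun_apply, enorm_smul, ← ofReal_norm (phase _ _ _ _), norm_phase, ENNReal.ofReal_one,
        one_mul]
      exact comp_adTwisted_ofBase (F := fun v => ‖ψ v‖ₑ ^ 2) hinv _ q
    simp only [h1]
    rw [(measurePreserving_baseAct x.h⁻¹).lintegral_comp (f := fun q => ‖ψ (ofBase gμ q)‖ₑ ^ 2)
      (measurable_comp_ofBase E (hψ.1.enorm.pow_const 2) hinv)]
    exact hψ.2.2

/-- The operators `Γ(h, f)` on the square integrable functions. -/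
def gammaL2 (x : SymGroup E G) : L2 g E σ m μ →ₗᵢ[ℂ] L2 g E σ m μ :=
  LinearMap.isometryOfInner
    { toFun := fun ψ => ⟨gammaFun ħ gμ x ψ.1, gammaFun_mem_l2Space ħ x ψ.2⟩
      map_add' := fun _ _ => Subtype.ext (funext fun _ => smul_add _ _ _)
      map_smul' := fun _ _ => Subtype.ext (funext fun _ => smul_comm _ _ _) }
    fun ψ φ => by
      change ∫ q, inner ℂ (gammaFun ħ gμ x ψ.1 (ofBase gμ q)) (gammaFun ħ gμ x φ.1 (ofBase gμ q))
        ∂baseMeasure m μ = ∫ q, inner ℂ (ψ.1 (ofBase gμ q)) (φ.1 (ofBase gμ q)) ∂baseMeasure m μ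
      have hinv : ∀ v (k : ∀ i, stab gμ i), inner ℂ (ψ.1 (rightMul v k)) (φ.1 (rightMul v k)) =
          inner ℂ (ψ.1 v) (φ.1 v) := fun v k => by
        rw [ψ.2.2.1, φ.2.2.1, LinearIsometry.inner_map_map]
      have hT := measurePreserving_baseAct (g := g) (m := m) (μ := μ) x.h⁻¹
      simp only [inner_gammaFun]
      simp only [comp_adTwisted_ofBase (F := fun v => inner ℂ (ψ.1 v) (φ.1 v)) hinv]
      conv_rhs => rw [← hT.map_eq]
      rw [integral_map hT.measurable.aemeasurable]
      rw [hT.map_eq]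
      exact (L2.integrable_inner ψ φ).aestronglyMeasurable

theorem gammaL2_mul (x y : SymGroup E G) (ψ : L2 g E σ m μ) :
    gammaL2 ħ (x * y) ψ = gammaL2 ħ x (gammaL2 ħ y ψ) := Subtype.ext (gammaFun_mul ħ x y ψ.1)

theorem gammaL2_one (ψ : L2 g E σ m μ) : gammaL2 ħ (1 : SymGroup E G) ψ = ψ :=
  Subtype.ext (gammaFun_one ħ ψ.1)

/-- The operators `Γ(h, f)` on the representation space. -/
def gammaLin (x : SymGroup E G) : RepSpace g E σ m μ →ₗ[ℂ] RepSpace g E σ m μ where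
  toFun := SeparationQuotient.lift (fun ψ => SeparationQuotient.mk (gammaL2 ħ x ψ)) fun _ _ h =>
    SeparationQuotient.mk_eq_mk.2 (h.map (gammaL2 ħ x).continuous)
  map_add' a b := by
    obtain ⟨ψ, rfl⟩ := SeparationQuotient.surjective_mk a
    obtain ⟨φ, rfl⟩ := SeparationQuotient.surjective_mk b
    exact congrArg SeparationQuotient.mk (map_add (gammaL2 ħ x) ψ φ)
  map_smul' c a := by
    obtain ⟨ψ, rfl⟩ := SeparationQuotient.surjective_mk a
    exact congrArg SeparationQuotient.mk (map_smul (gammaL2 ħ x) c ψ)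

theorem gammaLin_mk (x : SymGroup E G) (ψ : L2 g E σ m μ) :
    gammaLin ħ x (SeparationQuotient.mk ψ : RepSpace g E σ m μ) =
      SeparationQuotient.mk (gammaL2 ħ x ψ) := rfl

theorem gammaLin_comp (x y : SymGroup E G) :
    (gammaLin ħ x).comp (gammaLin ħ y) = (gammaLin ħ (x * y) : RepSpace g E σ m μ →ₗ[ℂ] _) := by
  refine LinearMap.ext fun a => ?_
  obtain ⟨ψ, rfl⟩ := SeparationQuotient.surjective_mk a
  rw [LinearMap.comp_apply, gammaLin_mk, gammaLin_mk, gammaLin_mk, gammaL2_mul]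

theorem gammaLin_one : (gammaLin ħ 1 : RepSpace g E σ m μ →ₗ[ℂ] _) = LinearMap.id := by
  refine LinearMap.ext fun a => ?_
  obtain ⟨ψ, rfl⟩ := SeparationQuotient.surjective_mk a
  rw [gammaLin_mk, gammaL2_one, LinearMap.id_apply]

variable (g E σ m μ) in
/-- The unitary representation `Γ`. -/
def gammaRep : SymGroup E G →* (RepSpace g E σ m μ ≃ₗᵢ[ℂ] RepSpace g E σ m μ) where
  toFun x :=
    { toLinearEquiv := LinearEquiv.ofLinearMap (gammaLin ħ x) (gammaLin ħ x⁻¹)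
        (by rw [gammaLin_comp, mul_inv_cancel, gammaLin_one])
        (by rw [gammaLin_comp, inv_mul_cancel, gammaLin_one])
      norm_map' := fun a => by
        obtain ⟨ψ, rfl⟩ := SeparationQuotient.surjective_mk a
        change ‖gammaLin ħ x _‖ = _
        rw [gammaLin_mk, SeparationQuotient.norm_mk, SeparationQuotient.norm_mk,
          LinearIsometry.norm_map] }
  map_one' := LinearIsometryEquiv.ext fun a => DFunLike.congr_fun (gammaLin_one ħ) a
  map_mul' x y := LinearIsometryEquiv.ext fun a =>
    (DFunLike.congr_fun (gammaLin_comp ħ x y) a).symm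

theorem isGamma_gammaRep : IsGamma ħ (gammaRep g E σ ħ m μ) :=
  fun x ψ => ⟨gammaL2 ħ x ψ, rfl, rfl⟩

theorem IsGamma.unique {Γ Γ' : SymGroup E G →* (RepSpace g E σ m μ ≃ₗᵢ[ℂ] RepSpace g E σ m μ)}
    (h : IsGamma ħ Γ) (h' : IsGamma ħ Γ') : Γ = Γ' := by
  refine MonoidHom.ext fun x => LinearIsometryEquiv.ext fun a => ?_
  obtain ⟨ψ, rfl⟩ := SeparationQuotient.surjective_mk a
  obtain ⟨φ, h1, h2⟩ := h x ψ
  obtain ⟨φ', h1', h2'⟩ := h' x ψ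
  rw [h2, h2', Subtype.ext (h1.trans h1'.symm : φ.1 = φ'.1)]

omit [SecondCountableTopology G] [MeasurableSpace G] [BorelSpace G] [FiniteDimensional ℝ E]
  [LocallyCompactSpace G] [PolishSpace G] [T2Space G] in
theorem continuous_norm_sq_comp_ofBase {ψ : Config G n g → W} (hψ : ψ ∈ smoothSpace g E σ) :
    Continuous fun q : Base g gμ => ‖ψ (ofBase gμ q)‖ ^ 2 :=
  continuous_comp_ofBase (F := fun v => ‖ψ v‖ ^ 2) (hψ.1.continuous.norm.pow 2) fun v k => by
    rw [hψ.2.1, LinearIsometry.norm_map]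

omit [SecondCountableTopology G] [MeasurableSpace G] [BorelSpace G] [FiniteDimensional ℝ E]
  [LocallyCompactSpace G] [PolishSpace G] in
theorem hasCompactSupport_norm_sq_comp_ofBase {ψ : Config G n g → W}
    (hψ : ψ ∈ smoothSpace g E σ) :
    HasCompactSupport fun q : Base g gμ => ‖ψ (ofBase gμ q)‖ ^ 2 := by
  obtain ⟨C, hC, h0⟩ := hψ.2.2
  refine HasCompactSupport.intro hC fun q hq => ?_
  rw [h0 _ (by rwa [toBase_ofBase]), norm_zero, zero_pow two_ne_zero]

theorem integrable_norm_sq_comp_ofBase {ψ : Config G n g → W} (hψ : ψ ∈ smoothSpace g E σ) :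
    Integrable (fun q : Base g gμ => ‖ψ (ofBase gμ q)‖ ^ 2) (baseMeasure m μ) :=
  (continuous_norm_sq_comp_ofBase hψ).integrable_of_hasCompactSupport
    (hasCompactSupport_norm_sq_comp_ofBase hψ)

theorem mem_l2Space_of_mem_smoothSpace {ψ : Config G n g → W} (hψ : ψ ∈ smoothSpace g E σ) :
    ψ ∈ l2Space (g := g) E σ m μ := by
  refine ⟨hψ.1.continuous.stronglyMeasurable, hψ.2.1, ?_⟩
  have h := (integrable_norm_sq_comp_ofBase (m := m) (μ := μ) hψ).2
  refine (lintegral_congr fun q => ?_).trans_lt h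
  rw [enorm_pow, enorm_norm]

variable (g E σ m μ) in
/-- The inclusion of the smooth space into the square integrable functions. -/
def smoothToL2 : smoothSpace g E σ →ₗ[ℂ] L2 g E σ m μ where
  toFun ψ := ⟨ψ.1, mem_l2Space_of_mem_smoothSpace ψ.2⟩
  map_add' _ _ := rfl
  map_smul' _ _ := rfl

variable (g E σ m μ) in
/-- The map from the smooth space to the representation space. -/
def classMap : smoothSpace g E σ →ₗ[ℂ] RepSpace g E σ m μ :=
  (SeparationQuotient.mkCLM ℂ (L2 g E σ m μ)).toLinearMap.comp (smoothToL2 g E σ m μ)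

theorem isClassMap_classMap : IsClassMap g E σ m μ (classMap g E σ m μ) :=
  fun ψ => ⟨smoothToL2 g E σ m μ ψ, rfl, rfl⟩

theorem IsClassMap.eq {ι : smoothSpace g E σ →ₗ[ℂ] RepSpace g E σ m μ}
    (h : IsClassMap g E σ m μ ι) : ι = classMap g E σ m μ := by
  refine LinearMap.ext fun ψ => ?_
  obtain ⟨φ, h1, h2⟩ := h ψ
  rw [h2, (Subtype.ext h1 : φ = smoothToL2 g E σ m μ ψ)]
  rfl

theorem inner_smoothToL2 (ψ φ : smoothSpace g E σ) :
    (inner ℂ (smoothToL2 g E σ m μ ψ) (smoothToL2 g E σ m μ φ) : ℂ) =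
      ∫ q, inner ℂ (ψ.1 (ofBase gμ q)) (φ.1 (ofBase gμ q)) ∂baseMeasure m μ := rfl

/-- The squared norm of `ψ` descends to a continuous, compactly supported, nonnegative function on
`Q`. If its integral is zero it vanishes, because the measure charges open sets. -/
theorem injective_classMap (hm : ∀ i, m i ≠ 0) : Function.Injective (classMap g E σ m μ) := by
  rw [injective_iff_map_eq_zero]
  intro ψ hψ
  have := isOpenPosMeasure_baseMeasure (g := g) (μ := μ) hm
  have h1 : ‖smoothToL2 g E σ m μ ψ‖ = 0 := by
    rw [← SeparationQuotient.norm_mk]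
    exact (congrArg norm hψ).trans norm_zero
  have h2 : (inner ℂ (smoothToL2 g E σ m μ ψ) (smoothToL2 g E σ m μ ψ) : ℂ) = 0 := by
    rw [inner_self_eq_norm_sq_to_K, h1]
    simp
  have h3 : ∫ q, ‖ψ.1 (ofBase gμ q)‖ ^ 2 ∂baseMeasure m μ = 0 := by
    have h (q) : inner ℂ (ψ.1 (ofBase gμ q)) (ψ.1 (ofBase gμ q)) =
        ((‖ψ.1 (ofBase gμ q)‖ ^ 2 : ℝ) : ℂ) := by
      rw [inner_self_eq_norm_sq_to_K]
      simp
    rw [inner_smoothToL2] at h2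
    simp only [h] at h2
    rwa [integral_complex_ofReal, Complex.ofReal_eq_zero] at h2
  have h4 : ∀ q, ψ.1 (ofBase gμ q) = 0 := fun q => by
    by_contra hq
    refine ((continuous_norm_sq_comp_ofBase ψ.2).integral_pos_of_hasCompactSupport_nonneg_nonzero
      (μ := baseMeasure m μ) (x := q) (hasCompactSupport_norm_sq_comp_ofBase ψ.2)
      (fun q => by positivity) ?_).ne' h3
    exact pow_ne_zero _ (norm_ne_zero_iff.2 hq)
  refine Subtype.ext (funext fun v => ?_)
  -- So far `ψ` is zero only at chosen representatives; equivariance and injectivity of `σ k⁻¹`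
  -- spread this to the whole fibre.
  obtain ⟨k, hk⟩ := exists_rightMul (gμ := gμ) v
  have h5 := h4 (toBase gμ v)
  rw [hk, ψ.2.2.1] at h5
  exact (σ k⁻¹).injective (h5.trans (map_zero _).symm)

end Gamma

/-! ### `Γ` implements the quantum action. -/

section Intertwining

variable {n g : ℕ} {E : Type*} [NormedAddCommGroup E] [NormedSpace ℝ E]
  {G : Type*} [TopologicalSpace G] [ChartedSpace E G] [Group G] [LieGroup 𝓘(ℝ, E) ∞ G]
  {gμ : Fin n → G} {W : Type*} [NormedAddCommGroup W] [InnerProductSpace ℂ W]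
  {σ : (∀ i, stab gμ i) → W →ₗᵢ[ℂ] W}

theorem derivOne_cexp {c : G → ℂ} (hc : MDifferentiableAt 𝓘(ℝ, E) 𝓘(ℝ, ℂ) c 1) (z : ℂ)
    (ξ : LieAlg E G) :
    derivOne (fun a => Complex.exp (z * c a)) ξ = Complex.exp (z * c 1) * (z * derivOne c ξ) := by
  have h := ((((hasDerivAt_id (c 1)).const_mul z).cexp).hasFDerivAt.restrictScalars ℝ).hasMFDerivAt
  refine (DFunLike.congr_fun (h.comp (1 : G) hc.hasMFDerivAt).mfderiv ξ).trans ?_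
  change derivOne c ξ * (Complex.exp (z * c 1) * (z * 1)) = _
  ring

theorem adTwisted_repFlow (X : Loop n g) (h : G) (v : Config G n g) (a : G) :
    adTwisted h (repFlow (E := E) X (v, a)) =
      repFlow (E := E) X (adTwisted h v, h * a * h⁻¹) := by
  rcases X with i | k | k <;>
  · ext (Z | Z) <;>
    simp only [repFlow, leftFlow, handleFlow, rightFlow, ContMDiffMap.coeFn_mk,
      Function.update_apply, adTwisted] <;>
    split_ifs <;> simp_all [mul_assoc]

variable (ħ : ℝ)

theorem phase_eq_charge (f : SmoothG E G) (v : Config G n g) :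
    phase ħ gμ f v = Complex.exp (Complex.I / ħ * (charge f).1 (beta gμ v)) := rfl

theorem derivOne_phase (f : SmoothG E G) (X : Loop n g) (v : Config G n g) (ξ : LieAlg E G) :
    derivOne (fun a => phase ħ gμ f (repFlow (E := E) X (v, a))) ξ =
      phase ħ gμ f v * (Complex.I / ħ * -(pb X ξ (charge f)).1 (beta gμ v)) := by
  simp only [phase_eq_charge, beta_repFlow]
  rw [derivOne_cexp (mdifferentiableAt_comp_flow (charge f).2 (flow X) (beta gμ v)),
    ← beta_repFlow, repFlow_one, pb_val, Pi.neg_apply, neg_neg]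
  rfl

variable [IsTopologicalGroup G]

/-- The operators `Γ(h, f)` on the smooth space. -/
def gammaSmooth (x : SymGroup E G) : smoothSpace g E σ →ₗ[ℂ] smoothSpace g E σ where
  toFun ψ := ⟨gammaFun ħ gμ x ψ.1, gammaFun_mem_smoothSpace ħ x ψ.2⟩
  map_add' _ _ := Subtype.ext (funext fun _ => smul_add _ _ _)
  map_smul' _ _ := Subtype.ext (funext fun _ => smul_comm _ _ _)

theorem gammaSmooth_comp (x y : SymGroup E G) :
    (gammaSmooth ħ x).comp (gammaSmooth ħ y) =
      (gammaSmooth ħ (x * y) : smoothSpace g E σ →ₗ[ℂ] smoothSpace g E σ) :=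
  LinearMap.ext fun ψ => Subtype.ext (gammaFun_mul ħ x y ψ.1).symm

theorem gammaSmooth_one :
    (gammaSmooth ħ 1 : smoothSpace g E σ →ₗ[ℂ] smoothSpace g E σ) = LinearMap.id :=
  LinearMap.ext fun ψ => Subtype.ext (gammaFun_one ħ ψ.1)

/-- The operators `Γ(h, f)` on the smooth space, as linear equivalences. -/
def gammaSmoothEquiv (x : SymGroup E G) : smoothSpace g E σ ≃ₗ[ℂ] smoothSpace g E σ :=
  LinearEquiv.ofLinearMap (gammaSmooth ħ x) (gammaSmooth ħ x⁻¹)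
    (by rw [gammaSmooth_comp, mul_inv_cancel, gammaSmooth_one])
    (by rw [gammaSmooth_comp, inv_mul_cancel, gammaSmooth_one])

variable [T2Space G] [FiniteDimensional ℝ E] [CompleteSpace E]

theorem flowerRep_actionHom_fn (x : SymGroup E G) (F : smoothFun E G n g)
    (ψ : smoothSpace g E σ) :
    flowerRep n g E σ ħ (actionHom ħ x (fn ħ F)) (gammaSmooth ħ x ψ) =
      gammaSmooth ħ x (flowerRep n g E σ ħ (fn ħ F) ψ) := by
  refine Subtype.ext (funext fun v => ?_)
  rw [actionHom_fn, (isFlowerRep_flowerRep ħ).fn_apply]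
  change F.1 (fun X => x.h⁻¹ * beta gμ v X * x.h) • phase ħ gμ x.f v • ψ.1 (adTwisted x.h⁻¹ v) =
    phase ħ gμ x.f v • (flowerRep n g E σ ħ (fn ħ F) ψ).1 (adTwisted x.h⁻¹ v)
  rw [(isFlowerRep_flowerRep ħ).fn_apply, smul_comm, beta_adTwisted]
  unfold conjAll
  rw [inv_inv]

/-- In `Π(t)(phase · ψ)` the derivative of the phase is a multiple of `{t, f ∘ Φ_∞}`, which cancels
the function added by the quantum action. The derivative of `ψ` turns its direction `Ad(h) ξ` back
into `ξ` by passing through the twisted conjugation. -/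
theorem flowerRep_actionHom_gen (hħ : ħ ≠ 0) (x : SymGroup E G) (X : Loop n g) (ξ : LieAlg E G)
    (ψ : smoothSpace g E σ) :
    flowerRep n g E σ ħ (actionHom ħ x (gen ħ X ξ)) (gammaSmooth ħ x ψ) =
      gammaSmooth ħ x (flowerRep n g E σ ħ (gen ħ X ξ) ψ) := by
  refine Subtype.ext (funext fun v => ?_)
  rw [actionHom_gen, map_add]
  change (flowerRep n g E σ ħ (gen ħ X (Ad x.h ξ)) (gammaSmooth ħ x ψ)).1 v +
    (flowerRep n g E σ ħ (fn ħ (pb X (Ad x.h ξ) (charge x.f))) (gammaSmooth ħ x ψ)).1 v =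
    phase ħ gμ x.f v • (flowerRep n g E σ ħ (gen ħ X ξ) ψ).1 (adTwisted x.h⁻¹ v)
  rw [(isFlowerRep_flowerRep ħ).fn_apply, (isFlowerRep_flowerRep ħ).gen_apply,
    (isFlowerRep_flowerRep ħ).gen_apply]
  change (-(Complex.I * ħ)) • derivOne (fun a => phase ħ gμ x.f (repFlow (E := E) X (v, a)) •
      ψ.1 (adTwisted x.h⁻¹ (repFlow (E := E) X (v, a)))) (Ad x.h ξ) +
    (pb X (Ad x.h ξ) (charge x.f)).1 (beta gμ v) •
      phase ħ gμ x.f v • ψ.1 (adTwisted x.h⁻¹ v) = _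
  have h1 := derivOne_conj (mdifferentiableAt_comp_flow ψ.2.1 (repFlow X) (adTwisted x.h⁻¹ v))
    x.h⁻¹ (Ad x.h ξ)
  rw [← Ad_mul, inv_mul_cancel, Ad_one] at h1
  simp only [← adTwisted_repFlow] at h1
  have h2 := derivOne_fun_smul (mdifferentiableAt_comp_flow (contMDiff_phase (gμ := gμ) ħ x.f)
    (repFlow X) v) (mdifferentiableAt_comp_flow (ψ.2.1.comp (contMDiff_adTwisted x.h⁻¹))
      (repFlow X) v) (Ad x.h ξ)
  simp only [Function.comp_apply] at h2
  rw [h2, h1, derivOne_phase, repFlow_one]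
  have h3 : (ħ : ℂ) ≠ 0 := by exact_mod_cast hħ
  -- The prefactor of the generator and the exponent of the phase are matched so that their product
  -- is one; `ħ ≠ 0` is needed here.
  have h4 : -(Complex.I * ħ) * (Complex.I / ħ) = 1 := by
    field_simp
    simp
  generalize (pb X (Ad x.h ξ) (charge x.f)).1 (beta gμ v) = c
  rw [smul_add, smul_smul _ (phase ħ gμ x.f v * _)]
  have h5 : -(Complex.I * ħ) * (phase ħ gμ x.f v * (Complex.I / ħ * -c)) =
      -(c * phase ħ gμ x.f v) := by
    linear_combination (-(c * phase ħ gμ x.f v)) * h4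
  rw [h5]
  module

theorem flowerRep_actionHom (hħ : ħ ≠ 0) (x : SymGroup E G) (Z : FlowerAlg E G n g ħ)
    (ψ : smoothSpace g E σ) :
    flowerRep n g E σ ħ (actionHom ħ x Z) (gammaSmooth ħ x ψ) =
      gammaSmooth ħ x (flowerRep n g E σ ħ Z ψ) := by
  -- Conjugation by `Γ(h, f)` is an algebra automorphism of the endomorphisms, so both sides are
  -- algebra homomorphisms and agreement on functions and decoupled generators is enough.
  have key : (flowerRep n g E σ ħ).comp (actionHom ħ x) =
      ((gammaSmoothEquiv ħ x).conjAlgEquiv ℂ).toAlgHom.comp (flowerRep n g E σ ħ) := by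
    refine flowerAlg_hom_ext (fun F => LinearMap.ext fun φ => ?_)
      fun X ξ => LinearMap.ext fun φ => ?_
    · have h := flowerRep_actionHom_fn ħ x F ((gammaSmoothEquiv ħ x).symm φ)
      exact (congrArg _ ((gammaSmoothEquiv ħ x).apply_symm_apply φ).symm).trans h
    · have h := flowerRep_actionHom_gen ħ hħ x X ξ ((gammaSmoothEquiv ħ x).symm φ)
      exact (congrArg _ ((gammaSmoothEquiv ħ x).apply_symm_apply φ).symm).trans h
  refine (DFunLike.congr_fun (DFunLike.congr_fun key Z) _).trans ?_
  exact congrArg (fun φ => gammaSmooth ħ x (flowerRep n g E σ ħ Z φ))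
    ((gammaSmoothEquiv ħ x).symm_apply_apply ψ)

variable [SecondCountableTopology G] [MeasurableSpace G] [BorelSpace G] [LocallyCompactSpace G]
  [PolishSpace G] {m : ∀ i, Measure (G ⧸ stab gμ i)} {μ : Measure G}
  [∀ i, SMulInvariantMeasure G (G ⧸ stab gμ i) (m i)] [∀ i, IsFiniteMeasureOnCompacts (m i)]
  [μ.IsHaarMeasure] [μ.IsMulRightInvariant]

theorem gammaRep_classMap (x : SymGroup E G) (ψ : smoothSpace g E σ) :
    gammaRep g E σ ħ m μ x (classMap g E σ m μ ψ) = classMap g E σ m μ (gammaSmooth ħ x ψ) := rfl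

end Intertwining

end FlowerAlgebra
end

theorem mainTheorem8 {E : Type*} [NormedAddCommGroup E] [NormedSpace ℝ E] [FiniteDimensional ℝ E]
    {G : Type*} [TopologicalSpace G] [ChartedSpace E G] [Group G] [LieGroup 𝓘(ℝ, E) ∞ G]
    [T2Space G] [SecondCountableTopology G] [MeasurableSpace G] [BorelSpace G]
    (μ : Measure G) [μ.IsHaarMeasure] [μ.IsMulRightInvariant]
    {n g : ℕ} (ħ : ℝ) (hħ : ħ ≠ 0) (gμ : Fin n → G)
    (m : ∀ i, Measure (G ⧸ stab gμ i)) [∀ i, SMulInvariantMeasure G (G ⧸ stab gμ i) (m i)]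
    [∀ i, IsFiniteMeasureOnCompacts (m i)] (hm : ∀ i, m i ≠ 0)
    {V : Fin n → Type*} [∀ i, NormedAddCommGroup (V i)] [∀ i, InnerProductSpace ℂ (V i)]
    [∀ i, CompleteSpace (V i)] (S : ∀ i, stab gμ i →* (V i ≃ₗᵢ[ℂ] V i))
    (hS : ∀ i x, Continuous fun k => S i k x) :
    ∃ ι : smoothSpace g E (tensorRep S) →ₗ[ℂ] RepSpace g E (tensorRep S) m μ,
      IsClassMap g E (tensorRep S) m μ ι ∧ Function.Injective ι ∧
      (∃! P : FlowerAlg E G n g ħ →ₐ[ℂ] Module.End ℂ (smoothSpace g E (tensorRep S)),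
        IsFlowerRep ħ P) ∧
      (∃! τ : SymGroup E G →* (FlowerAlg E G n g ħ ≃ₐ[ℂ] FlowerAlg E G n g ħ),
        IsQuantumAction ħ τ) ∧
      (∃! Γ : SymGroup E G →*
          (RepSpace g E (tensorRep S) m μ ≃ₗᵢ[ℂ] RepSpace g E (tensorRep S) m μ),
        IsGamma ħ Γ) ∧
      ∀ P τ Γ, IsFlowerRep ħ P → IsQuantumAction ħ τ → IsGamma ħ Γ →
        ∀ x : SymGroup E G,
          (∀ ψ, ∃ ψ', Γ x (ι ψ) = ι ψ') ∧
          ∀ (Z : FlowerAlg E G n g ħ) ψ, ∃ ψ', Γ x⁻¹ (ι ψ) = ι ψ' ∧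
            ι (P (τ x Z) ψ) = Γ x (ι (P Z ψ')) := by
  have := topologicalGroup_of_lieGroup 𝓘(ℝ, E) ∞ (G := G)
  have := Manifold.locallyCompact_of_finiteDimensional (M := G) 𝓘(ℝ, E)
  have := polishSpace_of_lieGroup (G := G) E
  have := FiniteDimensional.complete ℝ E
  refine ⟨classMap g E (tensorRep S) m μ, isClassMap_classMap, injective_classMap hm,
    ⟨flowerRep n g E (tensorRep S) ħ, isFlowerRep_flowerRep ħ,
      fun P hP => hP.unique ħ (isFlowerRep_flowerRep ħ)⟩,
    ⟨quantumAction E G n g ħ, isQuantumAction_quantumAction ħ, fun τ hτ => hτ.eq ħ⟩,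
    ⟨gammaRep g E (tensorRep S) ħ m μ, isGamma_gammaRep ħ,
      fun Γ hΓ => hΓ.unique ħ (isGamma_gammaRep ħ)⟩, ?_⟩
  intro P τ Γ hP hτ hΓ x
  -- Uniqueness reduces arbitrary `P`, `τ`, `Γ` to the constructed ones. The witness for `ψ'` is
  -- then `Γ(x)⁻¹ ψ` formed inside the smooth space.
  rw [hP.unique ħ (isFlowerRep_flowerRep ħ), hτ.eq ħ, hΓ.unique ħ (isGamma_gammaRep ħ)]
  refine ⟨fun ψ => ⟨gammaSmooth ħ x ψ, gammaRep_classMap ħ x ψ⟩, fun Z ψ =>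
    ⟨gammaSmooth ħ x⁻¹ ψ, gammaRep_classMap ħ x⁻¹ ψ, ?_⟩⟩
  rw [gammaRep_classMap, ← flowerRep_actionHom ħ hħ, quantumAction_apply]
  congr 2
  exact ((gammaSmoothEquiv ħ x).apply_symm_apply ψ).symm
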